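/- Let $0\le g_{\mathrm{in}}\in L^1(\mathbb{R}^3)$ and write $g_{\mathrm{in}}(p)=\mathfrak{g}_{\mathrm{in}}(q,\omega)$ in spherical coordinates $q=|p|>0$, $\omega=p/q\in S^2$. Consider the ultra-relativistic Fokker--Planck equation $$\partial_t g=\mathcal{L}g:=\partial_{p^i}\Big(\frac{p^ip^j}{|p|}\,\partial_{p^j}g\Big),\qquad t>0,\ p\in\mathbb{R}^3,\qquad g(0,p)=g_{\mathrm{in}}(p) \tag{1}$$ (summation over $i,j\in\{1,2,3\}$). For a class $\mathcal{T}$ of test functions, a function $g\in L^\infty((0,\infty);L^1(\mathbb{R}^3))$ is called a weak solution of (1) with respect to $\mathcal{T}$ if $$\int_0^\infty\!\!\int_{\mathbb{R}^3} g\,(\partial_t\varphi+\mathcal{L}\varphi)\,dp\,dt+\int_{\mathbb{R}^3}g_{\mathrm{in}}(p)\,\varphi(0,p)\,dp=0\qquad\text{for all }\varphi\in\mathcal{T}.$$ Let $\mathcal{T}_{\mathrm{sph}}$ be the class of functions $\varphi(t,p)=\psi(t,|p|,p/|p|)$ with $\psi\in C_c^\infty([0,\infty)\times[0,\infty)\times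 S^2)$, and let $\mathcal{T}_{\mathrm{c}}=C_c^\infty([0,\infty)\times\mathbb{R}^3)$; away from $p=0$ every element of $\mathcal{T}_{\mathrm{c}}$ agrees with an element of $\mathcal{T}_{\mathrm{sph}}$. For $t>0$ and almost every $p$ define $g(t,p)=\mathfrak{g}(t,q,\omega)$ by $$\mathfrak{g}(t,q,\omega)=\frac{e^{-q/t}}{tq}\int_0^\infty \mathfrak{g}_{\mathrm{in}}(z,\omega)\,z\,e^{-z/t}\,\mathcal{I}_2\Big[\frac{2\sqrt{q}\sqrt{z}}{t}\Big]\,dz, \tag{2}$$ where $\mathcal{I}_2[x]=\sum_{k\ge0}\frac{(x/2)^{2k+2}}{k!\,(k+2)!}$ is the modified Bessel function of the first kind of order $2$. Then: 1. For every $t>0$, the integral in (2) converges absolutely and $g(t,p)\ge0$ for almost every $p$. 2. $g\in L^\infty((0,\infty);L^1(\mathbb{R}^3))$ is a weak solution of (1) with respect to $\mathcal{T}_{\mathrm{sph}}$ and with respect to $\mathcal{T}_{\mathrm{c}}$. 3. It is unique: every weak solution of (1) with respect to $\mathcal{T}_{\mathrm{sph}}$ (of any sign) in $L^\infty((0,\infty);L^1(\mathbb{R}^3))$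 coincides with $g$ almost everywhere; and so does every almost everywhere nonnegative weak solution with respect to $\mathcal{T}_{\mathrm{c}}$ in $L^\infty((0,\infty);L^1(\mathbb{R}^3))$. 4. For every $\gamma\in[1,\infty]$, if $g_{\mathrm{in}}\in L^\gamma(\mathbb{R}^3)$, then for all $t>0$ one has $g(t,\cdot)\in L^\gamma(\mathbb{R}^3)$ and $\|g(t)\|_{L^\gamma(\mathbb{R}^3)}\le\|g_{\mathrm{in}}\|_{L^\gamma(\mathbb{R}^3)}$, with equality for $\gamma=1$. -/

import Mathlib

open MeasureTheory Set
open scoped ENNReal ContDiff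

noncomputable section

namespace UltraFP

/-- Momentum space `ℝ³` with the Euclidean norm and Lebesgue measure. -/
abbrev Mom : Type := EuclideanSpace ℝ (Fin 3)

/-- The partial derivative `∂f/∂pⁱ` at the point `p`. -/
def pd (i : Fin 3) (f : Mom → ℝ) (p : Mom) : ℝ :=
  fderiv ℝ f p (EuclideanSpace.single i 1)

/-- The entry `pⁱ pʲ / |p|` of the diffusion matrix. -/
def diffusion (i j : Fin 3) (p : Mom) : ℝ := p i * p j / ‖p‖

/-- The operator `f ↦ ∂ᵢ (pⁱ pʲ / |p| ∂ⱼ f)` (meaningful at `p ≠ 0`, i.e. almost everywhere). -/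
def ultraOp (f : Mom → ℝ) (p : Mom) : ℝ :=
  ∑ i, pd i (fun p' => ∑ j, diffusion i j p' * pd j f p') p

/-- The modified Bessel function of the first kind of order `n`. -/
def besselI (n : ℕ) (x : ℝ) : ℝ :=
  ∑' k : ℕ, (x / 2) ^ (2 * k + n) / ((k.factorial : ℝ) * ((k + n).factorial : ℝ))

/-- The representation of `f` in spherical coordinates, `q = |p| > 0`, `ω = p / |p|`. -/
def spherical (f : Mom → ℝ) (q : ℝ) (w : Mom) : ℝ := f (q • w)

/-- The integrand `𝔤_in(z, ω) z e^{-z/t} I₂(2 √q √z / t)` of the solution formula. -/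
def solIntegrand (gin : Mom → ℝ) (t q : ℝ) (w : Mom) (z : ℝ) : ℝ :=
  spherical gin z w * z * Real.exp (-z / t) * besselI 2 (2 * (√q / t) * √z)

/-- The solution formula in spherical coordinates. -/
def sphericalSol (gin : Mom → ℝ) (t q : ℝ) (w : Mom) : ℝ :=
  Real.exp (-q / t) / (t * q) * ∫ z in Ioi (0 : ℝ), solIntegrand gin t q w z

/-- The solution formula as a function of `t` and `p`. -/
def ultraSol (gin : Mom → ℝ) (t : ℝ) (p : Mom) : ℝ :=
  sphericalSol gin t ‖p‖ (‖p‖⁻¹ • p)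

/-- Membership in `L^∞((0,∞); L¹(ℝ³))`. -/
def MemLinftyL1 (g : ℝ → Mom → ℝ) : Prop :=
  AEStronglyMeasurable (fun x : ℝ × Mom => g x.1 x.2)
      ((volume.restrict (Ioi (0 : ℝ))).prod volume) ∧
    ∃ C : ℝ, ∀ᵐ t ∂(volume.restrict (Ioi (0 : ℝ))),
      Integrable (g t) ∧ ∫ p, |g t p| ≤ C

/-- Test functions in `C_c^∞([0,∞) × ℝ³)` (restrictions of functions in `C_c^∞(ℝ × ℝ³)`). -/
def IsTest (φ : ℝ → Mom → ℝ) : Prop :=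
  ContDiff ℝ ∞ (fun x : ℝ × Mom => φ x.1 x.2) ∧
    HasCompactSupport (fun x : ℝ × Mom => φ x.1 x.2)

/-- Test functions that are smooth and compactly supported in the spherical variables
`(t, q, ω) ∈ [0,∞) × [0,∞) × S²`, including `q = 0`. Away from `p = 0` this class contains all
functions in `C_c^∞([0,∞) × ℝ³)`, but the limit at `p → 0` of one of its members may depend on
the direction `ω`. -/
def IsSphericalTest (φ : ℝ → Mom → ℝ) : Prop :=
  ∃ Ψ : ℝ × ℝ × Mom → ℝ, ContDiff ℝ ∞ Ψ ∧ HasCompactSupport Ψ ∧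
    ∀ t p, φ t p = Ψ (t, ‖p‖, ‖p‖⁻¹ • p)

/-- `g ∈ L^∞((0,∞); L¹(ℝ³))` solves `∂ₜ g = ∂ᵢ (pⁱ pʲ / |p| ∂ⱼ g)`, `g(0) = gin`, weakly against
the test functions in the class `T`. -/
def IsWeakSolution (T : (ℝ → Mom → ℝ) → Prop) (gin : Mom → ℝ) (g : ℝ → Mom → ℝ) : Prop :=
  MemLinftyL1 g ∧ ∀ φ, T φ →
    (∫ t in Ioi (0 : ℝ), ∫ p, g t p * (deriv (fun s => φ s p) t + ultraOp (φ t) p)) +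
      ∫ p, gin p * φ 0 p = 0

end UltraFP

end

open Filter Topology

noncomputable section

namespace UltraFP

/-! The matrix `pⁱpʲ/|p|` acts only in the radial direction. On functions of `(q, ω)` the operator
is therefore `q ∂_q² + 3 ∂_q = q⁻² ∂_q (q³ ∂_q)`, which is symmetric for `q² dq`, and `ω` is a mere
parameter. The fundamental solution on a ray is explicit: `kern t q z = t⁻³ e^{-(q+z)/t} F(qz/t²)`
with `F = besselSeries 2`. The Bessel equation gives the evolution equation in flux form
(`hasDerivAt_cube_mul_kernDq`), and termwise Gamma integrals give total mass 1 and mean square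
distance `2zt + 12t²` from `z`. Formula (2) is the integral of the datum along its ray against this
symmetric Markov kernel.

Positivity is then clear. The norm bounds are Jensen's inequality on each ray (`enorm_raySol_le`)
followed by conservation of mass (`lintegral_kern_ray`); passing from rays back to `ℝ³` rests on the
measure-preserving exchange of two radii (`measurePreserving_raySwap`). For existence, the pairing
of the kernel with a test function is differentiated in time and integrated by parts; the flux
carries `q³`, so `q = 0` contributes no boundary term, and concentration as `t → 0` supplies the
initial value (`integral_integral_kern_mul_gen`). Duality and Fubini extend this to all data.

For uniqueness against spherical test functions, the backward equation has the solutions `(1 - mt)⁻³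
exp(-mq/(1 - mt))`, times any function of `ω`. Testing with them shows that two weak solutions have
the same moments at almost every time (`ae_backward_moment_eq`). At fixed `t` the rates `m/(1 - mt)`
cover all positive numbers, so the moments against `e^{-nq} ω^α` agree, and Stone–Weierstrass in the
variables `(e^{-q}, ω)` concludes (`ae_eq_zero_of_moments`).

For the smaller class `C_c^∞`, a spherical test function is cut off near the origin. The commutator
has a term of size `1/ε` on the shell `ε ≤ q ≤ 2ε`, which an `L¹` bound alone does not control. The
functions `ε²/(ε² + q²)` are smooth on `ℝ³`, bounded, and supersolutions of the radial operator
whose image dominates that term. Testing with them shows that its contribution vanishes as soon as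
the solution is nonnegative (`IsWeakSolution.isSphericalTest`). -/

/-! ### Power series of the Bessel functions -/

/-- The entire function `∑ xᵏ / (k! (k+n)!)`, so that `I_n(x) = (x/2)ⁿ F_n(x²/4)`. -/
def besselSeries (n : ℕ) (x : ℝ) : ℝ :=
  ∑' k : ℕ, x ^ k / ((k.factorial : ℝ) * ((k + n).factorial : ℝ))

lemma one_le_factorial_cast (n : ℕ) : (1 : ℝ) ≤ (n.factorial : ℝ) := by
  exact_mod_cast Nat.one_le_iff_ne_zero.2 n.factorial_ne_zero

lemma factorial_cast_pos (n : ℕ) : (0 : ℝ) < (n.factorial : ℝ) := by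
  exact_mod_cast n.factorial_pos

lemma summable_besselSeries (n : ℕ) (x : ℝ) :
    Summable fun k : ℕ => x ^ k / ((k.factorial : ℝ) * ((k + n).factorial : ℝ)) := by
  refine Summable.of_norm_bounded (Real.summable_pow_div_factorial |x|) fun k => ?_
  rw [norm_div, norm_pow, Real.norm_eq_abs, norm_mul, Real.norm_natCast, Real.norm_natCast]
  have h1 := factorial_cast_pos k
  have h2 := one_le_factorial_cast (k + n)
  gcongr
  nlinarith

lemma besselSeries_nonneg (n : ℕ) {x : ℝ} (hx : 0 ≤ x) : 0 ≤ besselSeries n x :=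
  tsum_nonneg fun k => by positivity

lemma hasDerivAt_besselSeries (n : ℕ) (x : ℝ) :
    HasDerivAt (besselSeries n) (besselSeries (n + 1) x) x := by
  set R : ℝ := |x| + 1 with hR
  have hR0 : 0 < R := by positivity
  have key := hasDerivAt_tsum_of_isPreconnected
    (g := fun (k : ℕ) (y : ℝ) => y ^ k / ((k.factorial : ℝ) * ((k + n).factorial : ℝ)))
    (g' := fun (k : ℕ) (y : ℝ) =>
      (k * y ^ (k - 1)) / ((k.factorial : ℝ) * ((k + n).factorial : ℝ)))
    -- At `k = 0` truncated subtraction makes this bound 1, which is harmless because the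
    -- differentiated term is 0.
    (u := fun k : ℕ => R ^ (k - 1) / ((k - 1).factorial : ℝ))
    (t := Metric.ball (0 : ℝ) R) (y₀ := 0) (y := x) ?_ Metric.isOpen_ball
    (convex_ball (0 : ℝ) R).isPreconnected ?_ ?_ (by simpa using hR0)
    (summable_besselSeries n 0) (by simp [hR])
  · have hs : Summable fun k : ℕ =>
        (k * x ^ (k - 1)) / ((k.factorial : ℝ) * ((k + n).factorial : ℝ)) := by
      rw [← summable_nat_add_iff 1]
      refine (summable_besselSeries (n + 1) x).congr fun k => ?_
      rw [Nat.factorial_succ k, show k + 1 + n = k + (n + 1) by ring]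
      have := factorial_cast_pos k
      have := factorial_cast_pos (k + (n + 1))
      simp
      field_simp
    have h2 : (∑' k : ℕ, (k * x ^ (k - 1)) / ((k.factorial : ℝ) * ((k + n).factorial : ℝ)))
        = besselSeries (n + 1) x := by
      rw [hs.tsum_eq_zero_add]
      simp only [Nat.cast_zero, zero_mul, zero_div, zero_add]
      refine tsum_congr fun k => ?_
      rw [Nat.factorial_succ k, show k + 1 + n = k + (n + 1) by ring]
      have := factorial_cast_pos k
      have := factorial_cast_pos (k + (n + 1))
      simp
      field_simp
    rw [h2] at key
    exact key
  · rw [← summable_nat_add_iff 1]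
    simpa using Real.summable_pow_div_factorial R
  · intro k y _
    simpa using (hasDerivAt_pow k y).div_const _
  · intro k y hy
    have hy' : |y| ≤ R := by simpa using (Metric.mem_ball.1 hy).le
    rcases k with _ | k
    · simp
    · have h1 := factorial_cast_pos k
      have h2 := one_le_factorial_cast (k + 1 + n)
      rw [Nat.factorial_succ k]
      simp only [Nat.add_sub_cancel, norm_div, norm_mul, norm_pow, Real.norm_eq_abs, Nat.abs_cast]
      push_cast
      calc ((k : ℝ) + 1) * |y| ^ k / (((k : ℝ) + 1) * k.factorial * (k + 1 + n).factorial)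
          = |y| ^ k / (k.factorial * (k + 1 + n).factorial) := by field_simp
        _ ≤ R ^ k / k.factorial := by
          gcongr
          nlinarith

lemma continuous_besselSeries (n : ℕ) : Continuous (besselSeries n) :=
  continuous_iff_continuousAt.2 fun x => (hasDerivAt_besselSeries n x).continuousAt

/-- The Bessel equation in series form. Comparing coefficients, it is `(k + 3)/(k + 3)! = 1/(k +
2)!`, where the factor `k` comes from shifting the index in `x * besselSeries 4 x`. -/
lemma besselSeries_ode (x : ℝ) :
    x * besselSeries 4 x + 3 * besselSeries 3 x = besselSeries 2 x := by
  have h4 : x * besselSeries 4 x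
      = ∑' k : ℕ, k * (x ^ k / ((k.factorial : ℝ) * ((k + 3).factorial : ℝ))) := by
    have key : ∀ k : ℕ, ((k + 1 : ℕ) : ℝ) * (x ^ (k + 1) /
        (((k + 1).factorial : ℝ) * ((k + 1 + 3).factorial : ℝ)))
        = x * (x ^ k / ((k.factorial : ℝ) * ((k + 4).factorial : ℝ))) := by
      intro k
      rw [Nat.factorial_succ k, show k + 1 + 3 = k + 4 by ring]
      have := factorial_cast_pos k
      have := factorial_cast_pos (k + 4)
      push_cast
      field_simp
      ring
    rw [Summable.tsum_eq_zero_add, besselSeries, ← tsum_mul_left]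
    · rw [← tsum_congr key]; simp
    · rw [← summable_nat_add_iff 1]
      simp_rw [key]
      exact (summable_besselSeries 4 x).mul_left x
  have hs4 : Summable fun k : ℕ => k * (x ^ k / ((k.factorial : ℝ) * ((k + 3).factorial : ℝ))) := by
    refine ((summable_besselSeries 2 x).sub ((summable_besselSeries 3 x).mul_left 3)).congr
      fun k => ?_
    rw [Nat.factorial_succ (k + 2)]
    have := factorial_cast_pos k
    have := factorial_cast_pos (k + 2)
    push_cast
    field_simp
    ring
  rw [h4, besselSeries, ← tsum_mul_left, ← hs4.tsum_add ((summable_besselSeries 3 x).mul_left 3)]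
  refine tsum_congr fun k => ?_
  rw [Nat.factorial_succ (k + 2)]
  have := factorial_cast_pos k
  have := factorial_cast_pos (k + 2)
  push_cast
  field_simp
  ring

lemma besselI_eq (n : ℕ) (x : ℝ) : besselI n x = (x / 2) ^ n * besselSeries n ((x / 2) ^ 2) := by
  rw [besselI, besselSeries, ← tsum_mul_left]
  refine tsum_congr fun k => ?_
  rw [pow_add, ← pow_mul]
  ring

/-! ### The radial kernel and its evolution equation -/

/-- The fundamental solution of the radial equation with respect to the weight `z² dz`. -/
def kern (t q z : ℝ) : ℝ := Real.exp (-(q + z) / t) / t ^ 3 * besselSeries 2 (q * z / t ^ 2)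

lemma kern_symm (t q z : ℝ) : kern t q z = kern t z q := by
  simp [kern, add_comm, mul_comm]

lemma kern_nonneg {t q z : ℝ} (ht : 0 < t) (hq : 0 ≤ q) (hz : 0 ≤ z) : 0 ≤ kern t q z := by
  have := besselSeries_nonneg 2 (x := q * z / t ^ 2) (by positivity)
  unfold kern
  positivity

lemma measurable_kern : Measurable fun x : ℝ × ℝ × ℝ => kern x.1 x.2.1 x.2.2 := by
  unfold kern
  have := (continuous_besselSeries 2).measurable
  fun_prop

/-- The square `(x/2)²` in front of the Bessel series contributes `qz/t²`, whose `z` completes the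
weight `z²`. The constant `t q e^{q/t}` left over is the inverse of the prefactor in (2). -/
lemma solIntegrand_eq (gin : Mom → ℝ) {t q z : ℝ} (w : Mom) (ht : 0 < t) (hq : 0 < q)
    (hz : 0 < z) :
    solIntegrand gin t q w z
      = t * q * Real.exp (q / t) * (z ^ 2 * (gin (z • w) * kern t q z)) := by
  have h1 : (2 * (√q / t) * √z / 2) ^ 2 = q * z / t ^ 2 := by
    rw [show 2 * (√q / t) * √z / 2 = √q * √z / t by ring, div_pow, mul_pow, Real.sq_sqrt hq.le,
      Real.sq_sqrt hz.le]
  have h2 : Real.exp (-(q + z) / t) = Real.exp (-z / t) * (Real.exp (q / t))⁻¹ := by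
    rw [← Real.exp_neg, ← Real.exp_add]; congr 1; ring
  rw [solIntegrand, besselI_eq, h1, kern, spherical, h2]
  have := Real.exp_pos (q / t)
  field_simp

/-- The time derivative of `kern`. -/
def kernDt (t q z : ℝ) : ℝ :=
  Real.exp (-(q + z) / t) / t ^ 3 * (((q + z) / t ^ 2 - 3 / t) * besselSeries 2 (q * z / t ^ 2)
    - 2 * q * z / t ^ 3 * besselSeries 3 (q * z / t ^ 2))

/-- The radial derivative of `kern`. -/
def kernDq (t q z : ℝ) : ℝ :=
  Real.exp (-(q + z) / t) / t ^ 3 * (z / t ^ 2 * besselSeries 3 (q * z / t ^ 2)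
    - besselSeries 2 (q * z / t ^ 2) / t)

lemma hasDerivAt_kern_time {t : ℝ} (ht : 0 < t) (q z : ℝ) :
    HasDerivAt (fun s => kern s q z) (kernDt t q z) t := by
  have h1 : HasDerivAt (fun s : ℝ => Real.exp (-(q + z) / s))
      (Real.exp (-(q + z) / t) * ((q + z) / t ^ 2)) t := by
    have := ((hasDerivAt_inv ht.ne').const_mul (-(q + z))).exp
    simp only [div_eq_mul_inv]
    convert this using 2
    ring
  have h2 : HasDerivAt (fun s : ℝ => q * z / s ^ 2) (-(2 * q * z / t ^ 3)) t := by
    have := (((hasDerivAt_pow 2 t).inv (by positivity)).const_mul (q * z))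
    simp only [div_eq_mul_inv]
    refine this.congr_deriv ?_
    simp
    field_simp
  have h3 := (hasDerivAt_besselSeries 2 (q * z / t ^ 2)).comp t h2
  have h4 := (h1.div (hasDerivAt_pow 3 t) (by positivity)).mul h3
  refine h4.congr_deriv ?_
  simp only [kernDt, Function.comp, Pi.div_apply]
  push_cast
  field_simp
  ring

lemma hasDerivAt_kern_radial (t q z : ℝ) :
    HasDerivAt (fun r => kern t r z) (kernDq t q z) q := by
  have h1 : HasDerivAt (fun r : ℝ => Real.exp (-(r + z) / t))
      (Real.exp (-(q + z) / t) * (-1 / t)) q := by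
    exact (((hasDerivAt_id q).add_const z).neg.div_const t).exp
  have h2 : HasDerivAt (fun r : ℝ => r * z / t ^ 2) (z / t ^ 2) q := by
    simpa using ((hasDerivAt_id q).mul_const z).div_const (t ^ 2)
  have h3 := (hasDerivAt_besselSeries 2 (q * z / t ^ 2)).comp q h2
  have h4 := (h1.div_const (t ^ 3)).mul h3
  refine h4.congr_deriv ?_
  simp only [kernDq, Function.comp]
  ring

/-- The evolution equation `q² ∂ₜK = ∂_q(q³ ∂_q K)` in flux form, ready for integration by parts
against `q² dq`. After differentiation it reduces to `besselSeries_ode` at `qz/t²`. -/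
lemma hasDerivAt_cube_mul_kernDq {t : ℝ} (ht : 0 < t) (q z : ℝ) :
    HasDerivAt (fun r => r ^ 3 * kernDq t r z) (q ^ 2 * kernDt t q z) q := by
  have h1 : HasDerivAt (fun r : ℝ => Real.exp (-(r + z) / t))
      (Real.exp (-(q + z) / t) * (-1 / t)) q := by
    exact (((hasDerivAt_id q).add_const z).neg.div_const t).exp
  have h2 : HasDerivAt (fun r : ℝ => r * z / t ^ 2) (z / t ^ 2) q := by
    simpa using ((hasDerivAt_id q).mul_const z).div_const (t ^ 2)
  have h3 := (hasDerivAt_besselSeries 2 (q * z / t ^ 2)).comp q h2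
  have h3' := (hasDerivAt_besselSeries 3 (q * z / t ^ 2)).comp q h2
  have h4 := (h1.div_const (t ^ 3)).mul ((h3'.const_mul (z / t ^ 2)).sub (h3.div_const t))
  have h5 := (hasDerivAt_pow 3 q).mul h4
  refine h5.congr_deriv ?_
  simp only [kernDt, Function.comp, Pi.mul_apply, Pi.sub_apply]
  rw [← besselSeries_ode (q * z / t ^ 2)]
  norm_num
  field_simp
  ring

lemma continuousOn_kern (z : ℝ) :
    ContinuousOn (fun x : ℝ × ℝ => kern x.1 x.2 z) {x | 0 < x.1} := by
  have := continuous_besselSeries 2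
  intro x hx
  have hx' : x.1 ≠ 0 := ne_of_gt hx
  apply ContinuousAt.continuousWithinAt
  unfold kern
  refine ContinuousAt.mul (by fun_prop (disch := positivity)) ?_
  exact this.continuousAt.comp (by fun_prop (disch := positivity))

lemma continuousOn_kernDt (z : ℝ) :
    ContinuousOn (fun x : ℝ × ℝ => kernDt x.1 x.2 z) {x | 0 < x.1} := by
  have h2 := continuous_besselSeries 2
  have h3 := continuous_besselSeries 3
  intro x hx
  have hx' : x.1 ≠ 0 := ne_of_gt hx
  apply ContinuousAt.continuousWithinAt
  have hx2 : ContinuousAt (fun x : ℝ × ℝ => x.2 * z / x.1 ^ 2) x := by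
    fun_prop (disch := positivity)
  have h2' : ContinuousAt (fun x : ℝ × ℝ => besselSeries 2 (x.2 * z / x.1 ^ 2)) x :=
    h2.continuousAt.comp hx2
  have h3' : ContinuousAt (fun x : ℝ × ℝ => besselSeries 3 (x.2 * z / x.1 ^ 2)) x :=
    h3.continuousAt.comp hx2
  unfold kernDt
  refine ContinuousAt.mul (by fun_prop (disch := positivity)) (.sub (.mul ?_ h2') (.mul ?_ h3'))
  · fun_prop (disch := positivity)
  · fun_prop (disch := positivity)

/-! ### The radial measure and the moments of the kernel -/

/-- The measure `z² dz` on `(0, ∞)`. -/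
def radialMeasure : Measure ℝ :=
  (volume.restrict (Ioi (0 : ℝ))).withDensity fun z => ENNReal.ofReal (z ^ 2)

instance : SigmaFinite radialMeasure := by
  unfold radialMeasure
  infer_instance

lemma lintegral_radialMeasure (f : ℝ → ℝ≥0∞) :
    ∫⁻ z, f z ∂radialMeasure = ∫⁻ z in Ioi (0 : ℝ), ENNReal.ofReal (z ^ 2) * f z := by
  rw [radialMeasure, lintegral_withDensity_eq_lintegral_mul_non_measurable]
  · rfl
  · fun_prop
  · simp

lemma integral_radialMeasure (f : ℝ → ℝ) :
    ∫ z, f z ∂radialMeasure = ∫ z in Ioi (0 : ℝ), z ^ 2 * f z := by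
  rw [radialMeasure, integral_withDensity_eq_integral_toReal_smul (by fun_prop) (by simp)]
  refine integral_congr_ae (ae_of_all _ fun z => ?_)
  simp [ENNReal.toReal_ofReal (sq_nonneg z)]

lemma integrable_radialMeasure_iff {f : ℝ → ℝ} :
    Integrable f radialMeasure ↔ IntegrableOn (fun z => z ^ 2 * f z) (Ioi 0) := by
  rw [radialMeasure, integrable_withDensity_iff_integrable_smul' (by fun_prop) (by simp)]
  simp only [smul_eq_mul, ENNReal.toReal_ofReal (sq_nonneg _)]
  rfl

lemma ae_radialMeasure_pos : ∀ᵐ z ∂radialMeasure, 0 < z := by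
  refine withDensity_absolutelyContinuous _ _ |>.ae_le ?_
  exact ae_restrict_mem measurableSet_Ioi

lemma lintegral_pow_mul_exp {t : ℝ} (ht : 0 < t) (m : ℕ) :
    ∫⁻ q in Ioi (0 : ℝ), ENNReal.ofReal (q ^ m * Real.exp (-q / t))
      = ENNReal.ofReal (m.factorial * t ^ (m + 1)) := by
  have hm : (0 : ℝ) < (m : ℝ) + 1 := by positivity
  have h := Real.integral_rpow_mul_exp_neg_mul_Ioi hm (r := 1 / t) (by positivity)
  have hval : (1 / (1 / t)) ^ ((m : ℝ) + 1) * Real.Gamma ((m : ℝ) + 1)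
      = m.factorial * t ^ (m + 1) := by
    rw [Real.Gamma_nat_eq_factorial, one_div_one_div, mul_comm]
    congr 1
    exact_mod_cast Real.rpow_natCast t (m + 1)
  have hcongr : EqOn (fun q : ℝ => q ^ ((m : ℝ) + 1 - 1) * Real.exp (-(1 / t * q)))
      (fun q => q ^ m * Real.exp (-q / t)) (Ioi 0) := by
    intro q _
    simp only [add_sub_cancel_right, Real.rpow_natCast]
    congr 2
    ring
  rw [setIntegral_congr_fun measurableSet_Ioi hcongr, hval] at h
  have hpos : (0 : ℝ) < m.factorial * t ^ (m + 1) := by positivity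
  -- A nonzero Bochner integral forces integrability, because the integral of a nonintegrable
  -- function is 0 by convention.
  have hint : IntegrableOn (fun q => q ^ m * Real.exp (-q / t)) (Ioi 0) := by
    by_contra hc
    rw [integral_undef hc] at h
    exact hpos.ne h
  rw [← h, ofReal_integral_eq_lintegral_ofReal hint]
  filter_upwards [ae_restrict_mem measurableSet_Ioi] with q hq
  have : (0 : ℝ) < q := hq
  positivity

lemma hasSum_exp (x : ℝ) : HasSum (fun k : ℕ => x ^ k / k.factorial) (Real.exp x) := by
  rw [Real.exp_eq_exp_ℝ]
  exact NormedSpace.expSeries_div_hasSum_exp x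

lemma hasSum_nat_mul_exp (x : ℝ) :
    HasSum (fun k : ℕ => k * (x ^ k / k.factorial)) (x * Real.exp x) := by
  rw [← hasSum_nat_add_iff' 1]
  simp only [Finset.range_one, Finset.sum_singleton, Nat.cast_zero, zero_mul, sub_zero]
  refine ((hasSum_exp x).mul_left x).congr_fun ?_
  intro k
  rw [Nat.factorial_succ]
  have := factorial_cast_pos k
  push_cast
  field_simp
  ring

lemma hasSum_sq_mul_exp (x : ℝ) :
    HasSum (fun k : ℕ => (k : ℝ) ^ 2 * (x ^ k / k.factorial)) ((x ^ 2 + x) * Real.exp x) := by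
  rw [← hasSum_nat_add_iff' 1]
  simp only [Finset.range_one, Finset.sum_singleton, Nat.cast_zero, ne_eq, OfNat.ofNat_ne_zero,
    not_false_eq_true, zero_pow, zero_mul, sub_zero]
  have h := ((hasSum_nat_mul_exp x).add (hasSum_exp x)).mul_left x
  rw [show (x ^ 2 + x) * Real.exp x = x * (x * Real.exp x + Real.exp x) by ring]
  refine h.congr_fun ?_
  intro k
  rw [Nat.factorial_succ]
  have := factorial_cast_pos k
  push_cast
  field_simp
  ring

/-- All terms are nonnegative, so the series may be integrated term by term, each term being a Gamma
integral. What remains is `tʲ` times the mean of `(k+2+j)!/(k+2)!` under the Poisson law of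
parameter `z/t`. -/
lemma lintegral_pow_mul_kern {t z m : ℝ} (ht : 0 < t) (hz : 0 ≤ z) (j : ℕ)
    (hm : HasSum (fun k : ℕ => Real.exp (-z / t) * t ^ j *
      (((k + 2 + j).factorial : ℝ) / (k + 2).factorial * ((z / t) ^ k / k.factorial))) m) :
    ∫⁻ q, ENNReal.ofReal (q ^ j * kern t q z) ∂radialMeasure = ENNReal.ofReal m := by
  have hexp : ∀ q ∈ Ioi (0 : ℝ), ENNReal.ofReal (q ^ 2) * ENNReal.ofReal (q ^ j * kern t q z)
      = ∑' k : ℕ, ENNReal.ofReal (Real.exp (-z / t) / t ^ 3 * ((z / t ^ 2) ^ k /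
          (k.factorial * (k + 2).factorial))) *
            ENNReal.ofReal (q ^ (k + 2 + j) * Real.exp (-q / t)) := by
    intro q hq
    have hq : (0 : ℝ) < q := hq
    have hs := (summable_besselSeries 2 (q * z / t ^ 2)).hasSum.mul_left
      (q ^ 2 * q ^ j * (Real.exp (-(q + z) / t) / t ^ 3))
    rw [← ENNReal.ofReal_mul (by positivity)]
    have hval : q ^ 2 * (q ^ j * kern t q z)
        = ∑' k : ℕ, q ^ 2 * q ^ j * (Real.exp (-(q + z) / t) / t ^ 3) *
          ((q * z / t ^ 2) ^ k / (k.factorial * (k + 2).factorial)) := by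
      rw [hs.tsum_eq, kern, besselSeries]
      ring
    rw [hval, ENNReal.ofReal_tsum_of_nonneg (fun k => by positivity) hs.summable]
    refine tsum_congr fun k => ?_
    rw [← ENNReal.ofReal_mul (by positivity)]
    congr 1
    rw [show -(q + z) / t = -z / t + -q / t by ring, Real.exp_add,
      show q * z / t ^ 2 = q * (z / t ^ 2) by ring, mul_pow q]
    ring
  rw [lintegral_radialMeasure, setLIntegral_congr_fun measurableSet_Ioi hexp,
    lintegral_tsum (fun k => by fun_prop), ← hm.tsum_eq,
    ENNReal.ofReal_tsum_of_nonneg (fun k => by positivity) hm.summable]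
  refine tsum_congr fun k => ?_
  rw [lintegral_const_mul _ (by fun_prop), lintegral_pow_mul_exp ht,
    ← ENNReal.ofReal_mul (by positivity)]
  congr 1
  have := factorial_cast_pos k
  have := factorial_cast_pos (k + 2)
  rw [div_pow, div_pow]
  field_simp
  ring

lemma lintegral_kern {t z : ℝ} (ht : 0 < t) (hz : 0 ≤ z) :
    ∫⁻ q, ENNReal.ofReal (kern t q z) ∂radialMeasure = 1 := by
  have h := lintegral_pow_mul_kern (m := 1) ht hz 0 ?_
  · simpa using h
  · have := (hasSum_exp (z / t)).mul_left (Real.exp (-z / t))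
    rw [← Real.exp_add, show -z / t + z / t = 0 by ring, Real.exp_zero] at this
    refine this.congr_fun fun k => ?_
    have := factorial_cast_pos (k + 2)
    simp [this.ne']

lemma lintegral_id_mul_kern {t z : ℝ} (ht : 0 < t) (hz : 0 ≤ z) :
    ∫⁻ q, ENNReal.ofReal (q ^ 1 * kern t q z) ∂radialMeasure = ENNReal.ofReal (z + 3 * t) := by
  refine lintegral_pow_mul_kern ht hz 1 ?_
  -- For `j = 1` the Poisson weight is `k + 3`.
  have := ((hasSum_nat_mul_exp (z / t)).add ((hasSum_exp (z / t)).mul_left 3)).mul_left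
    (Real.exp (-z / t) * t)
  have h1 : Real.exp (-z / t) * Real.exp (z / t) = 1 := by
    rw [← Real.exp_add, show -z / t + z / t = 0 by ring, Real.exp_zero]
  have h2 : Real.exp (-z / t) * t * (z / t * Real.exp (z / t) + 3 * Real.exp (z / t))
      = z + 3 * t := by
    calc _ = (Real.exp (-z / t) * Real.exp (z / t)) * (t * (z / t) + 3 * t) := by ring
      _ = z + 3 * t := by rw [h1, mul_div_cancel₀ _ ht.ne']; ring
  rw [h2] at this
  refine this.congr_fun fun k => ?_
  rw [Nat.factorial_succ (k + 2)]
  have := factorial_cast_pos (k + 2)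
  push_cast
  field_simp
  ring

lemma lintegral_sq_mul_kern {t z : ℝ} (ht : 0 < t) (hz : 0 ≤ z) :
    ∫⁻ q, ENNReal.ofReal (q ^ 2 * kern t q z) ∂radialMeasure
      = ENNReal.ofReal (z ^ 2 + 8 * z * t + 12 * t ^ 2) := by
  refine lintegral_pow_mul_kern ht hz 2 ?_
  -- For `j = 2` the weight is `(k + 3)(k + 4) = k² + 7k + 12`.
  have := (((hasSum_sq_mul_exp (z / t)).add ((hasSum_nat_mul_exp (z / t)).mul_left 7)).add
    ((hasSum_exp (z / t)).mul_left 12)).mul_left (Real.exp (-z / t) * t ^ 2)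
  have h1 : Real.exp (-z / t) * Real.exp (z / t) = 1 := by
    rw [← Real.exp_add, show -z / t + z / t = 0 by ring, Real.exp_zero]
  have h2 : Real.exp (-z / t) * t ^ 2 * (((z / t) ^ 2 + z / t) * Real.exp (z / t)
      + 7 * (z / t * Real.exp (z / t)) + 12 * Real.exp (z / t))
      = z ^ 2 + 8 * z * t + 12 * t ^ 2 := by
    calc _ = (Real.exp (-z / t) * Real.exp (z / t)) *
          ((t * (z / t)) ^ 2 + 8 * (t * (z / t)) * t + 12 * t ^ 2) := by ring
      _ = _ := by rw [h1, mul_div_cancel₀ _ ht.ne']; ring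
  rw [h2] at this
  refine this.congr_fun fun k => ?_
  rw [show k + 2 + 2 = k + 3 + 1 by ring, Nat.factorial_succ (k + 3), Nat.factorial_succ (k + 2)]
  have := factorial_cast_pos (k + 2)
  push_cast
  field_simp
  ring

lemma measurable_kern_left (t z : ℝ) : Measurable fun q => kern t q z :=
  measurable_kern.comp (g := fun x : ℝ × ℝ × ℝ => kern x.1 x.2.1 x.2.2)
    (f := fun q : ℝ => (t, q, z)) (by fun_prop)

lemma integrable_and_integral_of_lintegral {α : Type*} [MeasurableSpace α] {μ : Measure α}
    {f : α → ℝ} {m : ℝ} (hf : AEStronglyMeasurable f μ) (h0 : 0 ≤ᵐ[μ] f) (hm : 0 ≤ m)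
    (h : ∫⁻ x, ENNReal.ofReal (f x) ∂μ = ENNReal.ofReal m) :
    Integrable f μ ∧ ∫ x, f x ∂μ = m := by
  constructor
  · refine ⟨hf, ?_⟩
    rw [hasFiniteIntegral_iff_ofReal h0, h]
    exact ENNReal.ofReal_lt_top
  · rw [integral_eq_lintegral_of_nonneg_ae h0 hf, h, ENNReal.toReal_ofReal hm]

lemma integrable_kern {t z : ℝ} (ht : 0 < t) (hz : 0 ≤ z) :
    Integrable (fun q => kern t q z) radialMeasure ∧ ∫ q, kern t q z ∂radialMeasure = 1 := by
  refine integrable_and_integral_of_lintegral (measurable_kern_left t z).aestronglyMeasurable ?_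
    zero_le_one (by simpa using lintegral_kern ht hz)
  filter_upwards [ae_radialMeasure_pos] with q hq using kern_nonneg ht hq.le hz

/-- Expansion of the square and the moments of order 0, 1, 2. That the result vanishes with `t` is
the source of the concentration of the kernel at `z`. -/
lemma integrable_dist_sq_mul_kern {t z : ℝ} (ht : 0 < t) (hz : 0 ≤ z) :
    Integrable (fun q => (q - z) ^ 2 * kern t q z) radialMeasure ∧
      ∫ q, (q - z) ^ 2 * kern t q z ∂radialMeasure = 2 * z * t + 12 * t ^ 2 := by
  have hk := measurable_kern_left t z
  have h0 := integrable_kern ht hz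
  have h1 : Integrable (fun q => q ^ 1 * kern t q z) radialMeasure ∧
      ∫ q, q ^ 1 * kern t q z ∂radialMeasure = z + 3 * t := by
    refine integrable_and_integral_of_lintegral
      (Measurable.aestronglyMeasurable (by fun_prop)) ?_ (by positivity)
      (lintegral_id_mul_kern ht hz)
    filter_upwards [ae_radialMeasure_pos] with q hq
    have := kern_nonneg ht hq.le hz
    simp only [Pi.zero_apply]; positivity
  have h2 : Integrable (fun q => q ^ 2 * kern t q z) radialMeasure ∧
      ∫ q, q ^ 2 * kern t q z ∂radialMeasure = z ^ 2 + 8 * z * t + 12 * t ^ 2 := by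
    refine integrable_and_integral_of_lintegral
      (Measurable.aestronglyMeasurable (by fun_prop)) ?_ (by positivity)
      (lintegral_sq_mul_kern ht hz)
    filter_upwards [ae_radialMeasure_pos] with q hq
    have := kern_nonneg ht hq.le hz
    simp only [Pi.zero_apply]; positivity
  have heq : (fun q => (q - z) ^ 2 * kern t q z) = fun q =>
      q ^ 2 * kern t q z - 2 * z * (q ^ 1 * kern t q z) + z ^ 2 * kern t q z := by
    funext q; ring
  rw [heq]
  have hsub : Integrable (fun q => q ^ 2 * kern t q z - 2 * z * (q ^ 1 * kern t q z))
      radialMeasure := h2.1.sub (h1.1.const_mul _)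
  refine ⟨hsub.add (h0.1.const_mul _), ?_⟩
  rw [integral_add hsub (h0.1.const_mul _),
    integral_sub h2.1 (h1.1.const_mul _), integral_const_mul, integral_const_mul, h0.2, h1.2, h2.2]
  ring

/-! ### Polar coordinates and the exchange of radii -/

lemma lintegral_polar {f : Mom → ℝ≥0∞} (hf : Measurable f) :
    ∫⁻ p, f p = ∫⁻ w : Metric.sphere (0 : Mom) 1, ∫⁻ q, f (q • (w : Mom)) ∂radialMeasure
      ∂(volume : Measure Mom).toSphere := by
  have h1 : ∫⁻ p, f p = ∫⁻ p : ({0}ᶜ : Set Mom), f p ∂((volume : Measure Mom).comap (↑)) := by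
    rw [lintegral_subtype_comap (measurableSet_singleton _).compl, restrict_compl_singleton]
  have h2 := (volume : Measure Mom).measurePreserving_homeomorphUnitSphereProd
  have hdim : Module.finrank ℝ Mom - 1 = 2 := by simp
  rw [hdim] at h2
  have h3 := h2.lintegral_comp_emb (homeomorphUnitSphereProd Mom).measurableEmbedding
    (fun x => f ((homeomorphUnitSphereProd Mom).symm x))
  simp only [Homeomorph.symm_apply_apply] at h3
  rw [h1, h3, lintegral_prod]
  · refine lintegral_congr fun w => ?_
    simp only [homeomorphUnitSphereProd_symm_apply_coe]
    rw [lintegral_radialMeasure, Measure.volumeIoiPow,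
      lintegral_withDensity_eq_lintegral_mul_non_measurable _ (by fun_prop) (by simp),
      ← lintegral_subtype_comap measurableSet_Ioi]
    rfl
  · refine Measurable.aemeasurable (hf.comp (measurable_subtype_coe.comp ?_))
    exact (homeomorphUnitSphereProd Mom).symm.measurable

/-- Exchange of the radius of a point with another radius on the same ray. -/
def raySwap (x : Mom × ℝ) : Mom × ℝ := (x.2 • (‖x.1‖⁻¹ • x.1), ‖x.1‖)

lemma measurable_raySwap : Measurable raySwap := by
  unfold raySwap
  fun_prop

lemma raySwap_smul {w : Mom} (hw : ‖w‖ = 1) {q : ℝ} (hq : 0 < q) (z : ℝ) :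
    raySwap (q • w, z) = (z • w, q) := by
  simp [raySwap, norm_smul, hw, abs_of_pos hq, smul_smul, hq.ne']

/-- In polar coordinates the product measure is `dω ⊗ q²dq ⊗ z²dz`, and the map exchanges the two
radial factors, so Tonelli's theorem suffices. -/
lemma measurePreserving_raySwap :
    MeasurePreserving raySwap ((volume : Measure Mom).prod radialMeasure)
      ((volume : Measure Mom).prod radialMeasure) := by
  refine ⟨measurable_raySwap, Measure.ext_of_lintegral _ fun f hf => ?_⟩
  have hf' : Measurable fun x => f (raySwap x) := hf.comp measurable_raySwap
  rw [lintegral_map hf measurable_raySwap, lintegral_prod _ hf'.aemeasurable,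
    lintegral_prod _ hf.aemeasurable, lintegral_polar hf'.lintegral_prod_right',
    lintegral_polar hf.lintegral_prod_right']
  refine lintegral_congr fun w => ?_
  have hw : ‖(w : Mom)‖ = 1 := by simp
  have h1 : ∫⁻ q, ∫⁻ z, f (raySwap (q • (w : Mom), z)) ∂radialMeasure ∂radialMeasure
      = ∫⁻ q, ∫⁻ z, f (z • (w : Mom), q) ∂radialMeasure ∂radialMeasure := by
    refine lintegral_congr_ae ?_
    filter_upwards [ae_radialMeasure_pos] with q hq
    simp only [raySwap_smul hw hq]
  refine h1.trans (lintegral_lintegral_swap ?_)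
  exact (hf.comp (by fun_prop)).aemeasurable

lemma raySwap_raySwap {p : Mom} {z : ℝ} (hp : p ≠ 0) (hz : 0 < z) :
    raySwap (raySwap (p, z)) = (p, z) := by
  have hw : ‖‖p‖⁻¹ • p‖ = 1 := by
    rw [norm_smul, norm_inv, norm_norm, inv_mul_cancel₀ (norm_ne_zero_iff.2 hp)]
  have h := raySwap_smul hw hz ‖p‖
  rw [smul_inv_smul₀ (norm_ne_zero_iff.2 hp)] at h
  exact h

lemma ae_ne_zero_Mom : ∀ᵐ p : Mom, p ≠ 0 := by
  rw [ae_iff]; simp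

lemma ae_prod_ne_zero_pos :
    ∀ᵐ x ∂((volume : Measure Mom).prod radialMeasure), x.1 ≠ 0 ∧ 0 < x.2 := by
  have h1 := Measure.quasiMeasurePreserving_fst (μ := (volume : Measure Mom))
    (ν := radialMeasure) |>.ae ae_ne_zero_Mom
  have h2 := Measure.quasiMeasurePreserving_snd (μ := (volume : Measure Mom))
    (ν := radialMeasure) |>.ae ae_radialMeasure_pos
  filter_upwards [h1, h2] with x a b using ⟨a, b⟩

/-- A property holding almost everywhere holds almost everywhere on almost every ray. -/
lemma ae_ae_ray {P : Mom → Prop} (h : ∀ᵐ p, P p) :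
    ∀ᵐ p : Mom, ∀ᵐ z ∂radialMeasure, P (z • (‖p‖⁻¹ • p)) := by
  have h1 := (Measure.quasiMeasurePreserving_fst (μ := (volume : Measure Mom))
    (ν := radialMeasure)).ae h
  -- The first component of `raySwap (p, z)` is the point at radius `z` on the ray of `p`.
  exact Measure.ae_ae_of_ae_prod (measurePreserving_raySwap.quasiMeasurePreserving.ae h1)

/-! ### The solution operator and its norm bounds -/

/-- The solution operator as an integral against the kernel. -/
lemma ultraSol_eq (gin : Mom → ℝ) {t : ℝ} (ht : 0 < t) {p : Mom} (hp : p ≠ 0) :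
    ultraSol gin t p
      = ∫ z, gin (z • (‖p‖⁻¹ • p)) * kern t ‖p‖ z ∂radialMeasure := by
  have hq : 0 < ‖p‖ := norm_pos_iff.2 hp
  rw [ultraSol, sphericalSol, setIntegral_congr_fun measurableSet_Ioi
    (fun z hz => solIntegrand_eq gin (‖p‖⁻¹ • p) ht hq hz), integral_const_mul,
    integral_radialMeasure, ← mul_assoc]
  have : Real.exp (-‖p‖ / t) / (t * ‖p‖) * (t * ‖p‖ * Real.exp (‖p‖ / t)) = 1 := by
    rw [show -‖p‖ / t = -(‖p‖ / t) by ring, Real.exp_neg]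
    have := Real.exp_pos (‖p‖ / t)
    field_simp
  rw [this, one_mul]

lemma integrableOn_solIntegrand_iff (gin : Mom → ℝ) {t : ℝ} (ht : 0 < t) {p : Mom} (hp : p ≠ 0) :
    IntegrableOn (solIntegrand gin t ‖p‖ (‖p‖⁻¹ • p)) (Ioi 0) ↔
      Integrable (fun z => gin (z • (‖p‖⁻¹ • p)) * kern t ‖p‖ z) radialMeasure := by
  have hq : 0 < ‖p‖ := norm_pos_iff.2 hp
  have hE : EqOn (solIntegrand gin t ‖p‖ (‖p‖⁻¹ • p)) (fun z => t * ‖p‖ * Real.exp (‖p‖ / t) *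
      (z ^ 2 * (gin (z • (‖p‖⁻¹ • p)) * kern t ‖p‖ z))) (Ioi 0) :=
    fun z hz => solIntegrand_eq gin (‖p‖⁻¹ • p) ht hq hz
  rw [integrable_radialMeasure_iff, integrableOn_congr_fun hE measurableSet_Ioi]
  have : t * ‖p‖ * Real.exp (‖p‖ / t) ≠ 0 := by positivity
  exact integrable_const_mul_iff (Ne.isUnit this) _

lemma measurable_kern_norm (t : ℝ) : Measurable fun x : Mom × ℝ => kern t ‖x.1‖ x.2 :=
  measurable_kern.comp (g := fun x : ℝ × ℝ × ℝ => kern x.1 x.2.1 x.2.2)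
    (f := fun x : Mom × ℝ => (t, ‖x.1‖, x.2)) (by fun_prop)

/-- Mass conservation of the solution operator. -/
lemma lintegral_kern_ray {t : ℝ} (ht : 0 < t) {f : Mom → ℝ≥0∞} (hf : Measurable f) :
    ∫⁻ p : Mom, ∫⁻ z, f (z • (‖p‖⁻¹ • p)) * ENNReal.ofReal (kern t ‖p‖ z) ∂radialMeasure
      = ∫⁻ p, f p := by
  have hk := measurable_kern_norm t
  have hG : Measurable fun x : Mom × ℝ => f x.1 * ENNReal.ofReal (kern t x.2 ‖x.1‖) := by
    have : Measurable fun x : Mom × ℝ => kern t x.2 ‖x.1‖ := by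
      simpa only [kern_symm t _ ‖_‖] using hk
    fun_prop
  have h := measurePreserving_raySwap.lintegral_comp hG
  have hG' := hG.comp measurable_raySwap
  simp only [Function.comp_def] at hG'
  rw [lintegral_prod _ hG'.aemeasurable,
    lintegral_prod _ hG.aemeasurable] at h
  -- After the exchange of radii the value of `f` no longer depends on `z`, and only the total mass
  -- 1 of the kernel remains.
  have h2 : ∀ p : Mom, ∫⁻ z, f p * ENNReal.ofReal (kern t z ‖p‖) ∂radialMeasure = f p := by
    intro p
    rw [lintegral_const_mul _ (measurable_kern_left t _).ennreal_ofReal,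
      lintegral_kern ht (norm_nonneg p), mul_one]
  simp only [h2] at h
  rw [← h]
  refine lintegral_congr_ae ?_
  filter_upwards [ae_ne_zero_Mom] with p hp
  refine lintegral_congr_ae ?_
  filter_upwards [ae_radialMeasure_pos] with z hz
  have hw : ‖z • (‖p‖⁻¹ • p)‖ = z := by
    rw [norm_smul, norm_smul, norm_inv, norm_norm, inv_mul_cancel₀ (norm_ne_zero_iff.2 hp),
      mul_one, Real.norm_of_nonneg hz.le]
  simp only [raySwap, hw]

/-- The solution operator written with `kern`; it agrees with `ultraSol` for `t > 0`, `p ≠ 0`. -/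
def raySol (gin : Mom → ℝ) (t : ℝ) (p : Mom) : ℝ :=
  ∫ z, gin (z • (‖p‖⁻¹ • p)) * kern t ‖p‖ z ∂radialMeasure

lemma measurable_ray_integrand {gin : Mom → ℝ} (hg : Measurable gin) :
    Measurable fun x : (ℝ × Mom) × ℝ =>
      gin (x.2 • (‖x.1.2‖⁻¹ • x.1.2)) * kern x.1.1 ‖x.1.2‖ x.2 := by
  have hk : Measurable fun x : (ℝ × Mom) × ℝ => kern x.1.1 ‖x.1.2‖ x.2 :=
    measurable_kern.comp (g := fun x : ℝ × ℝ × ℝ => kern x.1 x.2.1 x.2.2)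
      (f := fun x : (ℝ × Mom) × ℝ => (x.1.1, ‖x.1.2‖, x.2)) (by fun_prop)
  exact (hg.comp (by fun_prop)).mul hk

lemma stronglyMeasurable_raySol {gin : Mom → ℝ} (hg : Measurable gin) :
    StronglyMeasurable fun x : ℝ × Mom => raySol gin x.1 x.2 :=
  (measurable_ray_integrand hg).stronglyMeasurable.integral_prod_right

lemma integrable_ray_integrand {gin : Mom → ℝ} (hg : Measurable gin) (hi : Integrable gin)
    {t : ℝ} (ht : 0 < t) :
    Integrable (fun x : Mom × ℝ => gin (x.2 • (‖x.1‖⁻¹ • x.1)) * kern t ‖x.1‖ x.2)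
      ((volume : Measure Mom).prod radialMeasure) := by
  have hm : Measurable fun x : Mom × ℝ => gin (x.2 • (‖x.1‖⁻¹ • x.1)) * kern t ‖x.1‖ x.2 :=
    (measurable_ray_integrand hg).comp (f := fun x : Mom × ℝ => ((t, x.1), x.2)) (by fun_prop)
  refine ⟨hm.aestronglyMeasurable, ?_⟩
  rw [HasFiniteIntegral, lintegral_prod _ hm.enorm.aemeasurable]
  have h := lintegral_kern_ray ht hg.enorm
  have h2 : ∫⁻ p : Mom, ∫⁻ z, ‖gin (z • (‖p‖⁻¹ • p)) * kern t ‖p‖ z‖ₑ ∂radialMeasure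
      = ∫⁻ p, ‖gin p‖ₑ := by
    rw [← h]
    refine lintegral_congr fun p => lintegral_congr_ae ?_
    filter_upwards [ae_radialMeasure_pos] with z hz
    rw [enorm_mul, Real.enorm_of_nonneg (kern_nonneg ht (norm_nonneg p) hz.le)]
  rw [h2]
  exact hi.2

lemma ofReal_raySol {gin : Mom → ℝ} (hg : Measurable gin) (hi : Integrable gin)
    (h0 : ∀ p, 0 ≤ gin p) {t : ℝ} (ht : 0 < t) :
    ∀ᵐ p : Mom, ENNReal.ofReal (raySol gin t p) = ∫⁻ z, ENNReal.ofReal (gin (z • (‖p‖⁻¹ • p))) *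
      ENNReal.ofReal (kern t ‖p‖ z) ∂radialMeasure := by
  filter_upwards [(integrable_ray_integrand hg hi ht).prod_right_ae] with p hp
  rw [raySol, ofReal_integral_eq_lintegral_ofReal hp]
  · refine lintegral_congr fun z => ?_
    rw [ENNReal.ofReal_mul (h0 _)]
  · filter_upwards [ae_radialMeasure_pos] with z hz
    exact mul_nonneg (h0 _) (kern_nonneg ht (norm_nonneg p) hz.le)

lemma raySol_nonneg {gin : Mom → ℝ} (h0 : ∀ p, 0 ≤ gin p) {t : ℝ} (ht : 0 < t) (p : Mom) :
    0 ≤ raySol gin t p := by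
  refine integral_nonneg_of_ae ?_
  filter_upwards [ae_radialMeasure_pos] with z hz
  exact mul_nonneg (h0 _) (kern_nonneg ht (norm_nonneg p) hz.le)

lemma eLpNorm_one_raySol {gin : Mom → ℝ} (hg : Measurable gin) (hi : Integrable gin)
    (h0 : ∀ p, 0 ≤ gin p) {t : ℝ} (ht : 0 < t) :
    eLpNorm (raySol gin t) 1 = eLpNorm gin 1 := by
  rw [eLpNorm_one_eq_lintegral_enorm, eLpNorm_one_eq_lintegral_enorm]
  simp only [Real.enorm_of_nonneg (raySol_nonneg h0 ht _), Real.enorm_of_nonneg (h0 _)]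
  rw [lintegral_congr_ae (ofReal_raySol hg hi h0 ht)]
  exact lintegral_kern_ray ht hg.ennreal_ofReal

/-- The transition probability along a ray. -/
def transition (t q : ℝ) : Measure ℝ :=
  radialMeasure.withDensity fun z => ENNReal.ofReal (kern t q z)

lemma measurable_kern_right (t q : ℝ) : Measurable fun z => kern t q z := by
  simpa only [kern_symm t q] using measurable_kern_left t q

lemma isProbabilityMeasure_transition {t q : ℝ} (ht : 0 < t) (hq : 0 ≤ q) :
    IsProbabilityMeasure (transition t q) := by
  constructor
  rw [transition, withDensity_apply _ MeasurableSet.univ, Measure.restrict_univ]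
  simp only [kern_symm t q]
  exact lintegral_kern ht hq

lemma lintegral_transition (t q : ℝ) (f : ℝ → ℝ≥0∞) :
    ∫⁻ z, f z ∂(transition t q)
      = ∫⁻ z, f z * ENNReal.ofReal (kern t q z) ∂radialMeasure := by
  rw [transition, lintegral_withDensity_eq_lintegral_mul_non_measurable _
    (measurable_kern_right t q).ennreal_ofReal (by simp)]
  refine lintegral_congr fun z => ?_
  rw [Pi.mul_apply, mul_comm]

/-- Jensen's inequality, in the form `L¹ ≤ L^γ` for the probability measure `transition t ‖p‖`. It
covers `γ = ∞` as well. -/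
lemma enorm_raySol_le {gin : Mom → ℝ} (hg : Measurable gin) {γ : ℝ≥0∞} (hγ : 1 ≤ γ)
    {t : ℝ} (ht : 0 < t) (p : Mom) :
    ‖raySol gin t p‖ₑ ≤ eLpNorm (fun z => gin (z • (‖p‖⁻¹ • p))) γ (transition t ‖p‖) := by
  have := isProbabilityMeasure_transition ht (norm_nonneg p)
  refine le_trans ?_ (eLpNorm_le_eLpNorm_of_exponent_le hγ
    (hg.comp (by fun_prop)).aestronglyMeasurable)
  rw [eLpNorm_one_eq_lintegral_enorm, lintegral_transition]
  refine (enorm_integral_le_lintegral_enorm _).trans (lintegral_mono_ae ?_)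
  filter_upwards [ae_radialMeasure_pos] with z hz
  rw [enorm_mul, Real.enorm_of_nonneg (kern_nonneg ht (norm_nonneg p) hz.le)]

/-- For finite `γ`, the bound on each ray is raised to the power `γ` and integrated by conservation
of mass for `|gin|^γ`. For `γ = ∞`, the essential bound holds almost everywhere on almost every ray.
-/
lemma eLpNorm_raySol_le {gin : Mom → ℝ} (hg : Measurable gin) {γ : ℝ≥0∞} (hγ : 1 ≤ γ)
    {t : ℝ} (ht : 0 < t) :
    eLpNorm (raySol gin t) γ ≤ eLpNorm gin γ := by
  have hγ0 : γ ≠ 0 := (zero_lt_one.trans_le hγ).ne'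
  rcases eq_or_ne γ ⊤ with rfl | htop
  · rw [eLpNorm_exponent_top, eLpNorm_exponent_top]
    refine essSup_le_of_ae_le _ ?_
    have h1 : ∀ᵐ p, ‖gin p‖ₑ ≤ eLpNormEssSup gin volume := ae_le_eLpNormEssSup
    filter_upwards [ae_ae_ray h1] with p hp
    refine (enorm_raySol_le hg le_top ht p).trans ?_
    rw [eLpNorm_exponent_top]
    exact essSup_le_of_ae_le _ ((withDensity_absolutelyContinuous _ _).ae_le hp)
  · have hpos : 0 < γ.toReal := ENNReal.toReal_pos hγ0 htop
    rw [eLpNorm_eq_lintegral_rpow_enorm_toReal hγ0 htop,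
      eLpNorm_eq_lintegral_rpow_enorm_toReal hγ0 htop,
      ← lintegral_kern_ray ht (hg.enorm.pow_const γ.toReal)]
    gcongr with p
    rw [← lintegral_transition t ‖p‖ fun z => ‖gin (z • (‖p‖⁻¹ • p))‖ₑ ^ γ.toReal]
    have h := enorm_raySol_le hg hγ ht p
    rw [eLpNorm_eq_lintegral_rpow_enorm_toReal hγ0 htop] at h
    calc ‖raySol gin t p‖ₑ ^ γ.toReal
        ≤ ((∫⁻ z, ‖gin (z • (‖p‖⁻¹ • p))‖ₑ ^ γ.toReal ∂(transition t ‖p‖)) ^ (1 / γ.toReal))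
            ^ γ.toReal := by gcongr
      _ = _ := by rw [← ENNReal.rpow_mul, one_div_mul_cancel hpos.ne', ENNReal.rpow_one]

lemma integrable_raySol {gin : Mom → ℝ} (hg : Measurable gin) (hi : Integrable gin)
    {t : ℝ} (ht : 0 < t) : Integrable (raySol gin t) := by
  exact (integrable_ray_integrand hg hi ht).integral_prod_left

lemma memLinftyL1_raySol {gin : Mom → ℝ} (hg : Measurable gin) (hi : Integrable gin) :
    MemLinftyL1 (raySol gin) := by
  refine ⟨(stronglyMeasurable_raySol hg).aestronglyMeasurable, ∫ p, |gin p|, ?_⟩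
  filter_upwards [ae_restrict_mem measurableSet_Ioi] with t ht
  have h := eLpNorm_raySol_le hg le_rfl ht
  refine ⟨integrable_raySol hg hi ht, ?_⟩
  have h1 := integral_norm_eq_lintegral_enorm (integrable_raySol hg hi ht).1
  have h2 := integral_norm_eq_lintegral_enorm hi.1
  simp only [Real.norm_eq_abs] at h1 h2
  rw [h1, h2]
  rw [eLpNorm_one_eq_lintegral_enorm, eLpNorm_one_eq_lintegral_enorm] at h
  exact ENNReal.toReal_mono hi.2.ne h

/-- Duality for the solution operator against a bounded function of radius and direction. -/
lemma integral_raySol_mul {gin : Mom → ℝ} (hg : Measurable gin) (hi : Integrable gin)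
    {Φ : ℝ → Mom → ℝ} (hΦ : Measurable fun x : ℝ × Mom => Φ x.1 x.2) {C : ℝ}
    (hC : ∀ q w, |Φ q w| ≤ C) {t : ℝ} (ht : 0 < t) :
    ∫ p, raySol gin t p * Φ ‖p‖ (‖p‖⁻¹ • p)
      = ∫ p, gin p * ∫ q, kern t q ‖p‖ * Φ q (‖p‖⁻¹ • p) ∂radialMeasure := by
  have hI := integrable_ray_integrand hg hi ht
  have hΦ1 : Measurable fun x : Mom × ℝ => Φ ‖x.1‖ (‖x.1‖⁻¹ • x.1) :=
    hΦ.comp (f := fun x : Mom × ℝ => (‖x.1‖, ‖x.1‖⁻¹ • x.1)) (by fun_prop)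
  have hI2 : Integrable (fun x : Mom × ℝ => gin (x.2 • (‖x.1‖⁻¹ • x.1)) * kern t ‖x.1‖ x.2
      * Φ ‖x.1‖ (‖x.1‖⁻¹ • x.1)) ((volume : Measure Mom).prod radialMeasure) :=
    hI.mul_bdd (c := C) hΦ1.aestronglyMeasurable (ae_of_all _ fun x => hC _ _)
  -- Exchanging the radii moves the kernel from the datum to `Φ`; integrability, established for the
  -- original integrand, is carried along by the same map.
  have hswap := measurePreserving_raySwap.integrable_comp_of_integrable hI2
  have hval := integral_map (f := fun x : Mom × ℝ => gin (x.2 • (‖x.1‖⁻¹ • x.1)) *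
    kern t ‖x.1‖ x.2 * Φ ‖x.1‖ (‖x.1‖⁻¹ • x.1)) (μ := (volume : Measure Mom).prod radialMeasure)
    measurable_raySwap.aemeasurable (by rw [measurePreserving_raySwap.map_eq]; exact hI2.1)
  rw [measurePreserving_raySwap.map_eq] at hval
  have hae : (fun x : Mom × ℝ => gin ((raySwap x).2 • (‖(raySwap x).1‖⁻¹ • (raySwap x).1)) *
      kern t ‖(raySwap x).1‖ (raySwap x).2 * Φ ‖(raySwap x).1‖ (‖(raySwap x).1‖⁻¹ • (raySwap x).1))
      =ᵐ[(volume : Measure Mom).prod radialMeasure]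
        fun x => gin x.1 * (kern t x.2 ‖x.1‖ * Φ x.2 (‖x.1‖⁻¹ • x.1)) := by
    filter_upwards [ae_prod_ne_zero_pos] with x hx
    obtain ⟨p, z⟩ := x
    obtain ⟨hp, hz⟩ : p ≠ 0 ∧ 0 < z := hx
    have h1 := raySwap_raySwap hp hz
    have h2 : ((raySwap (p, z)).2 • (‖(raySwap (p, z)).1‖⁻¹ • (raySwap (p, z)).1)) = p :=
      congrArg Prod.fst h1
    have h3 : ‖(raySwap (p, z)).1‖ = z := congrArg Prod.snd h1
    rw [h2, h3, mul_assoc]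
    congr 3
    simp only [raySwap]
    rw [inv_smul_smul₀ hz.ne']
  rw [integral_congr_ae hae, integral_prod _ hI2,
    integral_prod _ ((integrable_congr hae).1 hswap)] at hval
  simp only [integral_const_mul, integral_mul_const] at hval
  exact hval

/-! ### The equation in spherical variables -/

/-- Time derivative of a function of `(t, q, ω)`. -/
def dt (Ψ : ℝ × ℝ × Mom → ℝ) (x : ℝ × ℝ × Mom) : ℝ := fderiv ℝ Ψ x (1, 0, 0)

/-- Radial derivative of a function of `(t, q, ω)`. -/
def dq (Ψ : ℝ × ℝ × Mom → ℝ) (x : ℝ × ℝ × Mom) : ℝ := fderiv ℝ Ψ x (0, 1, 0)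

/-- The backward operator `∂ₜ + q ∂_q² + 3 ∂_q` in spherical variables. -/
def gen (Ψ : ℝ × ℝ × Mom → ℝ) (x : ℝ × ℝ × Mom) : ℝ :=
  dt Ψ x + (x.2.1 * dq (dq Ψ) x + 3 * dq Ψ x)

/-- Spherical variables. -/
def sph (t : ℝ) (p : Mom) : ℝ × ℝ × Mom := (t, ‖p‖, ‖p‖⁻¹ • p)

lemma measurable_sph : Measurable fun x : ℝ × Mom => sph x.1 x.2 := by
  unfold sph; fun_prop

variable {Ψ : ℝ × ℝ × Mom → ℝ}

lemma hasDerivAt_time_slice (hΨ : ContDiff ℝ ∞ Ψ) (t q : ℝ) (w : Mom) :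
    HasDerivAt (fun s => Ψ (s, q, w)) (dt Ψ (t, q, w)) t := by
  have h1 := (hΨ.differentiable (by simp) (t, q, w)).hasFDerivAt
  have h2 : HasDerivAt (fun s : ℝ => (s, q, w)) ((1 : ℝ), (0 : ℝ), (0 : Mom)) t :=
    (hasDerivAt_id t).prodMk (hasDerivAt_const t (q, w))
  exact h1.comp_hasDerivAt t h2

lemma hasDerivAt_radial_slice (hΨ : ContDiff ℝ ∞ Ψ) (t q : ℝ) (w : Mom) :
    HasDerivAt (fun s => Ψ (t, s, w)) (dq Ψ (t, q, w)) q := by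
  have h1 := (hΨ.differentiable (by simp) (t, q, w)).hasFDerivAt
  have h2 : HasDerivAt (fun s : ℝ => (t, s, w)) ((0 : ℝ), (1 : ℝ), (0 : Mom)) q :=
    (hasDerivAt_const q t).prodMk ((hasDerivAt_id q).prodMk (hasDerivAt_const q w))
  exact h1.comp_hasDerivAt q h2

lemma contDiff_dt (hΨ : ContDiff ℝ ∞ Ψ) : ContDiff ℝ ∞ (dt Ψ) :=
  (hΨ.fderiv_right (m := ∞) (by simp)).clm_apply contDiff_const

lemma contDiff_dq (hΨ : ContDiff ℝ ∞ Ψ) : ContDiff ℝ ∞ (dq Ψ) :=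
  (hΨ.fderiv_right (m := ∞) (by simp)).clm_apply contDiff_const

lemma hasCompactSupport_dt (hc : HasCompactSupport Ψ) : HasCompactSupport (dt Ψ) :=
  hc.fderiv_apply ℝ _

lemma hasCompactSupport_dq (hc : HasCompactSupport Ψ) : HasCompactSupport (dq Ψ) :=
  hc.fderiv_apply ℝ _

lemma continuous_gen (hΨ : ContDiff ℝ ∞ Ψ) : Continuous (gen Ψ) := by
  have h1 := (contDiff_dt hΨ).continuous
  have h2 := (contDiff_dq hΨ).continuous
  have h3 := (contDiff_dq (contDiff_dq hΨ)).continuous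
  unfold gen
  fun_prop

lemma hasCompactSupport_gen (hc : HasCompactSupport Ψ) : HasCompactSupport (gen Ψ) :=
  (hasCompactSupport_dt hc).add
    ((hasCompactSupport_dq (hasCompactSupport_dq hc)).mul_left.add
      (hasCompactSupport_dq hc).mul_left)

lemma exists_bound_of_hasCompactSupport {X : Type*} [TopologicalSpace X] {f : X → ℝ}
    (hf : Continuous f) (hc : HasCompactSupport f) : ∃ C, 0 ≤ C ∧ ∀ x, |f x| ≤ C := by
  obtain ⟨C, hC⟩ := hf.bounded_above_of_compact_support hc
  exact ⟨max C 0, le_max_right _ _, fun x => (hC x).trans (le_max_left _ _)⟩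

/-- A common support bound for a test function and its derivatives. -/
lemma exists_support_radius (hc : HasCompactSupport Ψ) :
    ∃ R : ℝ, 0 < R ∧ ∀ t q w, (R ≤ |t| ∨ R ≤ |q|) →
      Ψ (t, q, w) = 0 ∧ dq Ψ (t, q, w) = 0 ∧ gen Ψ (t, q, w) = 0 := by
  have hb : ∀ {f : ℝ × ℝ × Mom → ℝ}, HasCompactSupport f →
      ∃ R : ℝ, 0 < R ∧ ∀ t q w, (R ≤ |t| ∨ R ≤ |q|) → f (t, q, w) = 0 := by
    intro f hf
    obtain ⟨R, hR0, hR⟩ := hf.isCompact.isBounded.subset_ball_lt 0 (0 : ℝ × ℝ × Mom)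
    refine ⟨R, hR0, fun t q w h => ?_⟩
    by_contra hne
    have := hR (subset_tsupport f hne)
    rw [mem_ball_zero_iff, Prod.norm_def, Prod.norm_def] at this
    simp only [Real.norm_eq_abs] at this
    have h1 : |t| < R := (le_max_left _ _).trans_lt this
    have h2 : |q| < R := ((le_max_left _ _).trans (le_max_right _ _)).trans_lt this
    rcases h with h | h <;> linarith
  obtain ⟨R1, hR1, h1⟩ := hb hc
  obtain ⟨R2, hR2, h2⟩ := hb (hasCompactSupport_dq hc)
  obtain ⟨R3, hR3, h3⟩ := hb (hasCompactSupport_gen hc)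
  refine ⟨R1 + R2 + R3, by positivity, fun t q w h => ⟨h1 _ _ _ ?_, h2 _ _ _ ?_, h3 _ _ _ ?_⟩⟩
  all_goals rcases h with h | h
  all_goals first | (left; linarith) | (right; linarith)

lemma contDiffAt_sph (t : ℝ) {p : Mom} (hp : p ≠ 0) : ContDiffAt ℝ ∞ (sph t) p := by
  have h1 : ContDiffAt ℝ ∞ (fun p : Mom => ‖p‖) p := contDiffAt_norm ℝ hp
  exact contDiffAt_const.prodMk (h1.prodMk ((h1.inv (norm_ne_zero_iff.2 hp)).smul contDiffAt_id))

lemma sph_smul (t : ℝ) {s : ℝ} (hs : 0 < s) (p : Mom) :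
    sph t (s • p) = (t, s * ‖p‖, ‖p‖⁻¹ • p) := by
  simp only [sph, norm_smul, Real.norm_of_nonneg hs.le, smul_smul]
  congr 4
  field_simp

/-- Euler's relation: the derivative in direction `p` is `|p|` times the radial derivative. -/
lemma fderiv_comp_sph_self (hΨ : ContDiff ℝ ∞ Ψ) (t : ℝ) {p : Mom} (hp : p ≠ 0) :
    fderiv ℝ (fun p => Ψ (sph t p)) p p = ‖p‖ * dq Ψ (sph t p) := by
  have hd : DifferentiableAt ℝ (fun p => Ψ (sph t p)) p :=
    (hΨ.contDiffAt.comp p (contDiffAt_sph t hp)).differentiableAt (by simp)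
  have h1 : HasDerivAt (fun s : ℝ => Ψ (sph t (s • p)))
      (fderiv ℝ (fun p => Ψ (sph t p)) p p) 1 := by
    have hs : HasDerivAt (fun s : ℝ => s • p) p 1 := by
      simpa using (hasDerivAt_id (1 : ℝ)).smul_const p
    have hd' := hd.hasFDerivAt
    rw [← one_smul ℝ p] at hd'
    have := hd'.comp_hasDerivAt (1 : ℝ) hs
    simpa [Function.comp_def] using this
  have h2 : HasDerivAt (fun s : ℝ => Ψ (t, s * ‖p‖, ‖p‖⁻¹ • p)) (‖p‖ * dq Ψ (sph t p)) 1 := by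
    have hs : HasDerivAt (fun s : ℝ => s * ‖p‖) ‖p‖ 1 := by
      simpa using (hasDerivAt_id (1 : ℝ)).mul_const ‖p‖
    have hr := hasDerivAt_radial_slice hΨ t (1 * ‖p‖) (‖p‖⁻¹ • p)
    have := hr.comp (1 : ℝ) hs
    rw [mul_comm]
    simpa [sph, Function.comp_def] using this
  refine h1.unique (h2.congr_of_eventuallyEq ?_)
  filter_upwards [lt_mem_nhds (zero_lt_one (α := ℝ))] with s hs
  rw [sph_smul t hs]

lemma sum_coord_mul_pd (f : Mom → ℝ) (p : Mom) : ∑ j, p j * pd j f p = fderiv ℝ f p p := by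
  have hp : p = ∑ j, p j • EuclideanSpace.single j (1 : ℝ) := by
    ext i
    simp [Pi.single_apply]
  conv_rhs => rw [hp]
  rw [map_sum]
  simp only [map_smul, smul_eq_mul]
  rw [← hp]
  rfl

/-- By Euler's relation the flux is `p ∂_qΨ`, and `div (p F) = |p| ∂_q F + 3F` in dimension 3. No
angular derivative survives, which is why `Ψ` may be direction dependent at the origin. -/
lemma ultraOp_comp_sph (hΨ : ContDiff ℝ ∞ Ψ) (t : ℝ) {p : Mom} (hp : p ≠ 0) :
    ultraOp (fun p => Ψ (sph t p)) p
      = ‖p‖ * dq (dq Ψ) (sph t p) + 3 * dq Ψ (sph t p) := by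
  have hflux : ∀ i : Fin 3, (fun p' => ∑ j, diffusion i j p' * pd j (fun p => Ψ (sph t p)) p')
      =ᶠ[𝓝 p] fun p' => p' i * dq Ψ (sph t p') := by
    intro i
    filter_upwards [isOpen_ne.mem_nhds hp] with p' hp'
    have hn : ‖p'‖ ≠ 0 := norm_ne_zero_iff.2 hp'
    have h1 : ∀ j, diffusion i j p' * pd j (fun p => Ψ (sph t p)) p'
        = p' i / ‖p'‖ * (p' j * pd j (fun p => Ψ (sph t p)) p') := by
      intro j; rw [diffusion]; ring
    simp only [h1]
    rw [← Finset.mul_sum, sum_coord_mul_pd, fderiv_comp_sph_self hΨ t hp']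
    field_simp
  have hF : DifferentiableAt ℝ (fun p => dq Ψ (sph t p)) p :=
    ((contDiff_dq hΨ).contDiffAt.comp p (contDiffAt_sph t hp)).differentiableAt (by simp)
  have hpd : ∀ i : Fin 3, pd i (fun p' => ∑ j, diffusion i j p' *
      pd j (fun p => Ψ (sph t p)) p') p
      = p i * pd i (fun p => dq Ψ (sph t p)) p + dq Ψ (sph t p) := by
    intro i
    rw [pd, (hflux i).fderiv_eq]
    have hc : HasFDerivAt (fun p' : Mom => p' i) (EuclideanSpace.proj i : Mom →L[ℝ] ℝ) p :=
      (EuclideanSpace.proj i : Mom →L[ℝ] ℝ).hasFDerivAt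
    have hm := hc.mul hF.hasFDerivAt
    have hm' : fderiv ℝ (fun p' : Mom => p' i * dq Ψ (sph t p')) p = _ := hm.fderiv
    rw [hm']
    simp [pd]
  rw [ultraOp]
  simp only [hpd]
  rw [Finset.sum_add_distrib, sum_coord_mul_pd, fderiv_comp_sph_self (contDiff_dq hΨ) t hp]
  simp

lemma deriv_add_ultraOp (hΨ : ContDiff ℝ ∞ Ψ) {φ : ℝ → Mom → ℝ}
    (hφ : ∀ t p, φ t p = Ψ (sph t p)) (t : ℝ) {p : Mom} (hp : p ≠ 0) :
    deriv (fun s => φ s p) t + ultraOp (φ t) p = gen Ψ (sph t p) := by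
  have h1 : φ t = fun p => Ψ (sph t p) := funext (hφ t)
  have h2 : (fun s => φ s p) = fun s => Ψ (s, ‖p‖, ‖p‖⁻¹ • p) := funext fun s => hφ s p
  rw [h1, h2, ultraOp_comp_sph hΨ t hp, (hasDerivAt_time_slice hΨ t _ _).deriv]
  rfl

lemma integral_mul_deriv_add_ultraOp (hΨ : ContDiff ℝ ∞ Ψ) {φ : ℝ → Mom → ℝ}
    (hφ : ∀ t p, φ t p = Ψ (sph t p)) (g : ℝ → Mom → ℝ) :
    (∫ t in Ioi (0 : ℝ), ∫ p, g t p * (deriv (fun s => φ s p) t + ultraOp (φ t) p))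
      = ∫ t in Ioi (0 : ℝ), ∫ p, g t p * gen Ψ (sph t p) := by
  refine integral_congr_ae (ae_of_all _ fun t => integral_congr_ae ?_)
  filter_upwards [ae_ne_zero_Mom] with p hp
  rw [deriv_add_ultraOp hΨ hφ t hp]

/-- The weak formulation in spherical variables. -/
lemma IsWeakSolution.spherical_identity {T : (ℝ → Mom → ℝ) → Prop} {gin : Mom → ℝ}
    {g : ℝ → Mom → ℝ} (h : IsWeakSolution T gin g) (hΨ : ContDiff ℝ ∞ Ψ)
    (hT : T fun t p => Ψ (sph t p)) :
    (∫ t in Ioi (0 : ℝ), ∫ p, g t p * gen Ψ (sph t p)) + ∫ p, gin p * Ψ (sph 0 p) = 0 := by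
  rw [← integral_mul_deriv_add_ultraOp hΨ (fun _ _ => rfl)]
  exact h.2 _ hT

/-! ### Cutoffs and comparison of the test classes -/

/-- A smooth even cutoff, equal to `1` on `[-1, 1]` and vanishing outside `(-2, 2)`. -/
def cutoff (x : ℝ) : ℝ := Real.smoothTransition (2 - x ^ 2)

lemma contDiff_cutoff : ContDiff ℝ ∞ cutoff :=
  Real.smoothTransition.contDiff.comp (by fun_prop)

lemma cutoff_nonneg (x : ℝ) : 0 ≤ cutoff x := Real.smoothTransition.nonneg _

lemma cutoff_le_one (x : ℝ) : cutoff x ≤ 1 := Real.smoothTransition.le_one _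

lemma cutoff_eq_one {x : ℝ} (h : |x| ≤ 1) : cutoff x = 1 := by
  refine Real.smoothTransition.one_of_one_le ?_
  have := (sq_le_one_iff_abs_le_one x).2 h
  linarith

lemma cutoff_eq_zero {x : ℝ} (h : 2 ≤ |x|) : cutoff x = 0 := by
  refine Real.smoothTransition.zero_of_nonpos ?_
  have : (2 : ℝ) ^ 2 ≤ |x| ^ 2 := by gcongr
  rw [sq_abs] at this
  linarith

/-- `cutoff` depends only on the square of its argument, and `‖p‖²` is smooth, so there is no
singularity at the origin. -/
lemma contDiff_cutoff_norm : ContDiff ℝ ∞ fun p : Mom => cutoff ‖p‖ :=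
  Real.smoothTransition.contDiff.comp (contDiff_const.sub (contDiff_norm_sq ℝ))

lemma contDiff_cutoff_norm_div (R : ℝ) : ContDiff ℝ ∞ fun p : Mom => cutoff (‖p‖ / R) := by
  refine Real.smoothTransition.contDiff.comp (contDiff_const.sub ?_)
  simp only [div_pow]
  exact (contDiff_norm_sq ℝ).div_const _

lemma norm_inv_smul_le_one (p : Mom) : ‖‖p‖⁻¹ • p‖ ≤ 1 := by
  rw [norm_smul, norm_inv, norm_norm]
  exact inv_mul_le_one

lemma hasCompactSupport_of_bounds {a b c : ℝ}
    (h : ∀ t q w, (a < |t| ∨ b < |q| ∨ c < ‖w‖) → Ψ (t, q, w) = 0) : HasCompactSupport Ψ := by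
  refine HasCompactSupport.intro (K := Metric.closedBall (0 : ℝ) a ×ˢ
    (Metric.closedBall (0 : ℝ) b ×ˢ Metric.closedBall (0 : Mom) c))
    ((isCompact_closedBall _ _).prod ((isCompact_closedBall _ _).prod (isCompact_closedBall _ _)))
    ?_
  rintro ⟨t, q, w⟩ hx
  refine h t q w ?_
  by_contra hc
  push Not at hc
  exact hx ⟨by simpa using hc.1, by simpa using hc.2.1, by simpa using hc.2.2⟩

/-- The natural lift `φ(t, q • w)` is smooth but need not have compact support, since `q • w` can
stay bounded while `q` or `w` is large. The factors in `q / R` and `‖w‖` repair this; each is 1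
wherever the lift is evaluated at `‖w‖ ≤ 1` and `|q| ≤ R`. -/
lemma IsTest.isSphericalTest {φ : ℝ → Mom → ℝ} (h : IsTest φ) : IsSphericalTest φ := by
  obtain ⟨hs, hc⟩ := h
  obtain ⟨R, hR0, hR⟩ := hc.isCompact.isBounded.subset_ball_lt 0 (0 : ℝ × Mom)
  have hout : ∀ t p, (R ≤ |t| ∨ R ≤ ‖p‖) → φ t p = 0 := by
    intro t p h
    by_contra hne
    have := hR (subset_tsupport (fun x : ℝ × Mom => φ x.1 x.2) (a := (t, p)) hne)
    rw [mem_ball_zero_iff, Prod.norm_def] at this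
    have h1 : |t| < R := (le_max_left _ _).trans_lt this
    have h2 : ‖p‖ < R := (le_max_right _ _).trans_lt this
    rcases h with h | h <;> linarith
  refine ⟨fun x => φ x.1 (x.2.1 • x.2.2) * cutoff (x.2.1 / R) * cutoff ‖x.2.2‖, ?_, ?_, ?_⟩
  · refine ContDiff.mul (ContDiff.mul ?_ ?_) ?_
    · exact hs.comp (f := fun x : ℝ × ℝ × Mom => (x.1, x.2.1 • x.2.2)) (by fun_prop)
    · exact contDiff_cutoff.comp (by fun_prop)
    · exact contDiff_cutoff_norm.comp (by fun_prop)
  · refine hasCompactSupport_of_bounds (a := R) (b := 2 * R) (c := 2) fun t q w h => ?_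
    rcases h with h | h | h
    · simp [hout t _ (Or.inl h.le)]
    · have : cutoff (q / R) = 0 := by
        apply cutoff_eq_zero
        rw [abs_div, abs_of_pos hR0, le_div_iff₀ hR0]
        exact h.le
      simp [this]
    · have : cutoff ‖w‖ = 0 := cutoff_eq_zero (by simpa using h.le)
      simp [this]
  · intro t p
    have h1 : ‖p‖ • ‖p‖⁻¹ • p = p := by
      rcases eq_or_ne p 0 with rfl | hp
      · simp
      · exact smul_inv_smul₀ (norm_ne_zero_iff.2 hp) p
    have h2 : cutoff ‖‖p‖⁻¹ • p‖ = 1 := cutoff_eq_one (by simpa using norm_inv_smul_le_one p)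
    simp only [h1, h2, mul_one]
    rcases le_or_gt R ‖p‖ with h | h
    · rw [hout t p (Or.inr h), zero_mul]
    · rw [cutoff_eq_one, mul_one]
      rw [abs_div, abs_of_pos hR0, div_le_one hR0, abs_norm]
      exact h.le

lemma IsWeakSolution.isTest {gin : Mom → ℝ} {g : ℝ → Mom → ℝ}
    (h : IsWeakSolution IsSphericalTest gin g) : IsWeakSolution IsTest gin g :=
  ⟨h.1, fun φ hφ => h.2 φ hφ.isSphericalTest⟩

/-! ### The fundamental solution identity and existence -/

lemma integral_radialMeasure_eq_interval {f : ℝ → ℝ} {R : ℝ} (hR : 0 < R)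
    (hf : ∀ q, R ≤ |q| → f q = 0) :
    ∫ q, f q ∂radialMeasure = ∫ q in (0 : ℝ)..R, q ^ 2 * f q := by
  rw [integral_radialMeasure, intervalIntegral.integral_of_le hR.le]
  refine (setIntegral_eq_of_subset_of_forall_sdiff_eq_zero measurableSet_Ioi
    (fun q hq => hq.1) ?_)
  intro q hq
  have h1 : 0 < q := hq.1
  have h2 : R < q := by
    by_contra hc
    exact hq.2 ⟨h1, not_lt.1 hc⟩
  rw [hf q (h2.le.trans (le_abs_self q)), mul_zero]

/-- The pairing of the kernel with a test function is differentiable in time. -/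
lemma hasDerivAt_integral_kern_mul (hΨ : ContDiff ℝ ∞ Ψ) (hc : HasCompactSupport Ψ) (z : ℝ)
    (w : Mom) {t : ℝ} (ht : 0 < t) :
    HasDerivAt (fun s => ∫ q, kern s q z * Ψ (s, q, w) ∂radialMeasure)
      (∫ q, kern t q z * gen Ψ (t, q, w) ∂radialMeasure) t := by
  obtain ⟨R, hR0, hR⟩ := exists_support_radius hc
  have hB : (fun s => ∫ q, kern s q z * Ψ (s, q, w) ∂radialMeasure)
      = fun s => ∫ q in (0 : ℝ)..R, q ^ 2 * (kern s q z * Ψ (s, q, w)) := by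
    funext s
    exact integral_radialMeasure_eq_interval hR0 fun q hq => by
      rw [(hR s q w (Or.inr hq)).1, mul_zero]
  have hN : ∫ q, kern t q z * gen Ψ (t, q, w) ∂radialMeasure
      = ∫ q in (0 : ℝ)..R, q ^ 2 * (kern t q z * gen Ψ (t, q, w)) :=
    integral_radialMeasure_eq_interval hR0 fun q hq => by
      rw [(hR t q w (Or.inr hq)).2.2, mul_zero]
  rw [hB, hN]
  -- continuity of the integrands
  have hslice : Continuous fun x : ℝ × ℝ => ((x.1, x.2, w) : ℝ × ℝ × Mom) := by fun_prop
  have cΨ : Continuous fun x : ℝ × ℝ => Ψ (x.1, x.2, w) := hΨ.continuous.comp hslice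
  have cdt : Continuous fun x : ℝ × ℝ => dt Ψ (x.1, x.2, w) :=
    (contDiff_dt hΨ).continuous.comp hslice
  have cG : ContinuousOn (fun x : ℝ × ℝ => x.2 ^ 2 * (kernDt x.1 x.2 z * Ψ (x.1, x.2, w) +
      kern x.1 x.2 z * dt Ψ (x.1, x.2, w))) {x | 0 < x.1} :=
    (continuous_snd.pow 2).continuousOn.mul
      (((continuousOn_kernDt z).mul cΨ.continuousOn).add
        ((continuousOn_kern z).mul cdt.continuousOn))
  have cF : ContinuousOn (fun x : ℝ × ℝ => x.2 ^ 2 * (kern x.1 x.2 z * Ψ (x.1, x.2, w)))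
      {x | 0 < x.1} :=
    (continuous_snd.pow 2).continuousOn.mul ((continuousOn_kern z).mul cΨ.continuousOn)
  have slice_cont : ∀ {f : ℝ × ℝ → ℝ}, ContinuousOn f {x | 0 < x.1} → ∀ s, 0 < s →
      Continuous fun q => f (s, q) := by
    intro f hf s hs
    exact hf.comp_continuous (by fun_prop) (fun _ => hs)
  -- domination
  have hK : IsCompact (Icc (t / 2) (2 * t) ×ˢ Icc (0 : ℝ) R) := isCompact_Icc.prod isCompact_Icc
  obtain ⟨C, hC⟩ := hK.exists_bound_of_continuousOn (cG.mono (by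
    rintro ⟨s, q⟩ ⟨hs, _⟩
    exact lt_of_lt_of_le (by linarith : 0 < t / 2) hs.1))
  have hderiv := (intervalIntegral.hasDerivAt_integral_of_dominated_loc_of_deriv_le
    (F := fun s q => q ^ 2 * (kern s q z * Ψ (s, q, w)))
    (F' := fun s q => q ^ 2 * (kernDt s q z * Ψ (s, q, w) + kern s q z * dt Ψ (s, q, w)))
    (x₀ := t) (s := Ioo (t / 2) (2 * t)) (a := 0) (b := R) (bound := fun _ => C) (μ := volume)
    (Ioo_mem_nhds (by linarith) (by linarith))
    (by
      filter_upwards [lt_mem_nhds ht] with s hs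
      exact (slice_cont cF s hs).aestronglyMeasurable)
    ((slice_cont cF t ht).intervalIntegrable _ _)
    ((slice_cont cG t ht).aestronglyMeasurable)
    (ae_of_all _ fun q hq s hs => by
      rw [uIoc_of_le hR0.le] at hq
      exact hC (s, q) ⟨⟨hs.1.le, hs.2.le⟩, ⟨hq.1.le, hq.2⟩⟩)
    (by simp)
    (ae_of_all _ fun q _ s hs => by
      have hs0 : 0 < s := lt_trans (by linarith) hs.1
      exact ((hasDerivAt_kern_time hs0 q z).mul (hasDerivAt_time_slice hΨ s q w)).const_mul _)).2
  refine hderiv.congr_deriv ?_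
  -- integration by parts
  rw [← sub_eq_zero, ← intervalIntegral.integral_sub
    ((slice_cont cG t ht).intervalIntegrable _ _)]
  -- Green's identity: the difference of the integrands is the derivative of `q³(∂_qK Ψ - K ∂_qΨ)`.
  -- This vanishes at 0 because of `q³` and at `R` because of the support of `Ψ`.
  · have hprim : ∀ q ∈ uIcc (0 : ℝ) R, HasDerivAt
        (fun q => q ^ 3 * kernDq t q z * Ψ (t, q, w) - q ^ 3 * kern t q z * dq Ψ (t, q, w))
        (q ^ 2 * (kernDt t q z * Ψ (t, q, w) + kern t q z * dt Ψ (t, q, w))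
          - q ^ 2 * (kern t q z * gen Ψ (t, q, w))) q := by
      intro q _
      have h1 := (hasDerivAt_cube_mul_kernDq ht q z).mul (hasDerivAt_radial_slice hΨ t q w)
      have h2 := ((hasDerivAt_pow 3 q).mul (hasDerivAt_kern_radial t q z)).mul
        (hasDerivAt_radial_slice (contDiff_dq hΨ) t q w)
      refine (h1.sub h2).congr_deriv ?_
      simp only [gen, Pi.mul_apply]
      norm_num
      ring
    rw [intervalIntegral.integral_eq_sub_of_hasDerivAt hprim]
    · have := hR t R w (Or.inr (le_abs_self R))
      rw [this.1, this.2.1]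
      simp
    · refine Continuous.intervalIntegrable ((slice_cont cG t ht).sub ?_) _ _
      exact (continuous_pow 2).mul ((slice_cont (continuousOn_kern z) t ht).mul
        ((continuous_gen hΨ).comp (by fun_prop)))
  · refine Continuous.intervalIntegrable ?_ _ _
    exact (continuous_pow 2).mul ((slice_cont (continuousOn_kern z) t ht).mul
        ((continuous_gen hΨ).comp (by fun_prop)))

lemma integrable_kern_mul {t z : ℝ} (ht : 0 < t) (hz : 0 ≤ z) {f : ℝ → ℝ} (hf : Measurable f)
    {C : ℝ} (hC : ∀ q, |f q| ≤ C) : Integrable (fun q => kern t q z * f q) radialMeasure :=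
  (integrable_kern ht hz).1.mul_bdd (c := C) hf.aestronglyMeasurable (ae_of_all _ hC)

lemma abs_integral_kern_mul_le {t z : ℝ} (ht : 0 < t) (hz : 0 ≤ z) {f : ℝ → ℝ}
    {C : ℝ} (hC : ∀ q, |f q| ≤ C) : |∫ q, kern t q z * f q ∂radialMeasure| ≤ C := by
  have h := norm_integral_le_of_norm_le (f := fun q => kern t q z * f q)
    ((integrable_kern ht hz).1.mul_const C) (by
      filter_upwards [ae_radialMeasure_pos] with q hq
      have := kern_nonneg ht hq.le hz
      rw [norm_mul, Real.norm_of_nonneg this]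
      exact mul_le_mul_of_nonneg_left (hC q) this)
  rwa [integral_mul_const, (integrable_kern ht hz).2, one_mul] at h

/-- The kernel concentrates at `z` as `t → 0`. -/
lemma tendsto_integral_kern_mul (hΨ : ContDiff ℝ ∞ Ψ) (hc : HasCompactSupport Ψ) {z : ℝ}
    (hz : 0 ≤ z) (w : Mom) :
    Tendsto (fun s => ∫ q, kern s q z * Ψ (s, q, w) ∂radialMeasure) (𝓝[>] 0)
      (𝓝 (Ψ (0, z, w))) := by
  obtain ⟨L, hL⟩ := hΨ.lipschitzWith_of_hasCompactSupport hc (by simp)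
  obtain ⟨C, -, hC⟩ := exists_bound_of_hasCompactSupport hΨ.continuous hc
  have hlip : ∀ t > 0, ∀ q, |Ψ (t, q, w) - Ψ (0, z, w)| ≤ L * (t + |q - z|) := by
    intro t ht q
    have h := hL.dist_le_mul (t, q, w) (0, z, w)
    rw [Real.dist_eq] at h
    refine h.trans (mul_le_mul_of_nonneg_left ?_ L.2)
    simp only [Prod.dist_eq, dist_self, Real.dist_eq, sub_zero, abs_of_pos ht]
    have := abs_nonneg (q - z)
    refine max_le (by linarith) (max_le (by linarith) (by linarith))
  -- The Lipschitz bound leaves the mean of `|q - z|`. Young's inequality with weight `√t` bounds it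
  -- by `√t/2` plus the second moment `2zt + 12t²` divided by `2√t`, which is of order `√t`.
  have hbound : ∀ t > 0, |(∫ q, kern t q z * Ψ (t, q, w) ∂radialMeasure) - Ψ (0, z, w)|
      ≤ L * (t + (√t + (2 * z * √t + 12 * t * √t)) / 2) := by
    intro t ht
    have hk := integrable_kern ht hz
    have hv := integrable_dist_sq_mul_kern ht hz
    have hst : 0 < √t := Real.sqrt_pos.2 ht
    have hIΨ : Integrable (fun q => kern t q z * Ψ (t, q, w)) radialMeasure :=
      integrable_kern_mul ht hz (hΨ.continuous.measurable.comp (by fun_prop)) (fun q => hC _)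
    have h1 : (∫ q, kern t q z * Ψ (t, q, w) ∂radialMeasure) - Ψ (0, z, w)
        = ∫ q, (kern t q z * Ψ (t, q, w) - kern t q z * Ψ (0, z, w)) ∂radialMeasure := by
      rw [integral_sub hIΨ (hk.1.mul_const _), integral_mul_const, hk.2, one_mul]
    have hmaj : Integrable (fun q => (L : ℝ) * (t + √t / 2) * kern t q z +
        L / (2 * √t) * ((q - z) ^ 2 * kern t q z)) radialMeasure :=
      (hk.1.const_mul _).add (hv.1.const_mul _)
    rw [h1, ← Real.norm_eq_abs]
    refine (norm_integral_le_of_norm_le hmaj ?_).trans (le_of_eq ?_)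
    · filter_upwards [ae_radialMeasure_pos] with q hq
      have hkn := kern_nonneg ht hq.le hz
      rw [← mul_sub, norm_mul, Real.norm_of_nonneg hkn, Real.norm_eq_abs]
      have hyoung : |q - z| ≤ √t / 2 + (q - z) ^ 2 / (2 * √t) := by
        rw [← sub_nonneg]
        have : √t / 2 + (q - z) ^ 2 / (2 * √t) - |q - z| = (√t - |q - z|) ^ 2 / (2 * √t) := by
          rw [← sq_abs (q - z)]
          field_simp
          ring
        rw [this]
        positivity
      calc kern t q z * |Ψ (t, q, w) - Ψ (0, z, w)|
          ≤ kern t q z * (L * (t + (√t / 2 + (q - z) ^ 2 / (2 * √t)))) := by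
            gcongr
            exact (hlip t ht q).trans (by gcongr)
        _ = _ := by ring
    · rw [integral_add (hk.1.const_mul _) (hv.1.const_mul _), integral_const_mul,
        integral_const_mul, hk.2, hv.2]
      have hsq : t = √t * √t := (Real.mul_self_sqrt ht.le).symm
      generalize √t = r at *
      subst hsq
      field_simp
      ring
  rw [tendsto_iff_norm_sub_tendsto_zero]
  have hlim : Tendsto (fun t : ℝ => L * (t + (√t + (2 * z * √t + 12 * t * √t)) / 2)) (𝓝[>] 0)
      (𝓝 0) := by
    have hcont : Continuous fun t : ℝ => (L : ℝ) * (t + (√t + (2 * z * √t + 12 * t * √t)) / 2) := by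
      fun_prop
    have := hcont.tendsto 0
    simp only [Real.sqrt_zero, mul_zero, add_zero, zero_div] at this
    exact this.mono_left nhdsWithin_le_nhds
  refine squeeze_zero' (Eventually.of_forall fun _ => norm_nonneg _) ?_ hlim
  filter_upwards [self_mem_nhdsWithin] with t ht using hbound t ht

/-- The fundamental solution identity on a ray. -/
lemma integral_integral_kern_mul_gen (hΨ : ContDiff ℝ ∞ Ψ) (hc : HasCompactSupport Ψ) {z : ℝ}
    (hz : 0 ≤ z) (w : Mom) :
    ∫ t in Ioi (0 : ℝ), ∫ q, kern t q z * gen Ψ (t, q, w) ∂radialMeasure = -Ψ (0, z, w) := by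
  obtain ⟨R, hR0, hR⟩ := exists_support_radius hc
  obtain ⟨C, hC0, hC⟩ := exists_bound_of_hasCompactSupport (continuous_gen hΨ)
    (hasCompactSupport_gen hc)
  set B : ℝ → ℝ := fun s => ∫ q, kern s q z * Ψ (s, q, w) ∂radialMeasure with hB
  have hmeas : StronglyMeasurable fun t =>
      ∫ q, kern t q z * gen Ψ (t, q, w) ∂radialMeasure := by
    refine StronglyMeasurable.integral_prod_right'
      (f := fun x : ℝ × ℝ => kern x.1 x.2 z * gen Ψ (x.1, x.2, w)) (Measurable.stronglyMeasurable ?_)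
    exact (measurable_kern.comp (g := fun x : ℝ × ℝ × ℝ => kern x.1 x.2.1 x.2.2)
      (f := fun x : ℝ × ℝ => (x.1, x.2, z)) (by fun_prop)).mul
      ((continuous_gen hΨ).measurable.comp (by fun_prop))
  have hint : IntegrableOn (fun t => ∫ q, kern t q z * gen Ψ (t, q, w) ∂radialMeasure)
      (Ioi (0 : ℝ)) := by
    have h1 : IntegrableOn (fun t => ∫ q, kern t q z * gen Ψ (t, q, w) ∂radialMeasure)
        (Ioc (0 : ℝ) R) := by
      refine IntegrableOn.of_bound (by simp) hmeas.aestronglyMeasurable C ?_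
      filter_upwards [ae_restrict_mem measurableSet_Ioc] with t ht
      exact abs_integral_kern_mul_le ht.1 hz fun q => hC _
    refine h1.of_forall_sdiff_eq_zero measurableSet_Ioi ?_
    intro t ht
    have h1 : 0 < t := ht.1
    have h2 : R < t := by
      by_contra hcon
      exact ht.2 ⟨h1, not_lt.1 hcon⟩
    simp [(hR t _ w (Or.inl (h2.le.trans (le_abs_self t)))).2.2]
  -- At `t = 0` the kernel is a meaningless division by zero, so the pairing is redefined there as
  -- its right limit. It vanishes for large `t`, hence `m := 0`.
  have h := integral_Ioi_of_hasDerivAt_of_tendsto (a := 0) (m := 0)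
    (f := Function.update B 0 (Ψ (0, z, w))) ?_ ?_ hint ?_
  · rw [h]; simp
  · rw [continuousWithinAt_update_same]
    have : Ici (0 : ℝ) \ {0} = Ioi 0 := by
      rw [Ici_sdiff_left]
    rw [this]
    exact tendsto_integral_kern_mul hΨ hc hz w
  · intro t ht
    have ht' : (0 : ℝ) < t := ht
    refine (hasDerivAt_integral_kern_mul hΨ hc z w ht').congr_of_eventuallyEq ?_
    filter_upwards [lt_mem_nhds ht'] with s hs
    rw [Function.update_of_ne hs.ne']
  · refine tendsto_const_nhds.congr' ?_
    filter_upwards [eventually_ge_atTop R] with t ht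
    rw [Function.update_of_ne (hR0.trans_le ht).ne', hB]
    simp [(hR t _ w (Or.inl (ht.trans (le_abs_self t)))).1]

/-- Duality puts the kernel on the test function, Fubini brings the time integral inside, and the
fundamental solution identity applies at each `p` with `z = ‖p‖`. -/
lemma isWeakSolution_raySol {gin : Mom → ℝ} (hg : Measurable gin) (hi : Integrable gin) :
    IsWeakSolution IsSphericalTest gin (raySol gin) := by
  refine ⟨memLinftyL1_raySol hg hi, ?_⟩
  rintro φ ⟨Ψ, hΨ, hc, hφ⟩
  obtain ⟨R, hR0, hR⟩ := exists_support_radius hc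
  obtain ⟨C, hC0, hC⟩ := exists_bound_of_hasCompactSupport (continuous_gen hΨ)
    (hasCompactSupport_gen hc)
  rw [integral_mul_deriv_add_ultraOp hΨ hφ]
  set N : ℝ → Mom → ℝ := fun t p =>
    ∫ q, kern t q ‖p‖ * gen Ψ (t, q, ‖p‖⁻¹ • p) ∂radialMeasure with hN
  have hdual : ∀ t ∈ Ioi (0 : ℝ), ∫ p, raySol gin t p * gen Ψ (sph t p)
      = ∫ p, gin p * N t p := by
    intro t ht
    exact integral_raySol_mul hg hi (Φ := fun q w => gen Ψ (t, q, w))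
      ((continuous_gen hΨ).measurable.comp (by fun_prop)) (fun q w => hC _) ht
  rw [setIntegral_congr_fun measurableSet_Ioi hdual]
  have hNmeas : StronglyMeasurable fun x : ℝ × Mom => N x.1 x.2 := by
    refine StronglyMeasurable.integral_prod_right' (f := fun x : (ℝ × Mom) × ℝ =>
      kern x.1.1 x.2 ‖x.1.2‖ * gen Ψ (x.1.1, x.2, ‖x.1.2‖⁻¹ • x.1.2))
      (Measurable.stronglyMeasurable ?_)
    exact (measurable_kern.comp (g := fun x : ℝ × ℝ × ℝ => kern x.1 x.2.1 x.2.2)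
      (f := fun x : (ℝ × Mom) × ℝ => (x.1.1, x.2, ‖x.1.2‖)) (by fun_prop)).mul
      ((continuous_gen hΨ).measurable.comp (by fun_prop))
  have hNint : Integrable (fun x : ℝ × Mom => gin x.2 * N x.1 x.2)
      ((volume.restrict (Ioi (0 : ℝ))).prod volume) := by
    -- Since the kernel has mass 1, `N` is bounded by `C`; for `t > R` it vanishes with `gen Ψ`.
    have hmaj : Integrable (fun x : ℝ × Mom => (Ioc 0 R).indicator (fun _ => C) x.1 * ‖gin x.2‖)
        ((volume.restrict (Ioi (0 : ℝ))).prod volume) := by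
      refine Integrable.mul_prod ?_ hi.norm
      refine Integrable.restrict (IntegrableOn.integrable_indicator ?_ measurableSet_Ioc)
      exact integrableOn_const (by simp)
    refine hmaj.mono' ((hg.comp measurable_snd).mul hNmeas.measurable).aestronglyMeasurable ?_
    have hpos : ∀ᵐ x ∂((volume.restrict (Ioi (0 : ℝ))).prod (volume : Measure Mom)), 0 < x.1 :=
      Measure.quasiMeasurePreserving_fst.ae (ae_restrict_mem measurableSet_Ioi)
    filter_upwards [hpos] with x hx
    rw [norm_mul, mul_comm]
    refine mul_le_mul_of_nonneg_right ?_ (norm_nonneg _)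
    rcases le_or_gt x.1 R with h | h
    · rw [indicator_of_mem (show x.1 ∈ Ioc 0 R from ⟨hx, h⟩)]
      exact abs_integral_kern_mul_le hx (norm_nonneg _) fun q => hC _
    · rw [indicator_of_notMem (fun hmem => absurd hmem.2 (not_le.2 h))]
      simp [hN, (hR x.1 _ _ (Or.inl (h.le.trans (le_abs_self _)))).2.2]
  rw [integral_integral_swap hNint]
  have hz : ∀ p, ∫ t in Ioi (0 : ℝ), gin p * N t p = -(gin p * φ 0 p) := by
    intro p
    rw [integral_const_mul, hN, integral_integral_kern_mul_gen hΨ hc (norm_nonneg p), hφ]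
    ring
  simp only [hz]
  rw [integral_neg, neg_add_cancel]

/-! ### Space-time integrals against weak solutions -/

/-- Lebesgue measure on `(0, ∞) × ℝ³`. -/
def spaceTime : Measure (ℝ × Mom) := (volume.restrict (Ioi (0 : ℝ))).prod volume

instance : SFinite spaceTime := by
  unfold spaceTime
  infer_instance

lemma ae_spaceTime : ∀ᵐ x ∂spaceTime, 0 < x.1 ∧ x.2 ≠ 0 := by
  have h1 : ∀ᵐ x ∂spaceTime, 0 < x.1 :=
    Measure.quasiMeasurePreserving_fst.ae (ae_restrict_mem measurableSet_Ioi)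
  have h2 : ∀ᵐ x ∂spaceTime, x.2 ≠ 0 := Measure.quasiMeasurePreserving_snd.ae ae_ne_zero_Mom
  filter_upwards [h1, h2] with x a b using ⟨a, b⟩

/-- A bound on the `L¹` norm uniform in time gives integrability only over bounded time intervals,
hence the truncation at `T`. -/
lemma MemLinftyL1.integrableOn {h : ℝ → Mom → ℝ} (hh : MemLinftyL1 h) (T : ℝ) :
    Integrable (fun x : ℝ × Mom => {x : ℝ × Mom | x.1 ≤ T}.indicator (fun x => h x.1 x.2) x)
      spaceTime := by
  obtain ⟨hm, C, hC⟩ := hh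
  have hset : MeasurableSet {x : ℝ × Mom | x.1 ≤ T} := measurableSet_le measurable_fst measurable_const
  have hm' : AEStronglyMeasurable
      (fun x : ℝ × Mom => {x : ℝ × Mom | x.1 ≤ T}.indicator (fun x => h x.1 x.2) x) spaceTime :=
    hm.indicator hset
  have hslice : ∀ t p, {x : ℝ × Mom | x.1 ≤ T}.indicator (fun x => h x.1 x.2) (t, p)
      = (Iic T).indicator (fun _ => h t p) t := by
    intro t p
    by_cases ht : t ≤ T <;> simp [indicator, ht]
  rw [spaceTime, integrable_prod_iff hm']
  refine ⟨?_, ?_⟩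
  · filter_upwards [hC] with t ht
    simp only [hslice]
    by_cases h1 : t ∈ Iic T <;> simp [h1, ht.1]
  · have hb : Integrable (fun t => (Iic T).indicator (fun _ => C) t)
        (volume.restrict (Ioi (0 : ℝ))) := by
      rw [integrable_indicator_iff measurableSet_Iic]
      refine integrableOn_const ?_
      rw [Measure.restrict_apply measurableSet_Iic, Iic_inter_Ioi]
      simp
    refine hb.mono' hm'.norm.integral_prod_right' ?_
    filter_upwards [hC] with t ht
    rw [Real.norm_of_nonneg (integral_nonneg fun _ => norm_nonneg _)]
    simp only [hslice]
    by_cases h1 : t ∈ Iic T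
    · simp only [indicator_of_mem h1, Real.norm_eq_abs]
      exact ht.2
    · simp [h1]

lemma mul_eq_indicator_mul (h : ℝ → Mom → ℝ) {F : ℝ × Mom → ℝ} {T : ℝ}
    (hT : ∀ x : ℝ × Mom, T < x.1 → F x = 0) :
    (fun x : ℝ × Mom => h x.1 x.2 * F x)
      = fun x => {x : ℝ × Mom | x.1 ≤ T}.indicator (fun x => h x.1 x.2) x * F x := by
  funext x
  by_cases hx : x.1 ≤ T
  · simp [indicator, hx]
  · simp [hT x (not_le.1 hx)]

lemma MemLinftyL1.integrable_mul {h : ℝ → Mom → ℝ} (hh : MemLinftyL1 h) {F : ℝ × Mom → ℝ}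
    (hF : AEStronglyMeasurable F spaceTime) {C T : ℝ} (hC : ∀ᵐ x ∂spaceTime, |F x| ≤ C)
    (hT : ∀ x : ℝ × Mom, T < x.1 → F x = 0) :
    Integrable (fun x : ℝ × Mom => h x.1 x.2 * F x) spaceTime := by
  rw [mul_eq_indicator_mul h hT]
  exact (hh.integrableOn T).mul_bdd (c := C) hF hC

/-- Dominated convergence with majorant `C |h|` on `t ≤ T`. The removals of cutoffs and the shell
estimate below pass to the limit through it. -/
lemma MemLinftyL1.tendsto_integral_mul {h : ℝ → Mom → ℝ} (hh : MemLinftyL1 h)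
    {F : ℕ → ℝ × Mom → ℝ} {G : ℝ × Mom → ℝ}
    (hF : ∀ n, AEStronglyMeasurable (F n) spaceTime) {C T : ℝ}
    (hC : ∀ n, ∀ᵐ x ∂spaceTime, |F n x| ≤ C) (hT : ∀ n, ∀ x : ℝ × Mom, T < x.1 → F n x = 0)
    (hlim : ∀ᵐ x ∂spaceTime, Tendsto (fun n => F n x) atTop (𝓝 (G x))) :
    Tendsto (fun n => ∫ x, h x.1 x.2 * F n x ∂spaceTime) atTop
      (𝓝 (∫ x, h x.1 x.2 * G x ∂spaceTime)) := by
  refine tendsto_integral_of_dominated_convergence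
    (fun x => ‖{x : ℝ × Mom | x.1 ≤ T}.indicator (fun x => h x.1 x.2) x‖ * C)
    (fun n => (hh.integrable_mul (hF n) (hC n) (hT n)).1) ((hh.integrableOn T).norm.mul_const C)
    ?_ ?_
  · intro n
    filter_upwards [hC n] with x hx
    rw [congrFun (mul_eq_indicator_mul h (hT n)) x, norm_mul]
    exact mul_le_mul_of_nonneg_left hx (norm_nonneg _)
  · filter_upwards [hlim] with x hx using hx.const_mul _

/-- A continuous compactly supported function of the spherical variables, as a multiplier. -/
lemma aestronglyMeasurable_comp_sph {Φ : ℝ × ℝ × Mom → ℝ} (hΦ : Continuous Φ) :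
    AEStronglyMeasurable (fun x : ℝ × Mom => Φ (sph x.1 x.2)) spaceTime :=
  (hΦ.measurable.comp measurable_sph).aestronglyMeasurable

lemma MemLinftyL1.integrable_mul_gen {h : ℝ → Mom → ℝ} (hh : MemLinftyL1 h)
    (hΨ : ContDiff ℝ ∞ Ψ) (hc : HasCompactSupport Ψ) :
    Integrable (fun x : ℝ × Mom => h x.1 x.2 * gen Ψ (sph x.1 x.2)) spaceTime := by
  obtain ⟨R, hR0, hR⟩ := exists_support_radius hc
  obtain ⟨C, -, hC⟩ := exists_bound_of_hasCompactSupport (continuous_gen hΨ)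
    (hasCompactSupport_gen hc)
  exact hh.integrable_mul (aestronglyMeasurable_comp_sph (continuous_gen hΨ))
    (ae_of_all _ fun x => hC _) (T := R) fun x hx =>
      (hR _ _ _ (Or.inl (hx.le.trans (le_abs_self _)))).2.2

lemma MemLinftyL1.integral_integral_mul_gen {h : ℝ → Mom → ℝ} (hh : MemLinftyL1 h)
    (hΨ : ContDiff ℝ ∞ Ψ) (hc : HasCompactSupport Ψ) :
    ∫ t in Ioi (0 : ℝ), ∫ p, h t p * gen Ψ (sph t p)
      = ∫ x, h x.1 x.2 * gen Ψ (sph x.1 x.2) ∂spaceTime :=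
  (integral_prod _ (hh.integrable_mul_gen hΨ hc)).symm

lemma IsWeakSolution.spaceTime_identity {T : (ℝ → Mom → ℝ) → Prop} {gin : Mom → ℝ}
    {g : ℝ → Mom → ℝ} (h : IsWeakSolution T gin g) (hΨ : ContDiff ℝ ∞ Ψ)
    (hc : HasCompactSupport Ψ) (hT : T fun t p => Ψ (sph t p)) :
    (∫ x, g x.1 x.2 * gen Ψ (sph x.1 x.2) ∂spaceTime) + ∫ p, gin p * Ψ (sph 0 p) = 0 := by
  rw [← h.1.integral_integral_mul_gen hΨ hc]
  exact h.spherical_identity hΨ hT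

lemma tendsto_integral_mul_of_bounded {gin : Mom → ℝ} (hi : Integrable gin)
    {f : ℕ → Mom → ℝ} {g : Mom → ℝ} (hf : ∀ n, AEStronglyMeasurable (f n) volume) {C : ℝ}
    (hC : ∀ n p, |f n p| ≤ C) (hlim : ∀ p, p ≠ 0 → Tendsto (fun n => f n p) atTop (𝓝 (g p))) :
    Tendsto (fun n => ∫ p, gin p * f n p) atTop (𝓝 (∫ p, gin p * g p)) := by
  refine tendsto_integral_of_dominated_convergence (fun p => ‖gin p‖ * C)
    (fun n => hi.1.mul (hf n)) (hi.norm.mul_const C) ?_ ?_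
  · intro n
    refine ae_of_all _ fun p => ?_
    rw [norm_mul]
    exact mul_le_mul_of_nonneg_left (hC n p) (norm_nonneg _)
  · filter_upwards [ae_ne_zero_Mom] with p hp using (hlim p hp).const_mul _

/-! ### Product rules and radial cutoffs -/

lemma dq_eq_of_hasDerivAt {t q : ℝ} {w : Mom} {d : ℝ} (hd : DifferentiableAt ℝ Ψ (t, q, w))
    (h : HasDerivAt (fun s => Ψ (t, s, w)) d q) : dq Ψ (t, q, w) = d := by
  have h2 : HasDerivAt (fun s : ℝ => (t, s, w)) ((0 : ℝ), (1 : ℝ), (0 : Mom)) q :=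
    (hasDerivAt_const q t).prodMk ((hasDerivAt_id q).prodMk (hasDerivAt_const q w))
  exact (hd.hasFDerivAt.comp_hasDerivAt q h2).unique h

lemma dt_eq_of_hasDerivAt {t q : ℝ} {w : Mom} {d : ℝ} (hd : DifferentiableAt ℝ Ψ (t, q, w))
    (h : HasDerivAt (fun s => Ψ (s, q, w)) d t) : dt Ψ (t, q, w) = d := by
  have h2 : HasDerivAt (fun s : ℝ => (s, q, w)) ((1 : ℝ), (0 : ℝ), (0 : Mom)) t :=
    (hasDerivAt_id t).prodMk (hasDerivAt_const t (q, w))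
  exact (hd.hasFDerivAt.comp_hasDerivAt t h2).unique h

/-- Product rule for multiplication by a function of the radius. -/
lemma gen_mul_radial {A : ℝ × ℝ × Mom → ℝ} (hA : ContDiff ℝ ∞ A) {r r' r'' : ℝ → ℝ}
    (h1 : ∀ q, HasDerivAt r (r' q) q) (h2 : ∀ q, HasDerivAt r' (r'' q) q) (x : ℝ × ℝ × Mom) :
    gen (fun x => A x * r x.2.1) x = r x.2.1 * gen A x + 2 * x.2.1 * r' x.2.1 * dq A x
      + A x * (x.2.1 * r'' x.2.1 + 3 * r' x.2.1) := by
  have hdA : Differentiable ℝ A := hA.differentiable (by simp)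
  have hdA' : Differentiable ℝ (dq A) := (contDiff_dq hA).differentiable (by simp)
  have hr : Differentiable ℝ fun x : ℝ × ℝ × Mom => r x.2.1 :=
    Differentiable.comp (g := r) (fun q => (h1 q).differentiableAt) (by fun_prop)
  have hr' : Differentiable ℝ fun x : ℝ × ℝ × Mom => r' x.2.1 :=
    Differentiable.comp (g := r') (fun q => (h2 q).differentiableAt) (by fun_prop)
  have hdq : dq (fun x => A x * r x.2.1) = fun x => dq A x * r x.2.1 + A x * r' x.2.1 := by
    funext ⟨t, q, w⟩
    exact dq_eq_of_hasDerivAt (hdA.mul hr _) ((hasDerivAt_radial_slice hA t q w).mul (h1 q))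
  obtain ⟨t, q, w⟩ := x
  have hdq2 : dq (dq fun x => A x * r x.2.1) (t, q, w)
      = (dq (dq A) (t, q, w) * r q + dq A (t, q, w) * r' q)
        + (dq A (t, q, w) * r' q + A (t, q, w) * r'' q) := by
    rw [hdq]
    exact dq_eq_of_hasDerivAt ((hdA'.mul hr _).add (hdA.mul hr' _))
      (((hasDerivAt_radial_slice (contDiff_dq hA) t q w).mul (h1 q)).add
        ((hasDerivAt_radial_slice hA t q w).mul (h2 q)))
  have hdt : dt (fun x => A x * r x.2.1) (t, q, w) = dt A (t, q, w) * r q :=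
    dt_eq_of_hasDerivAt (hdA.mul hr _) ((hasDerivAt_time_slice hA t q w).mul_const (r q))
  rw [gen, hdq2, hdt, hdq, gen]
  ring

lemma gen_time_mul_direction {ζ : ℝ → ℝ} {b : Mom → ℝ} (hζ : ContDiff ℝ ∞ ζ) (hb : ContDiff ℝ ∞ b)
    (t q : ℝ) (w : Mom) :
    gen (fun x => ζ x.1 * b x.2.2) (t, q, w) = deriv ζ t * b w ∧
      dq (fun x => ζ x.1 * b x.2.2) (t, q, w) = 0 := by
  have hA : ContDiff ℝ ∞ fun x : ℝ × ℝ × Mom => ζ x.1 * b x.2.2 :=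
    (hζ.comp contDiff_fst).mul (hb.comp (by fun_prop))
  have hd := hA.differentiable (by simp)
  have hdq : dq (fun x => ζ x.1 * b x.2.2) = fun _ => 0 := by
    funext ⟨t, q, w⟩
    exact dq_eq_of_hasDerivAt (hd _) (hasDerivAt_const q (ζ t * b w))
  have hdq2 : dq (fun _ => (0 : ℝ)) (t, q, w) = 0 := by simp [dq]
  have hdt : dt (fun x => ζ x.1 * b x.2.2) (t, q, w) = deriv ζ t * b w :=
    dt_eq_of_hasDerivAt (hd _)
      ((hζ.differentiable (by simp) t).hasDerivAt.mul_const (b w))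
  refine ⟨?_, by rw [hdq]⟩
  rw [gen, hdq, hdq2, hdt]
  ring

/-- The first derivative of the cutoff. -/
def cutoff' (x : ℝ) : ℝ := deriv cutoff x

/-- The second derivative of the cutoff. -/
def cutoff'' (x : ℝ) : ℝ := deriv cutoff' x

lemma contDiff_cutoff' : ContDiff ℝ ∞ cutoff' :=
  ((contDiff_infty_iff_deriv (f := cutoff)).1 contDiff_cutoff).2

lemma contDiff_cutoff'' : ContDiff ℝ ∞ cutoff'' :=
  ((contDiff_infty_iff_deriv (f := cutoff')).1 contDiff_cutoff').2

lemma hasDerivAt_cutoff (x : ℝ) : HasDerivAt cutoff (cutoff' x) x :=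
  (contDiff_cutoff.differentiable (by simp) x).hasDerivAt

lemma hasDerivAt_cutoff' (x : ℝ) : HasDerivAt cutoff' (cutoff'' x) x :=
  (contDiff_cutoff'.differentiable (by simp) x).hasDerivAt

lemma cutoff'_eq_zero {x : ℝ} (h : |x| < 1 ∨ 2 < |x|) : cutoff' x = 0 := by
  rcases h with h | h
  · have : cutoff =ᶠ[𝓝 x] fun _ => 1 := by
      filter_upwards [continuous_abs.continuousAt.eventually_lt continuousAt_const h] with y hy
      exact cutoff_eq_one hy.le
    rw [cutoff', this.deriv_eq, deriv_const]
  · have : cutoff =ᶠ[𝓝 x] fun _ => 0 := by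
      filter_upwards [continuousAt_const.eventually_lt continuous_abs.continuousAt h] with y hy
      exact cutoff_eq_zero (le_of_lt hy)
    rw [cutoff', this.deriv_eq, deriv_const]

lemma cutoff''_eq_zero {x : ℝ} (h : |x| < 1 ∨ 2 < |x|) : cutoff'' x = 0 := by
  have : cutoff' =ᶠ[𝓝 x] fun _ => 0 := by
    rcases h with h | h
    · filter_upwards [continuous_abs.continuousAt.eventually_lt continuousAt_const h] with y hy
      exact cutoff'_eq_zero (Or.inl hy)
    · filter_upwards [continuousAt_const.eventually_lt continuous_abs.continuousAt h] with y hy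
      exact cutoff'_eq_zero (Or.inr hy)
  rw [cutoff'', this.deriv_eq, deriv_const]

/-- The radial operator applied to the cutoff. -/
def cutoffL (x : ℝ) : ℝ := x * cutoff'' x + 3 * cutoff' x

lemma cutoffL_eq_zero {x : ℝ} (h : |x| < 1 ∨ 2 < |x|) : cutoffL x = 0 := by
  rw [cutoffL, cutoff'_eq_zero h, cutoff''_eq_zero h]; ring

lemma exists_cutoff_bound :
    ∃ K, 0 ≤ K ∧ ∀ x, |cutoff' x| ≤ K ∧ |x * cutoff' x| ≤ K ∧ |cutoffL x| ≤ K := by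
  have hs : ∀ f : ℝ → ℝ, (∀ x, 2 < |x| → f x = 0) → HasCompactSupport f := by
    intro f hf
    refine HasCompactSupport.intro (isCompact_closedBall (0 : ℝ) 2) fun x hx => hf x ?_
    simpa using hx
  have c1 := contDiff_cutoff'.continuous
  have c2 := contDiff_cutoff''.continuous
  obtain ⟨K1, hK1, h1⟩ := exists_bound_of_hasCompactSupport c1
    (hs _ fun x hx => cutoff'_eq_zero (Or.inr hx))
  obtain ⟨K2, hK2, h2⟩ := exists_bound_of_hasCompactSupport (f := fun x => x * cutoff' x)
    (by fun_prop) (hs _ fun x hx => by rw [cutoff'_eq_zero (Or.inr hx), mul_zero])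
  obtain ⟨K3, hK3, h3⟩ := exists_bound_of_hasCompactSupport (f := cutoffL)
    (by unfold cutoffL; fun_prop) (hs _ fun x hx => cutoffL_eq_zero (Or.inr hx))
  refine ⟨K1 + K2 + K3, by positivity, fun x => ⟨?_, ?_, ?_⟩⟩
  · linarith [h1 x]
  · linarith [h2 x]
  · linarith [h3 x]

lemma hasDerivAt_cutoff_div (R q : ℝ) :
    HasDerivAt (fun q => cutoff (q / R)) (cutoff' (q / R) / R) q := by
  have := (hasDerivAt_cutoff (q / R)).comp q ((hasDerivAt_id q).div_const R)
  refine this.congr_deriv ?_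
  ring

lemma hasDerivAt_cutoff'_div (R q : ℝ) :
    HasDerivAt (fun q => cutoff' (q / R) / R) (cutoff'' (q / R) / R ^ 2) q := by
  have := ((hasDerivAt_cutoff' (q / R)).comp q ((hasDerivAt_id q).div_const R)).div_const R
  refine this.congr_deriv ?_
  field_simp

/-- The effect of a radial cutoff at scale `R`. -/
lemma gen_mul_cutoff {A : ℝ × ℝ × Mom → ℝ} (hA : ContDiff ℝ ∞ A) {R : ℝ} (hR : 0 < R)
    (x : ℝ × ℝ × Mom) :
    gen (fun x => A x * cutoff (x.2.1 / R)) x = cutoff (x.2.1 / R) * gen A x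
      + 2 * (x.2.1 / R * cutoff' (x.2.1 / R)) * dq A x
      + A x * (cutoffL (x.2.1 / R) / R) := by
  rw [gen_mul_radial hA (hasDerivAt_cutoff_div R) (hasDerivAt_cutoff'_div R), cutoffL]
  field_simp

/-- Both commutator terms live on the shell `R ≤ q ≤ 2R`. The coefficient of `dq A` is bounded
uniformly in `R`, but that of `A` has size `1/R`, which is singular when the cutoff shrinks to the
origin. -/
lemma gen_mul_one_sub_cutoff {A : ℝ × ℝ × Mom → ℝ} (hA : ContDiff ℝ ∞ A) {R : ℝ} (hR : 0 < R)
    (x : ℝ × ℝ × Mom) :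
    gen (fun x => A x * (1 - cutoff (x.2.1 / R))) x = (1 - cutoff (x.2.1 / R)) * gen A x
      - 2 * (x.2.1 / R * cutoff' (x.2.1 / R)) * dq A x
      - A x * (cutoffL (x.2.1 / R) / R) := by
  rw [gen_mul_radial hA (r := fun q => 1 - cutoff (q / R))
    (fun q => (hasDerivAt_cutoff_div R q).const_sub 1)
    (fun q => (hasDerivAt_cutoff'_div R q).fun_neg), cutoffL]
  field_simp
  ring

lemma contDiffAt_sph_joint {x : ℝ × Mom} (hx : x.2 ≠ 0) :
    ContDiffAt ℝ ∞ (fun x : ℝ × Mom => sph x.1 x.2) x := by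
  have h1 : ContDiffAt ℝ ∞ (fun x : ℝ × Mom => ‖x.2‖) x := contDiffAt_snd.norm ℝ hx
  exact contDiffAt_fst.prodMk
    (h1.prodMk ((h1.inv (norm_ne_zero_iff.2 hx)).smul contDiffAt_snd))

lemma isTest_of_bounds {φ : ℝ → Mom → ℝ} (hs : ContDiff ℝ ∞ fun x : ℝ × Mom => φ x.1 x.2)
    {a b : ℝ} (h : ∀ t p, (a < |t| ∨ b < ‖p‖) → φ t p = 0) : IsTest φ := by
  refine ⟨hs, HasCompactSupport.intro (K := Metric.closedBall (0 : ℝ) a ×ˢ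
    Metric.closedBall (0 : Mom) b) ((isCompact_closedBall _ _).prod (isCompact_closedBall _ _)) ?_⟩
  rintro ⟨t, p⟩ hx
  refine h t p ?_
  by_contra hc
  push Not at hc
  exact hx ⟨by simpa using hc.1, by simpa using hc.2⟩

/-- Cutting off a spherical test function near the origin gives a test function on `ℝ³`. -/
lemma isTest_mul_one_sub_cutoff (hΨ : ContDiff ℝ ∞ Ψ) (hc : HasCompactSupport Ψ) {ε : ℝ}
    (hε : 0 < ε) :
    IsTest fun t p => Ψ (sph t p) * (1 - cutoff (‖p‖ / ε)) := by
  obtain ⟨R, hR0, hR⟩ := exists_support_radius hc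
  refine isTest_of_bounds (a := R) (b := R) ?_ ?_
  · refine contDiff_iff_contDiffAt.2 fun x => ?_
    rcases eq_or_ne x.2 0 with hx | hx
    · have : (fun x : ℝ × Mom => Ψ (sph x.1 x.2) * (1 - cutoff (‖x.2‖ / ε))) =ᶠ[𝓝 x]
          fun _ => 0 := by
        have hcont : ContinuousAt (fun x : ℝ × Mom => ‖x.2‖) x := by fun_prop
        have hlt : ‖x.2‖ < ε := by simpa [hx] using hε
        filter_upwards [hcont.eventually_lt continuousAt_const hlt] with y hy
        rw [cutoff_eq_one, sub_self, mul_zero]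
        rw [abs_div, abs_norm, abs_of_pos hε, div_le_one hε]
        exact le_of_lt hy
      exact contDiffAt_const.congr_of_eventuallyEq this
    · refine (hΨ.contDiffAt.comp x (contDiffAt_sph_joint hx)).mul (contDiffAt_const.sub ?_)
      exact ((contDiff_cutoff_norm_div ε).comp contDiff_snd).contDiffAt
  · intro t p h
    have : Ψ (sph t p) = 0 := by
      refine (hR t ‖p‖ _ ?_).1
      rcases h with h | h
      · exact Or.inl h.le
      · exact Or.inr (by simpa using h.le)
    rw [this, zero_mul]

/-! ### No concentration at the origin for nonnegative solutions -/

/-- A radial profile concentrating at the origin. -/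
def profile (ε q : ℝ) : ℝ := ε ^ 2 / (ε ^ 2 + q ^ 2)

/-- The derivative of `profile`. -/
def profile' (ε q : ℝ) : ℝ := -(2 * q * ε ^ 2) / (ε ^ 2 + q ^ 2) ^ 2

/-- The negative of the radial operator applied to `profile`. -/
def profileL (ε q : ℝ) : ℝ := 8 * q * ε ^ 4 / (ε ^ 2 + q ^ 2) ^ 3

/-- The second derivative of `profile`. -/
def profile'' (ε q : ℝ) : ℝ := (6 * q ^ 2 * ε ^ 2 - 2 * ε ^ 4) / (ε ^ 2 + q ^ 2) ^ 3

lemma hasDerivAt_profile {ε : ℝ} (hε : 0 < ε) (q : ℝ) :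
    HasDerivAt (profile ε) (profile' ε q) q := by
  have hpos : 0 < ε ^ 2 + q ^ 2 := by positivity
  have h := (hasDerivAt_const q (ε ^ 2)).div ((hasDerivAt_pow 2 q).const_add (ε ^ 2)) hpos.ne'
  refine h.congr_deriv ?_
  simp [profile']
  ring

lemma hasDerivAt_profile' {ε : ℝ} (hε : 0 < ε) (q : ℝ) :
    HasDerivAt (profile' ε) (profile'' ε q) q := by
  have hpos : 0 < ε ^ 2 + q ^ 2 := by positivity
  have h1 : HasDerivAt (fun q : ℝ => -(2 * q * ε ^ 2)) (-(2 * ε ^ 2)) q := by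
    refine (((hasDerivAt_id q).const_mul 2).mul_const (ε ^ 2)).neg.congr_deriv ?_
    simp
  have h2 : HasDerivAt (fun q : ℝ => (ε ^ 2 + q ^ 2) ^ 2) (2 * (ε ^ 2 + q ^ 2) * (2 * q)) q := by
    refine (((hasDerivAt_pow 2 q).const_add (ε ^ 2)).pow 2).congr_deriv ?_
    simp
  refine (h1.div h2 (by positivity)).congr_deriv ?_
  rw [profile'']
  field_simp
  ring

/-- The profile is a bounded supersolution: `profileL` is nonnegative for `q ≥ 0` and of size `1/ε`
on the shell `q ~ ε`, the size of the bad commutator term. -/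
lemma radial_profile {ε : ℝ} (hε : 0 < ε) (q : ℝ) :
    q * profile'' ε q + 3 * profile' ε q = -profileL ε q := by
  have hpos : 0 < ε ^ 2 + q ^ 2 := by positivity
  rw [profile'', profile', profileL]
  field_simp
  ring

lemma profile_nonneg (ε q : ℝ) : 0 ≤ profile ε q := by unfold profile; positivity

lemma profile_le_one {ε : ℝ} (hε : 0 < ε) (q : ℝ) : profile ε q ≤ 1 := by
  have hpos : 0 < ε ^ 2 + q ^ 2 := by positivity
  rw [profile, div_le_one hpos]
  nlinarith [sq_nonneg q]

lemma abs_mul_profile'_le {ε : ℝ} (hε : 0 < ε) (q : ℝ) : |q * profile' ε q| ≤ 1 := by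
  have hpos : 0 < ε ^ 2 + q ^ 2 := by positivity
  have : q * profile' ε q = -(2 * q ^ 2 * ε ^ 2 / (ε ^ 2 + q ^ 2) ^ 2) := by
    rw [profile']; ring
  rw [this, abs_neg, abs_of_nonneg (by positivity), div_le_one (by positivity)]
  nlinarith [sq_nonneg (ε ^ 2), sq_nonneg (q ^ 2)]

/-- The sequence of scales tending to `0`. -/
def scale (n : ℕ) : ℝ := 1 / ((n : ℝ) + 2)

lemma scale_pos (n : ℕ) : 0 < scale n := by unfold scale; positivity

/-- The shift by 2 in `scale` keeps the shell `ε ≤ q ≤ 2ε` inside the region where `cutoff` equals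
1. -/
lemma scale_le (n : ℕ) : 2 * scale n ≤ 1 := by
  unfold scale
  rw [mul_one_div, div_le_one (by positivity)]
  have : (0 : ℝ) ≤ n := by positivity
  linarith

lemma tendsto_scale : Tendsto scale atTop (𝓝 0) := by
  have h := tendsto_one_div_add_atTop_nhds_zero_nat (𝕜 := ℝ)
  have h2 := (tendsto_add_atTop_iff_nat 1).2 h
  refine h2.congr fun n => ?_
  simp only [scale]
  push_cast
  ring

lemma tendsto_profile {q : ℝ} (hq : q ≠ 0) :
    Tendsto (fun n => profile (scale n) q) atTop (𝓝 0) := by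
  have hc : ContinuousAt (fun ε : ℝ => profile ε q) 0 := by
    unfold profile
    fun_prop (disch := positivity)
  have h := hc.tendsto.comp tendsto_scale
  simpa [profile, Function.comp_def] using h

lemma tendsto_profile' {q : ℝ} (hq : q ≠ 0) :
    Tendsto (fun n => profile' (scale n) q) atTop (𝓝 0) := by
  have hc : ContinuousAt (fun ε : ℝ => profile' ε q) 0 := by
    unfold profile'
    fun_prop (disch := positivity)
  have h := hc.tendsto.comp tendsto_scale
  simpa [profile', Function.comp_def] using h

/-- In the variable `x = q/ε` both sides are `1/ε` times a fixed function; the left one is supported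
in `1 ≤ x ≤ 2`, where the right one is bounded below. -/
lemma exists_cutoffL_le_profileL :
    ∃ K, 0 ≤ K ∧ ∀ n : ℕ, ∀ q : ℝ, 0 ≤ q →
      |cutoffL (q / scale n) / scale n| ≤ K * (cutoff q * profileL (scale n) q) := by
  obtain ⟨K, hK0, hK⟩ := exists_cutoff_bound
  -- On `1 ≤ x ≤ 2` one has `8x/(1 + x²)³ ≥ 8/5³`.
  refine ⟨K * (125 / 8), by positivity, fun n q hq => ?_⟩
  have hε := scale_pos n
  have hε1 := scale_le n
  generalize scale n = ε at *
  have hrhs : 0 ≤ K * (125 / 8) * (cutoff q * profileL ε q) := by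
    have := cutoff_nonneg q
    unfold profileL
    positivity
  obtain ⟨x, rfl⟩ : ∃ x, q = ε * x := ⟨q / ε, by field_simp⟩
  have hx0 : 0 ≤ x := by
    by_contra hc
    push Not at hc
    nlinarith
  rw [mul_div_cancel_left₀ _ hε.ne']
  by_cases hx : |x| < 1 ∨ 2 < |x|
  · rw [cutoffL_eq_zero hx]
    simpa using hrhs
  · push Not at hx
    rw [abs_of_nonneg hx0] at hx
    have h1 : cutoff (ε * x) = 1 := by
      refine cutoff_eq_one ?_
      rw [abs_of_nonneg hq]
      nlinarith
    have h2 : profileL ε (ε * x) = 8 * x / (1 + x ^ 2) ^ 3 / ε := by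
      rw [profileL, show ε ^ 2 + (ε * x) ^ 2 = ε ^ 2 * (1 + x ^ 2) by ring]
      field_simp
    have h3 : 8 / 125 ≤ 8 * x / (1 + x ^ 2) ^ 3 := by
      rw [div_le_div_iff₀ (by norm_num) (by positivity)]
      have : (1 + x ^ 2) ^ 3 ≤ 5 ^ 3 := by
        gcongr
        nlinarith
      nlinarith
    rw [h1, h2, one_mul, abs_div, abs_of_pos hε, ← mul_div_assoc]
    gcongr
    calc |cutoffL x| ≤ K := (hK x).2.2
      _ = K * (125 / 8) * (8 / 125) := by ring
      _ ≤ _ := by gcongr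

/-- The test functions detecting concentration at the origin. -/
def probe (T ε : ℝ) (x : ℝ × ℝ × Mom) : ℝ :=
  (cutoff (x.1 / T) * cutoff ‖x.2.2‖) * (cutoff x.2.1 * profile ε x.2.1)

lemma contDiff_profile {ε : ℝ} (hε : 0 < ε) : ContDiff ℝ ∞ (profile ε) := by
  unfold profile
  exact contDiff_const.div (by fun_prop) fun q => by positivity

lemma contDiff_probe (T : ℝ) {ε : ℝ} (hε : 0 < ε) : ContDiff ℝ ∞ (probe T ε) := by
  unfold probe
  refine ContDiff.mul (.mul ?_ ?_) (.mul ?_ ?_)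
  · exact contDiff_cutoff.comp (by fun_prop)
  · exact contDiff_cutoff_norm.comp (by fun_prop)
  · exact contDiff_cutoff.comp (by fun_prop)
  · exact (contDiff_profile hε).comp (by fun_prop)

lemma cutoff_div_eq_zero {T t : ℝ} (hT : 0 < T) (h : 2 * T < |t|) : cutoff (t / T) = 0 := by
  apply cutoff_eq_zero
  rw [abs_div, abs_of_pos hT, le_div_iff₀ hT]
  exact h.le

lemma hasCompactSupport_probe {T : ℝ} (hT : 0 < T) (ε : ℝ) :
    HasCompactSupport (probe T ε) := by
  refine hasCompactSupport_of_bounds (a := 2 * T) (b := 2) (c := 2) fun t q w h => ?_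
  rcases h with h | h | h
  · simp [probe, cutoff_div_eq_zero hT h]
  · simp [probe, cutoff_eq_zero h.le]
  · have : cutoff ‖w‖ = 0 := cutoff_eq_zero (by simpa using h.le)
    simp [probe, this]

lemma cutoff_norm_direction (p : Mom) : cutoff ‖‖p‖⁻¹ • p‖ = 1 :=
  cutoff_eq_one (by simpa using norm_inv_smul_le_one p)

lemma probe_sph (T ε t : ℝ) (p : Mom) :
    probe T ε (sph t p) = cutoff (t / T) * (cutoff ‖p‖ * profile ε ‖p‖) := by
  simp [probe, sph, cutoff_norm_direction]

/-- The profile is a smooth function of `|p|²`, so the probe is smooth across `p = 0` and belongs to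
the smaller class; this dictates the choice of `profile`. -/
lemma isTest_probe {T ε : ℝ} (hT : 0 < T) (hε : 0 < ε) :
    IsTest fun t p => probe T ε (sph t p) := by
  simp only [probe_sph]
  refine isTest_of_bounds (a := 2 * T) (b := 2) ?_ ?_
  · refine ContDiff.mul ?_ (.mul ?_ ?_)
    · exact contDiff_cutoff.comp (by fun_prop)
    · exact contDiff_cutoff_norm.comp contDiff_snd
    · unfold profile
      refine contDiff_const.div (contDiff_const.add ((contDiff_norm_sq ℝ).comp contDiff_snd)) ?_
      intro x
      positivity
  · intro t p h
    rcases h with h | h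
    · simp [cutoff_div_eq_zero hT h]
    · simp [cutoff_eq_zero (x := ‖p‖) (by simpa using h.le)]

lemma gen_probe_sph (T : ℝ) {ε : ℝ} (hε : 0 < ε) (t : ℝ) (p : Mom) :
    gen (probe T ε) (sph t p)
      = (cutoff' (t / T) / T * (cutoff ‖p‖ * profile ε ‖p‖)
        + cutoff (t / T) * (2 * cutoff' ‖p‖ * (‖p‖ * profile' ε ‖p‖)
          + cutoffL ‖p‖ * profile ε ‖p‖))
        - cutoff (t / T) * (cutoff ‖p‖ * profileL ε ‖p‖) := by
  have hζ : ContDiff ℝ ∞ fun t : ℝ => cutoff (t / T) := contDiff_cutoff.comp (by fun_prop)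
  have hA : ContDiff ℝ ∞ fun x : ℝ × ℝ × Mom => cutoff (x.1 / T) * cutoff ‖x.2.2‖ :=
    (hζ.comp contDiff_fst).mul (contDiff_cutoff_norm.comp (by fun_prop))
  have h := gen_mul_radial hA (r := fun q => cutoff q * profile ε q)
    (fun q => (hasDerivAt_cutoff q).mul (hasDerivAt_profile hε q))
    (fun q => ((hasDerivAt_cutoff' q).mul (hasDerivAt_profile hε q)).add
      ((hasDerivAt_cutoff q).mul (hasDerivAt_profile' hε q))) (sph t p)
  have h2 := gen_time_mul_direction hζ contDiff_cutoff_norm t ‖p‖ (‖p‖⁻¹ • p)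
  rw [(hasDerivAt_cutoff_div T t).deriv, cutoff_norm_direction, mul_one] at h2
  refine h.trans ?_
  have h3 : gen (fun x : ℝ × ℝ × Mom => cutoff (x.1 / T) * cutoff ‖x.2.2‖) (sph t p)
      = cutoff' (t / T) / T := h2.1
  have h4 : dq (fun x : ℝ × ℝ × Mom => cutoff (x.1 / T) * cutoff ‖x.2.2‖) (sph t p) = 0 := h2.2
  rw [h3, h4]
  have h5 := radial_profile hε ‖p‖
  have h6 : profileL ε ‖p‖ = -(‖p‖ * profile'' ε ‖p‖ + 3 * profile' ε ‖p‖) := by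
    rw [h5, neg_neg]
  simp only [sph, cutoff_norm_direction, mul_one]
  rw [h6, cutoffL]
  ring

lemma measurable_profile (ε : ℝ) : Measurable (profile ε) := by
  unfold profile; fun_prop

lemma measurable_profile' (ε : ℝ) : Measurable (profile' ε) := by
  unfold profile'; fun_prop

/-- A weak solution does not charge small shells around the origin to leading order. -/
lemma tendsto_integral_profileL {gin : Mom → ℝ} (hi : Integrable gin) {h : ℝ → Mom → ℝ}
    (hh : IsWeakSolution IsTest gin h) {T : ℝ} (hT : 0 < T) :
    (∀ n, Integrable (fun x : ℝ × Mom => h x.1 x.2 *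
      (cutoff (x.1 / T) * (cutoff ‖x.2‖ * profileL (scale n) ‖x.2‖))) spaceTime) ∧
    Tendsto (fun n => ∫ x, h x.1 x.2 *
      (cutoff (x.1 / T) * (cutoff ‖x.2‖ * profileL (scale n) ‖x.2‖)) ∂spaceTime) atTop (𝓝 0) := by
  obtain ⟨K, hK0, hK⟩ := exists_cutoff_bound
  have mc := contDiff_cutoff.continuous.measurable
  have mc' := contDiff_cutoff'.continuous.measurable
  have mcL : Measurable cutoffL := by
    have := contDiff_cutoff''.continuous.measurable
    unfold cutoffL
    fun_prop
  -- `G n` collects all terms of the operator applied to the probe except the one with `profileL`.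
  -- It is bounded uniformly in `n` and tends to 0 off the origin.
  set G : ℕ → ℝ × Mom → ℝ := fun n x =>
    cutoff' (x.1 / T) / T * (cutoff ‖x.2‖ * profile (scale n) ‖x.2‖)
        + cutoff (x.1 / T) * (2 * cutoff' ‖x.2‖ * (‖x.2‖ * profile' (scale n) ‖x.2‖)
          + cutoffL ‖x.2‖ * profile (scale n) ‖x.2‖) with hG
  have hGm : ∀ n, AEStronglyMeasurable (G n) spaceTime := by
    intro n
    have := measurable_profile (scale n)
    have := measurable_profile' (scale n)
    exact Measurable.aestronglyMeasurable (by fun_prop)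
  have hGb : ∀ n, ∀ᵐ x ∂spaceTime, |G n x| ≤ K / T + (2 * K + K) := by
    intro n
    refine ae_of_all _ fun x => ?_
    have a1 : |cutoff' (x.1 / T) / T * (cutoff ‖x.2‖ * profile (scale n) ‖x.2‖)| ≤ K / T := by
      rw [abs_mul, abs_div, abs_of_pos hT]
      refine mul_le_of_le_one_right (by positivity) ?_ |>.trans ?_
      · rw [abs_of_nonneg (mul_nonneg (cutoff_nonneg _) (profile_nonneg _ _))]
        exact mul_le_one₀ (cutoff_le_one _) (profile_nonneg _ _) (profile_le_one (scale_pos n) _)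
      · gcongr
        exact (hK _).1
    have a2 : |2 * cutoff' ‖x.2‖ * (‖x.2‖ * profile' (scale n) ‖x.2‖)| ≤ 2 * K := by
      rw [abs_mul, abs_mul, abs_two]
      refine mul_le_of_le_one_right (by positivity)
        (abs_mul_profile'_le (scale_pos n) _) |>.trans ?_
      gcongr
      exact (hK _).1
    have a3 : |cutoffL ‖x.2‖ * profile (scale n) ‖x.2‖| ≤ K := by
      rw [abs_mul, abs_of_nonneg (profile_nonneg _ _)]
      exact (mul_le_of_le_one_right (abs_nonneg _) (profile_le_one (scale_pos n) _)).trans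
        (hK _).2.2
    refine (abs_add_le _ _).trans (add_le_add a1 ?_)
    rw [abs_mul, abs_of_nonneg (cutoff_nonneg _)]
    exact (mul_le_of_le_one_left (abs_nonneg _) (cutoff_le_one _)).trans
      ((abs_add_le _ _).trans (add_le_add a2 a3))
  have hGT : ∀ n, ∀ x : ℝ × Mom, 2 * T < x.1 → G n x = 0 := by
    intro n x hx
    have h2 : 2 < |x.1 / T| := by
      rw [abs_div, abs_of_pos hT, lt_div_iff₀ hT]
      exact hx.trans_le (le_abs_self _)
    simp [hG, cutoff'_eq_zero (Or.inr h2), cutoff_eq_zero h2.le]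
  have hGlim : ∀ᵐ x ∂spaceTime, Tendsto (fun n => G n x) atTop (𝓝 0) := by
    filter_upwards [ae_spaceTime] with x hx
    have hq : ‖x.2‖ ≠ 0 := norm_ne_zero_iff.2 hx.2
    have h1 := tendsto_profile hq
    have h2 := tendsto_profile' hq
    have := ((h1.const_mul (cutoff ‖x.2‖)).const_mul (cutoff' (x.1 / T) / T)).add
      ((((h2.const_mul ‖x.2‖).const_mul (2 * cutoff' ‖x.2‖)).add
        (h1.const_mul (cutoffL ‖x.2‖))).const_mul (cutoff (x.1 / T)))
    simpa using this
  have hGtend := hh.1.tendsto_integral_mul hGm hGb hGT hGlim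
  have hGint := fun n => hh.1.integrable_mul (hGm n) (hGb n) (hGT n)
  have hUint := fun n => hh.1.integrable_mul_gen (contDiff_probe T (scale_pos n))
    (hasCompactSupport_probe hT (scale n))
  have hsplit : ∀ n, (fun x : ℝ × Mom => h x.1 x.2 *
      (cutoff (x.1 / T) * (cutoff ‖x.2‖ * profileL (scale n) ‖x.2‖)))
      = fun x => h x.1 x.2 * G n x - h x.1 x.2 * gen (probe T (scale n)) (sph x.1 x.2) := by
    intro n
    funext x
    rw [gen_probe_sph T (scale_pos n)]
    simp only [hG]
    ring
  refine ⟨fun n => by rw [hsplit n]; exact (hGint n).sub (hUint n), ?_⟩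
  have hgin : Tendsto (fun n => ∫ p, gin p * probe T (scale n) (sph 0 p)) atTop
      (𝓝 (∫ p, gin p * 0)) := by
    refine tendsto_integral_mul_of_bounded hi (C := 1) ?_ ?_ ?_
    · intro n
      have := measurable_profile (scale n)
      simp only [probe_sph]
      exact Measurable.aestronglyMeasurable (by fun_prop)
    · intro n p
      have h1 : 0 ≤ cutoff ‖p‖ * profile (scale n) ‖p‖ :=
        mul_nonneg (cutoff_nonneg _) (profile_nonneg _ _)
      rw [probe_sph, abs_of_nonneg (mul_nonneg (cutoff_nonneg _) h1)]
      exact mul_le_one₀ (cutoff_le_one _) h1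
        (mul_le_one₀ (cutoff_le_one _) (profile_nonneg _ _) (profile_le_one (scale_pos n) _))
    · intro p hp
      simp only [probe_sph]
      simpa using ((tendsto_profile (norm_ne_zero_iff.2 hp)).const_mul (cutoff ‖p‖)).const_mul
        (cutoff (0 / T))
  -- The weak formulation expresses the `profileL` integral through quantities that tend to 0,
  -- without using the sign of `h`.
  have hid : ∀ n, ∫ x, h x.1 x.2 *
      (cutoff (x.1 / T) * (cutoff ‖x.2‖ * profileL (scale n) ‖x.2‖)) ∂spaceTime
      = (∫ x, h x.1 x.2 * G n x ∂spaceTime) + ∫ p, gin p * probe T (scale n) (sph 0 p) := by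
    intro n
    rw [hsplit n, integral_sub (hGint n) (hUint n)]
    have := hh.spaceTime_identity (contDiff_probe T (scale_pos n))
      (hasCompactSupport_probe hT (scale n)) (isTest_probe hT (scale_pos n))
    linarith
  simp only [hid]
  simpa using hGtend.add hgin

lemma ae_spaceTime_nonneg {h : ℝ → Mom → ℝ} (hh : MemLinftyL1 h)
    (h0 : ∀ᵐ t ∂(volume.restrict (Ioi (0 : ℝ))), ∀ᵐ p, 0 ≤ h t p) :
    ∀ᵐ x ∂spaceTime, 0 ≤ h x.1 x.2 := by
  -- Passing from slices to the product needs a measurable set, so the sign is transferred to a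
  -- measurable representative.
  obtain ⟨f, hf, hfh⟩ := hh.1
  have h1 := Measure.ae_ae_of_ae_prod hfh
  have h2 : ∀ᵐ x ∂spaceTime, 0 ≤ f x := by
    rw [spaceTime, Measure.ae_prod_iff_ae_ae (measurableSet_le measurable_const hf.measurable)]
    filter_upwards [h0, h1] with t ht ht'
    filter_upwards [ht, ht'] with p hp hp'
    rw [← hp']
    exact hp
  have hfh' : ∀ᵐ x ∂spaceTime, h x.1 x.2 = f x := hfh
  filter_upwards [h2, hfh'] with x a b
  rw [b]
  exact a

/-- A nonnegative weak solution against `C_c^∞` is one against spherical test functions. -/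
lemma IsWeakSolution.isSphericalTest {gin : Mom → ℝ} (hi : Integrable gin) {h : ℝ → Mom → ℝ}
    (hh : IsWeakSolution IsTest gin h)
    (h0 : ∀ᵐ t ∂(volume.restrict (Ioi (0 : ℝ))), ∀ᵐ p, 0 ≤ h t p) :
    IsWeakSolution IsSphericalTest gin h := by
  refine ⟨hh.1, ?_⟩
  rintro φ ⟨Ψ, hΨ, hc, hφ⟩
  have hnn := ae_spaceTime_nonneg hh.1 h0
  obtain ⟨R, hR0, hR⟩ := exists_support_radius hc
  obtain ⟨C1, hC10, hC1⟩ := exists_bound_of_hasCompactSupport hΨ.continuous hc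
  obtain ⟨C2, hC20, hC2⟩ := exists_bound_of_hasCompactSupport (contDiff_dq hΨ).continuous
    (hasCompactSupport_dq hc)
  obtain ⟨C3, hC30, hC3⟩ := exists_bound_of_hasCompactSupport (continuous_gen hΨ)
    (hasCompactSupport_gen hc)
  obtain ⟨K, hK0, hK⟩ := exists_cutoff_bound
  obtain ⟨K', hK'0, hK'⟩ := exists_cutoffL_le_profileL
  have mc := contDiff_cutoff.continuous.measurable
  have mc' := contDiff_cutoff'.continuous.measurable
  have hmg : Measurable fun x : ℝ × Mom => gen Ψ (sph x.1 x.2) :=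
    (continuous_gen hΨ).measurable.comp measurable_sph
  have hmd : Measurable fun x : ℝ × Mom => dq Ψ (sph x.1 x.2) :=
    (contDiff_dq hΨ).continuous.measurable.comp measurable_sph
  rw [integral_mul_deriv_add_ultraOp hΨ hφ, hh.1.integral_integral_mul_gen hΨ hc]
  set Θ : ℕ → ℝ × ℝ × Mom → ℝ := fun n x => Ψ x * (1 - cutoff (x.2.1 / scale n)) with hΘ
  have hΘs : ∀ n, ContDiff ℝ ∞ (Θ n) := fun n =>
    hΨ.mul (contDiff_const.sub (contDiff_cutoff.comp (by fun_prop)))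
  have hΘc : ∀ n, HasCompactSupport (Θ n) := fun n => hc.mul_right
  have hid : ∀ n, (∫ x, h x.1 x.2 * gen (Θ n) (sph x.1 x.2) ∂spaceTime)
      + ∫ p, gin p * Θ n (sph 0 p) = 0 := fun n =>
    hh.spaceTime_identity (hΘs n) (hΘc n) (isTest_mul_one_sub_cutoff hΨ hc (scale_pos n))
  -- `F n` is the uniformly bounded part of the operator applied to `Θ n`; the omitted part is the
  -- term of size `1/ε`.
  set F : ℕ → ℝ × Mom → ℝ := fun n x => (1 - cutoff (‖x.2‖ / scale n)) * gen Ψ (sph x.1 x.2)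
    - 2 * (‖x.2‖ / scale n * cutoff' (‖x.2‖ / scale n)) * dq Ψ (sph x.1 x.2) with hF
  have hFm : ∀ n, AEStronglyMeasurable (F n) spaceTime := fun n =>
    Measurable.aestronglyMeasurable (by fun_prop)
  have hFb : ∀ n, ∀ᵐ x ∂spaceTime, |F n x| ≤ C3 + 2 * K * C2 := by
    intro n
    refine ae_of_all _ fun x => (abs_sub _ _).trans (add_le_add ?_ ?_)
    · rw [abs_mul, abs_of_nonneg (sub_nonneg.2 (cutoff_le_one _))]
      refine (mul_le_of_le_one_left (abs_nonneg _) ?_).trans (hC3 _)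
      linarith [cutoff_nonneg (‖x.2‖ / scale n)]
    · rw [abs_mul, abs_mul, abs_two]
      gcongr
      · exact (hK _).2.1
      · exact hC2 _
  have hFT : ∀ n, ∀ x : ℝ × Mom, R < x.1 → F n x = 0 := by
    intro n x hx
    have := hR x.1 ‖x.2‖ (‖x.2‖⁻¹ • x.2) (Or.inl (hx.le.trans (le_abs_self _)))
    have h1 : gen Ψ (sph x.1 x.2) = 0 := this.2.2
    have h2 : dq Ψ (sph x.1 x.2) = 0 := this.2.1
    simp [hF, h1, h2]
  have hlarge : ∀ p : Mom, p ≠ 0 → ∀ᶠ n in atTop, 2 < |‖p‖ / scale n| := by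
    intro p hp
    have hq : 0 < ‖p‖ := norm_pos_iff.2 hp
    filter_upwards [tendsto_scale.eventually_lt_const (half_pos hq)] with n hn
    rw [abs_of_pos (div_pos hq (scale_pos n)), lt_div_iff₀ (scale_pos n)]
    linarith
  have hFlim : ∀ᵐ x ∂spaceTime, Tendsto (fun n => F n x) atTop (𝓝 (gen Ψ (sph x.1 x.2))) := by
    filter_upwards [ae_spaceTime] with x hx
    refine tendsto_const_nhds.congr' ?_
    filter_upwards [hlarge x.2 hx.2] with n hn
    simp [hF, cutoff_eq_zero hn.le, cutoff'_eq_zero (Or.inr hn)]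
  have hFtend := hh.1.tendsto_integral_mul hFm hFb hFT hFlim
  have hFint := fun n => hh.1.integrable_mul (hFm n) (hFb n) (hFT n)
  have hGint := fun n => hh.1.integrable_mul_gen (hΘs n) (hΘc n)
  obtain ⟨hPint, hPtend⟩ := tendsto_integral_profileL hi hh hR0
  -- the remainder is controlled by the concentration estimate
  have hrem : ∀ n, ‖(∫ x, h x.1 x.2 * F n x ∂spaceTime)
      - ∫ x, h x.1 x.2 * gen (Θ n) (sph x.1 x.2) ∂spaceTime‖
      ≤ C1 * K' * ∫ x, h x.1 x.2 *
        (cutoff (x.1 / R) * (cutoff ‖x.2‖ * profileL (scale n) ‖x.2‖)) ∂spaceTime := by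
    intro n
    rw [← integral_sub (hFint n) (hGint n), ← integral_const_mul]
    refine norm_integral_le_of_norm_le ((hPint n).const_mul _) ?_
    filter_upwards [hnn, ae_spaceTime] with x hx hx'
    have hgen : gen (Θ n) (sph x.1 x.2) = F n x
        - Ψ (sph x.1 x.2) * (cutoffL (‖x.2‖ / scale n) / scale n) :=
      gen_mul_one_sub_cutoff hΨ (scale_pos n) _
    rw [hgen, show h x.1 x.2 * F n x - h x.1 x.2 * (F n x - Ψ (sph x.1 x.2) *
      (cutoffL (‖x.2‖ / scale n) / scale n)) = h x.1 x.2 * (Ψ (sph x.1 x.2) *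
      (cutoffL (‖x.2‖ / scale n) / scale n)) by ring, norm_mul, Real.norm_of_nonneg hx,
      mul_left_comm]
    -- Nonnegativity enters here: it turns the pointwise domination by `profileL` into domination of
    -- the integral, whose limit is known only without absolute value on `h`.
    refine mul_le_mul_of_nonneg_left ?_ hx
    rw [norm_mul, Real.norm_eq_abs, Real.norm_eq_abs]
    have hP0 : 0 ≤ cutoff ‖x.2‖ * profileL (scale n) ‖x.2‖ := by
      have := cutoff_nonneg ‖x.2‖
      have := scale_pos n
      unfold profileL
      positivity
    -- The probe with time scale `R` has time factor 1 up to `R`, and `Ψ` vanishes afterwards.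
    rcases le_or_gt x.1 R with ht | ht
    · have h1 : cutoff (x.1 / R) = 1 := by
        refine cutoff_eq_one ?_
        rw [abs_of_pos (div_pos hx'.1 hR0), div_le_one hR0]
        exact ht
      rw [h1, one_mul, mul_assoc]
      exact mul_le_mul (hC1 _) (hK' n _ (norm_nonneg _)) (abs_nonneg _) hC10
    · have h1 : Ψ (sph x.1 x.2) = 0 := (hR x.1 _ _ (Or.inl (ht.le.trans (le_abs_self _)))).1
      rw [h1, abs_zero, zero_mul]
      have := cutoff_nonneg (x.1 / R)
      positivity
  have hrem0 : Tendsto (fun n => (∫ x, h x.1 x.2 * F n x ∂spaceTime)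
      - ∫ x, h x.1 x.2 * gen (Θ n) (sph x.1 x.2) ∂spaceTime) atTop (𝓝 0) :=
    squeeze_zero_norm hrem (by simpa using hPtend.const_mul (C1 * K'))
  have hgin : Tendsto (fun n => ∫ p, gin p * Θ n (sph 0 p)) atTop
      (𝓝 (∫ p, gin p * φ 0 p)) := by
    refine tendsto_integral_mul_of_bounded hi (C := C1) ?_ ?_ ?_
    · intro n
      refine Measurable.aestronglyMeasurable ((hΘs n).continuous.measurable.comp ?_)
      unfold sph
      fun_prop
    · intro n p
      simp only [hΘ]
      rw [abs_mul, abs_of_nonneg (sub_nonneg.2 (cutoff_le_one _))]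
      refine (mul_le_of_le_one_right (abs_nonneg _) ?_).trans (hC1 _)
      linarith [cutoff_nonneg ((sph 0 p).2.1 / scale n)]
    · intro p hp
      refine tendsto_const_nhds.congr' ?_
      filter_upwards [hlarge p hp] with n hn
      rw [hφ]
      simp [hΘ, sph, cutoff_eq_zero hn.le]
  have hsum := (hFtend.sub hrem0).add hgin
  have hzero : ∀ n, (∫ x, h x.1 x.2 * F n x ∂spaceTime)
      - ((∫ x, h x.1 x.2 * F n x ∂spaceTime)
        - ∫ x, h x.1 x.2 * gen (Θ n) (sph x.1 x.2) ∂spaceTime)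
      + ∫ p, gin p * Θ n (sph 0 p) = 0 := by
    intro n
    rw [sub_sub_cancel]
    exact hid n
  simp only [hzero, sub_zero] at hsum
  exact tendsto_nhds_unique hsum tendsto_const_nhds

/-! ### Exponential moments determine an integrable function -/

/-- Monomials in the components of the direction. -/
def mono (α : Fin 3 → ℕ) (w : Mom) : ℝ := ∏ i, w i ^ α i

lemma contDiff_mono (α : Fin 3 → ℕ) : ContDiff ℝ ∞ (mono α) := by
  unfold mono
  fun_prop

lemma abs_mono_le (α : Fin 3 → ℕ) {w : Mom} (hw : ‖w‖ ≤ 1) : |mono α w| ≤ 1 := by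
  rw [mono, Finset.abs_prod]
  refine Finset.prod_le_one (fun i _ => abs_nonneg _) fun i _ => ?_
  rw [abs_pow]
  exact pow_le_one₀ (abs_nonneg _) ((PiLp.norm_apply_le w i).trans hw)

/-- The compact space carrying the variables `(e^{-|p|}, p/|p|)`. -/
abbrev Moment : Type := Metric.closedBall (0 : ℝ × Mom) 1

/-- The map `p ↦ (e^{-|p|}, p/|p|)`. -/
def toMoment (p : Mom) : Moment :=
  ⟨(Real.exp (-‖p‖), ‖p‖⁻¹ • p), by
    rw [mem_closedBall_zero_iff, Prod.norm_def]
    refine max_le ?_ (norm_inv_smul_le_one p)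
    rw [Real.norm_of_nonneg (Real.exp_nonneg _)]
    exact Real.exp_le_one_iff.2 (neg_nonpos.2 (norm_nonneg p))⟩

/-- The left inverse of `toMoment`. -/
def ofMoment (x : Moment) : Mom := (-Real.log x.1.1) • x.1.2

lemma measurable_toMoment : Measurable toMoment :=
  Measurable.subtype_mk (by fun_prop)

lemma measurable_ofMoment : Measurable ofMoment := by
  unfold ofMoment
  fun_prop

lemma ofMoment_toMoment (p : Mom) : ofMoment (toMoment p) = p := by
  simp only [ofMoment, toMoment, Real.log_exp, neg_neg]
  rcases eq_or_ne p 0 with rfl | hp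
  · simp
  · exact smul_inv_smul₀ (norm_ne_zero_iff.2 hp) p

/-- The coordinate functions on `Moment`. -/
def momentCoord : Option (Fin 3) → BoundedContinuousFunction Moment ℝ
  | none => BoundedContinuousFunction.mkOfCompact ⟨fun x => x.1.1, by fun_prop⟩
  | some i => BoundedContinuousFunction.mkOfCompact ⟨fun x => x.1.2 i, by fun_prop⟩

/-- The algebra of polynomial functions on `Moment`. -/
def momentAlgebra : StarSubalgebra ℝ (BoundedContinuousFunction Moment ℝ) where
  toSubalgebra := Algebra.adjoin ℝ (range momentCoord)
  star_mem' := by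
    intro a ha
    have : star a = a := by ext x; simp
    rwa [this]

lemma exists_monomial_of_mem_closure {f : BoundedContinuousFunction Moment ℝ}
    (hf : f ∈ Submonoid.closure (range momentCoord)) :
    ∃ (n : ℕ) (α : Fin 3 → ℕ), ∀ x, f x = x.1.1 ^ n * mono α x.1.2 := by
  induction hf using Submonoid.closure_induction with
  | mem f hf =>
    obtain ⟨i, rfl⟩ := hf
    rcases i with _ | i
    · exact ⟨1, 0, fun x => by simp [momentCoord, mono]⟩
    · refine ⟨0, Pi.single i 1, fun x => ?_⟩
      rw [mono, Finset.prod_eq_single i]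
      · simp [momentCoord]
      · intro j _ hj
        simp [hj]
      · simp
  | one => exact ⟨0, 0, fun x => by simp [mono]⟩
  | mul f g _ _ hf hg =>
    obtain ⟨n, α, h1⟩ := hf
    obtain ⟨m, β, h2⟩ := hg
    refine ⟨n + m, α + β, fun x => ?_⟩
    rw [BoundedContinuousFunction.mul_apply, h1, h2]
    simp only [mono, Pi.add_apply, pow_add, Finset.prod_mul_distrib]
    ring

lemma separatesPoints_momentAlgebra :
    (momentAlgebra.map (BoundedContinuousFunction.toContinuousMapStarₐ ℝ)).SeparatesPoints := by
  intro x y hxy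
  have key : ∃ i, momentCoord i x ≠ momentCoord i y := by
    by_contra hc
    push Not at hc
    refine hxy (Subtype.ext (Prod.ext (hc none) ?_))
    ext i
    exact hc (some i)
  obtain ⟨i, hi⟩ := key
  refine ⟨momentCoord i, ⟨(momentCoord i).toContinuousMap, ?_, rfl⟩, hi⟩
  exact ⟨momentCoord i, Algebra.subset_adjoin (mem_range_self i), rfl⟩

/-- An integrable function is determined by its moments against `e^{-n|p|} (p/|p|)^α`. -/
lemma ae_eq_zero_of_moments {d : Mom → ℝ} (hd : Integrable d)
    (h : ∀ (n : ℕ) (α : Fin 3 → ℕ),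
      ∫ p, d p * (Real.exp (-(n * ‖p‖)) * mono α (‖p‖⁻¹ • p)) = 0) :
    d =ᵐ[volume] 0 := by
  -- The positive and negative parts of `d` become two finite measures, and the claim becomes their
  -- equality.
  set μ : Measure Mom := volume.withDensity fun p => ENNReal.ofReal (d p) with hμ
  set ν : Measure Mom := volume.withDensity fun p => ENNReal.ofReal (-d p) with hν
  have hfμ : IsFiniteMeasure μ := isFiniteMeasure_withDensity_ofReal hd.2
  have hfν : IsFiniteMeasure ν := isFiniteMeasure_withDensity_ofReal hd.neg.2
  have hdm := hd.1.aemeasurable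
  have hdn : AEMeasurable (fun p => -d p) volume := hdm.neg
  have hintegral : ∀ f : BoundedContinuousFunction Moment ℝ,
      (∫ x, f x ∂(μ.map toMoment)) - ∫ x, f x ∂(ν.map toMoment)
        = ∫ p, d p * f (toMoment p) := by
    intro f
    have hfm : AEStronglyMeasurable (fun p => f (toMoment p)) volume :=
      (f.continuous.measurable.comp measurable_toMoment).aestronglyMeasurable
    rw [integral_map measurable_toMoment.aemeasurable f.continuous.aestronglyMeasurable,
      integral_map measurable_toMoment.aemeasurable f.continuous.aestronglyMeasurable, hμ, hν,
      integral_withDensity_eq_integral_toReal_smul₀ hdm.ennreal_ofReal (by simp),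
      integral_withDensity_eq_integral_toReal_smul₀ hdn.ennreal_ofReal (by simp),
      ← integral_sub]
    · refine integral_congr_ae (ae_of_all _ fun p => ?_)
      simp only [smul_eq_mul]
      rw [← sub_mul]
      congr 1
      rcases le_total 0 (d p) with hp | hp
      · rw [ENNReal.toReal_ofReal hp, ENNReal.ofReal_of_nonpos (by linarith)]
        simp
      · rw [ENNReal.toReal_ofReal (by linarith : 0 ≤ -d p), ENNReal.ofReal_of_nonpos hp]
        simp
    · refine Integrable.mul_bdd (c := ‖f‖) ?_ hfm (ae_of_all _ fun p => f.norm_coe_le_norm _)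
      exact hd.pos_part.congr (ae_of_all _ fun p => by simp [ENNReal.toReal_ofReal'])
    · refine Integrable.mul_bdd (c := ‖f‖) ?_ hfm (ae_of_all _ fun p => f.norm_coe_le_norm _)
      exact hd.neg.pos_part.congr (ae_of_all _ fun p => by simp [ENNReal.toReal_ofReal'])
  -- Stone–Weierstrass: the images are finite measures on a compact metric space that agree on a
  -- point-separating algebra, spanned by the monomials in `e^{-|p|}` and `p/|p|`.
  have hmap : μ.map toMoment = ν.map toMoment := by
    refine ext_of_forall_mem_subalgebra_integral_eq_of_polish (𝕜 := ℝ)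
      separatesPoints_momentAlgebra fun f hf => ?_
    rw [← sub_eq_zero, hintegral]
    replace hf : f ∈ Algebra.adjoin ℝ (range momentCoord) := hf
    rw [← Subalgebra.mem_toSubmodule, Algebra.adjoin_eq_span] at hf
    have hint : ∀ g : BoundedContinuousFunction Moment ℝ,
        Integrable fun p => d p * g (toMoment p) := fun g =>
      hd.mul_bdd (c := ‖g‖) (g.continuous.measurable.comp measurable_toMoment).aestronglyMeasurable
        (ae_of_all _ fun p => g.norm_coe_le_norm _)
    induction hf using Submodule.span_induction with
    | mem g hg =>
      obtain ⟨n, α, hn⟩ := exists_monomial_of_mem_closure hg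
      rw [← h n α]
      refine integral_congr_ae (ae_of_all _ fun p => ?_)
      simp only [hn, toMoment]
      rw [← Real.exp_nat_mul]
      congr 4
      ring
    | zero => simp
    | add g k hg hk ihg ihk =>
      have : (fun p => d p * (g + k) (toMoment p))
          = fun p => d p * g (toMoment p) + d p * k (toMoment p) := by
        funext p
        rw [BoundedContinuousFunction.add_apply, mul_add]
      rw [this, integral_add (hint g) (hint k), ihg, ihk, add_zero]
    | smul c g hg ihg =>
      have : (fun p => d p * (c • g) (toMoment p)) = fun p => c * (d p * g (toMoment p)) := by
        funext p
        simp only [BoundedContinuousFunction.coe_smul, smul_eq_mul]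
        ring
      rw [this, integral_const_mul, ihg, mul_zero]
  -- No information is lost in the image, because `toMoment` has a measurable left inverse.
  have heq : μ = ν := by
    have h1 : ∀ ρ : Measure Mom, (ρ.map toMoment).map ofMoment = ρ := by
      intro ρ
      rw [Measure.map_map measurable_ofMoment measurable_toMoment]
      have : ofMoment ∘ toMoment = id := funext ofMoment_toMoment
      rw [this, Measure.map_id]
    rw [← h1 μ, hmap, h1]
  have hae := (withDensity_eq_iff_of_sigmaFinite hdm.ennreal_ofReal hdn.ennreal_ofReal).1 heq
  filter_upwards [hae] with p hp
  rcases le_total 0 (d p) with h0 | h0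
  · rw [ENNReal.ofReal_of_nonpos (by linarith : -d p ≤ 0), ENNReal.ofReal_eq_zero] at hp
    exact le_antisymm hp h0
  · rw [ENNReal.ofReal_of_nonpos h0, eq_comm, ENNReal.ofReal_eq_zero] at hp
    exact le_antisymm h0 (neg_nonpos.1 hp)

/-! ### Backward exponentials and uniqueness -/

/-- An exponential solution of the backward equation, for `t < 1 / m`. -/
def backward (m t q : ℝ) : ℝ := (1 - m * t)⁻¹ ^ 3 * Real.exp (-(m * (1 - m * t)⁻¹ * q))

lemma hasDerivAt_backward_radial (m t q : ℝ) :
    HasDerivAt (fun q => backward m t q) (-(m * (1 - m * t)⁻¹) * backward m t q) q := by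
  have h := (((hasDerivAt_id q).const_mul (m * (1 - m * t)⁻¹)).neg.exp).const_mul
    ((1 - m * t)⁻¹ ^ 3)
  refine h.congr_deriv ?_
  simp [backward]
  ring

/-- With `s = 1/(1 - mt)` one has `s' = m s²`. The resulting factor `3ms - m²s²q` is the negative of
what `q ∂_q² + 3 ∂_q` produces from `e^{-msq}`, so the two cancel in `gen`. -/
lemma hasDerivAt_backward_time {m t : ℝ} (ht : 1 - m * t ≠ 0) (q : ℝ) :
    HasDerivAt (fun t => backward m t q)
      (backward m t q * (3 * m * (1 - m * t)⁻¹ - m ^ 2 * (1 - m * t)⁻¹ ^ 2 * q)) t := by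
  have h0 : HasDerivAt (fun t => (1 - m * t)⁻¹) (m * (1 - m * t)⁻¹ ^ 2) t := by
    refine ((((hasDerivAt_id t).const_mul m).const_sub 1).inv ht).congr_deriv ?_
    simp
    field_simp
  have h := (h0.pow 3).mul ((h0.const_mul m).mul_const q).neg.exp
  refine h.congr_deriv ?_
  simp only [backward, Pi.pow_apply, Pi.neg_apply]
  generalize (1 - m * t)⁻¹ = s
  norm_num
  ring

lemma backward_nonneg {m t : ℝ} (ht : 0 ≤ 1 - m * t) (q : ℝ) : 0 ≤ backward m t q := by
  unfold backward; positivity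

lemma backward_le {m t q δ : ℝ} (hm : 0 ≤ m) (hδ : 0 < δ) (ht : δ ≤ 1 - m * t) (hq : 0 ≤ q) :
    backward m t q ≤ δ⁻¹ ^ 3 := by
  have h1 : 0 < 1 - m * t := hδ.trans_le ht
  unfold backward
  refine (mul_le_of_le_one_right (by positivity) ?_).trans ?_
  · exact Real.exp_le_one_iff.2 (neg_nonpos.2 (by positivity))
  · gcongr

/-- A time cutoff times the backward exponential times a function of the direction. -/
def backwardTest (m : ℝ) (θ : ℝ → ℝ) (b : Mom → ℝ) (x : ℝ × ℝ × Mom) : ℝ :=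
  θ x.1 * backward m x.1 x.2.1 * b x.2.2

section

variable {m c : ℝ} {θ : ℝ → ℝ} {b : Mom → ℝ}

/-- The time cutoff vanishes beyond `c < 1/m`, hence before the exponential becomes singular at `t =
1/m`. -/
lemma contDiff_backwardTest (hm : 0 < m) (hθ : ContDiff ℝ ∞ θ) (hb : ContDiff ℝ ∞ b)
    (hc : m * c < 1) (h0 : ∀ t, c < t → θ t = 0) : ContDiff ℝ ∞ (backwardTest m θ b) := by
  refine contDiff_iff_contDiffAt.2 fun x => ?_
  rcases le_or_gt x.1 c with hx | hx
  · have hne : 1 - m * x.1 ≠ 0 := by nlinarith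
    have hinv : ContDiffAt ℝ ∞ (fun x : ℝ × ℝ × Mom => (1 - m * x.1)⁻¹) x :=
      ContDiffAt.inv (by fun_prop) hne
    unfold backwardTest backward
    refine ((hθ.comp contDiff_fst).contDiffAt.mul ((hinv.pow 3).mul ?_)).mul
      (hb.comp (by fun_prop)).contDiffAt
    exact ((contDiffAt_const.mul hinv).mul (by fun_prop)).neg.exp
  · have : backwardTest m θ b =ᶠ[𝓝 x] fun _ => 0 := by
      filter_upwards [continuousAt_const.eventually_lt continuous_fst.continuousAt hx] with y hy
      simp [backwardTest, h0 _ hy]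
    exact contDiffAt_const.congr_of_eventuallyEq this

lemma dq_backwardTest (hm : 0 < m) (hθ : ContDiff ℝ ∞ θ) (hb : ContDiff ℝ ∞ b)
    (hc : m * c < 1) (h0 : ∀ t, c < t → θ t = 0) :
    dq (backwardTest m θ b) = fun x => -(m * (1 - m * x.1)⁻¹) * backwardTest m θ b x := by
  funext ⟨t, q, w⟩
  have hd := (contDiff_backwardTest hm hθ hb hc h0).differentiable (by simp)
  refine dq_eq_of_hasDerivAt (hd _) ?_
  refine (((hasDerivAt_backward_radial m t q).const_mul (θ t)).mul_const (b w)).congr_deriv ?_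
  simp only [backwardTest]
  ring

lemma deriv_eq_zero_of_lt (h0 : ∀ t, c < t → θ t = 0) {t : ℝ} (ht : c < t) : deriv θ t = 0 := by
  have : θ =ᶠ[𝓝 t] fun _ => 0 := by
    filter_upwards [lt_mem_nhds ht] with s hs using h0 s hs
  rw [this.deriv_eq, deriv_const]

/-- The backward exponential is annihilated and the direction is inert, so only the derivative of
the time cutoff remains. -/
lemma gen_backwardTest (hm : 0 < m) (hθ : ContDiff ℝ ∞ θ) (hb : ContDiff ℝ ∞ b)
    (hc : m * c < 1) (h0 : ∀ t, c < t → θ t = 0) (t q : ℝ) (w : Mom) :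
    gen (backwardTest m θ b) (t, q, w) = deriv θ t * backward m t q * b w := by
  have hs := contDiff_backwardTest hm hθ hb hc h0
  have hd := hs.differentiable (by simp)
  have hdq := dq_backwardTest hm hθ hb hc h0
  have hdq2 : dq (dq (backwardTest m θ b)) (t, q, w)
      = (m * (1 - m * t)⁻¹) ^ 2 * backwardTest m θ b (t, q, w) := by
    have hd2 := (contDiff_dq hs).differentiable (by simp)
    refine dq_eq_of_hasDerivAt (hd2 _) ?_
    have h1 : (fun s => dq (backwardTest m θ b) (t, s, w))
        = fun s => -(m * (1 - m * t)⁻¹) * backwardTest m θ b (t, s, w) := by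
      funext s; rw [hdq]
    rw [h1]
    have h2 := hasDerivAt_radial_slice hs t q w
    rw [hdq] at h2
    refine (h2.const_mul _).congr_deriv ?_
    ring
  rw [gen, hdq2, hdq]
  rcases le_or_gt t c with ht | ht
  · have hne : 1 - m * t ≠ 0 := by nlinarith
    have hdt : dt (backwardTest m θ b) (t, q, w) = (deriv θ t * backward m t q + θ t *
        (backward m t q * (3 * m * (1 - m * t)⁻¹ - m ^ 2 * (1 - m * t)⁻¹ ^ 2 * q))) * b w :=
      dt_eq_of_hasDerivAt (hd _) ((((hθ.differentiable (by simp) t).hasDerivAt).mul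
        (hasDerivAt_backward_time hne q)).mul_const (b w))
    rw [hdt]
    simp only [backwardTest]
    ring
  · have hdt : dt (backwardTest m θ b) (t, q, w) = 0 := by
      refine dt_eq_of_hasDerivAt (hd _) ((hasDerivAt_const t (0 : ℝ)).congr_of_eventuallyEq ?_)
      filter_upwards [lt_mem_nhds ht] with s hs
      simp [backwardTest, h0 s hs]
    rw [hdt, deriv_eq_zero_of_lt h0 ht]
    simp [backwardTest, h0 t ht]

end

/-- Testing a weak solution with the backward exponentials. -/
lemma IsWeakSolution.backward_identity {gin : Mom → ℝ} (hi : Integrable gin) {h : ℝ → Mom → ℝ}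
    (hh : IsWeakSolution IsSphericalTest gin h) {m c : ℝ} (hm : 0 < m) {θ : ℝ → ℝ}
    (hθ : ContDiff ℝ ∞ θ) (hθc : HasCompactSupport θ) (hc : m * c < 1)
    (h0 : ∀ t, c < t → θ t = 0) (α : Fin 3 → ℕ) :
    (∫ x, h x.1 x.2 * (deriv θ x.1 * backward m x.1 ‖x.2‖ * mono α (‖x.2‖⁻¹ • x.2)) ∂spaceTime)
      + ∫ p, gin p * (θ 0 * backward m 0 ‖p‖ * mono α (‖p‖⁻¹ • p)) = 0 := by
  -- The factor `cutoff ‖w‖` provides compact support in `w` and is 1 on all directions that occur.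
  set b : Mom → ℝ := fun w => mono α w * cutoff ‖w‖ with hbdef
  have hb : ContDiff ℝ ∞ b := (contDiff_mono α).mul contDiff_cutoff_norm
  have hbω : ∀ p : Mom, b (‖p‖⁻¹ • p) = mono α (‖p‖⁻¹ • p) := fun p => by
    simp only [hbdef]
    rw [cutoff_norm_direction, mul_one]
  have hbω1 : ∀ p : Mom, |b (‖p‖⁻¹ • p)| ≤ 1 := fun p => by
    rw [hbω]; exact abs_mono_le α (norm_inv_smul_le_one p)
  set A := backwardTest m θ b with hA
  have hAs : ContDiff ℝ ∞ A := contDiff_backwardTest hm hθ hb hc h0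
  set S : ℕ → ℝ := fun n => (n : ℝ) + 1 with hS
  have hS0 : ∀ n, 0 < S n := fun n => by positivity
  -- The exponential does not have compact support in `q`, so it is truncated at radius `S n → ∞`.
  -- The commutator terms are bounded uniformly and vanish for `q < S n`.
  set Θ : ℕ → ℝ × ℝ × Mom → ℝ := fun n x => A x * cutoff (x.2.1 / S n) with hΘ
  have hΘs : ∀ n, ContDiff ℝ ∞ (Θ n) := fun n =>
    hAs.mul (contDiff_cutoff.comp (by fun_prop))
  obtain ⟨ρ, hρ0, hρ⟩ := hθc.isCompact.isBounded.subset_ball_lt 0 (0 : ℝ)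
  have hθρ : ∀ t, ρ ≤ |t| → θ t = 0 := by
    intro t ht
    by_contra hne
    have := hρ (subset_tsupport θ hne)
    rw [mem_ball_zero_iff, Real.norm_eq_abs] at this
    linarith
  have hΘc : ∀ n, HasCompactSupport (Θ n) := by
    intro n
    refine hasCompactSupport_of_bounds (a := ρ) (b := 2 * S n) (c := 2) fun t q w h => ?_
    rcases h with h | h | h
    · simp [hΘ, hA, backwardTest, hθρ t h.le]
    · simp [hΘ, cutoff_div_eq_zero (hS0 n) h]
    · have : cutoff ‖w‖ = 0 := cutoff_eq_zero (by simpa using h.le)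
      simp [hΘ, hA, backwardTest, hbdef, this]
  have hid : ∀ n, (∫ x, h x.1 x.2 * gen (Θ n) (sph x.1 x.2) ∂spaceTime)
      + ∫ p, gin p * Θ n (sph 0 p) = 0 := fun n =>
    hh.spaceTime_identity (hΘs n) (hΘc n) ⟨Θ n, hΘs n, hΘc n, fun _ _ => rfl⟩
  -- bounds
  obtain ⟨K, hK0, hK⟩ := exists_cutoff_bound
  obtain ⟨C0, hC00, hC0⟩ := exists_bound_of_hasCompactSupport hθ.continuous hθc
  obtain ⟨C1, hC10, hC1⟩ := exists_bound_of_hasCompactSupport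
    (hθ.continuous_deriv (by simp)) hθc.deriv
  -- Lower bound for `1 - mt` on `t ≤ c`; it makes all estimates below uniform.
  set δ : ℝ := 1 - m * c with hδ
  have hδ0 : 0 < δ := by linarith
  have hmul : ∀ {η : ℝ → ℝ} {C : ℝ}, 0 ≤ C → (∀ t, |η t| ≤ C) → (∀ t, c < t → η t = 0) →
      ∀ t p, |η t * backward m t ‖p‖ * b (‖p‖⁻¹ • p)| ≤ C * δ⁻¹ ^ 3 := by
    intro η C hC hη hη0 t p
    rcases le_or_gt t c with ht | ht
    · have hs : δ ≤ 1 - m * t := by nlinarith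
      rw [abs_mul, abs_mul, abs_of_nonneg (backward_nonneg (hδ0.le.trans hs) _)]
      refine (mul_le_of_le_one_right (mul_nonneg (abs_nonneg _)
        (backward_nonneg (hδ0.le.trans hs) _)) (hbω1 p)).trans ?_
      exact mul_le_mul (hη t) (backward_le hm.le hδ0 hs (norm_nonneg p))
        (backward_nonneg (hδ0.le.trans hs) _) hC
    · rw [hη0 t ht]
      simp only [zero_mul, abs_zero]
      positivity
  have hAb : ∀ t p, |A (sph t p)| ≤ C0 * δ⁻¹ ^ 3 := fun t p => hmul hC00 hC0 h0 t p
  have hgb : ∀ t p, |gen A (sph t p)| ≤ C1 * δ⁻¹ ^ 3 := fun t p => by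
    rw [sph, hA, gen_backwardTest hm hθ hb hc h0]
    exact hmul hC10 hC1 (fun s hs => deriv_eq_zero_of_lt h0 hs) t p
  have hdb : ∀ t p, |dq A (sph t p)| ≤ m * δ⁻¹ * (C0 * δ⁻¹ ^ 3) := fun t p => by
    rw [hA, dq_backwardTest hm hθ hb hc h0]
    rcases le_or_gt t c with ht | ht
    · have hs : δ ≤ 1 - m * t := by nlinarith
      have hs0 : 0 < 1 - m * t := hδ0.trans_le hs
      rw [abs_mul, abs_neg]
      refine mul_le_mul ?_ (hAb t p) (abs_nonneg _) (by positivity)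
      rw [abs_of_pos (by simp only [sph]; positivity)]
      simp only [sph]
      gcongr
    · have : backwardTest m θ b (sph t p) = 0 := by simp [backwardTest, sph, h0 t ht]
      simp only [this, mul_zero, abs_zero]
      positivity
  have hgen : ∀ n, ∀ x : ℝ × Mom, gen (Θ n) (sph x.1 x.2)
      = cutoff (‖x.2‖ / S n) * gen A (sph x.1 x.2)
      + 2 * (‖x.2‖ / S n * cutoff' (‖x.2‖ / S n)) * dq A (sph x.1 x.2)
      + A (sph x.1 x.2) * (cutoffL (‖x.2‖ / S n) / S n) := fun n x =>
    gen_mul_cutoff hAs (hS0 n) _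
  have htend := hh.1.tendsto_integral_mul (F := fun n x => gen (Θ n) (sph x.1 x.2))
    (G := fun x => gen A (sph x.1 x.2)) (T := c)
    (C := C1 * δ⁻¹ ^ 3 + 2 * K * (m * δ⁻¹ * (C0 * δ⁻¹ ^ 3)) + C0 * δ⁻¹ ^ 3 * K)
    (fun n => aestronglyMeasurable_comp_sph (continuous_gen (hΘs n))) ?_ ?_ ?_
  · have hgin : Tendsto (fun n => ∫ p, gin p * Θ n (sph 0 p)) atTop
        (𝓝 (∫ p, gin p * A (sph 0 p))) := by
      refine tendsto_integral_mul_of_bounded hi (C := C0 * δ⁻¹ ^ 3) ?_ ?_ ?_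
      · intro n
        refine Measurable.aestronglyMeasurable ((hΘs n).continuous.measurable.comp ?_)
        unfold sph
        fun_prop
      · intro n p
        simp only [hΘ]
        rw [abs_mul, abs_of_nonneg (cutoff_nonneg _)]
        exact (mul_le_of_le_one_right (abs_nonneg _) (cutoff_le_one _)).trans (hAb 0 p)
      · intro p _
        refine tendsto_const_nhds.congr' ?_
        filter_upwards [eventually_ge_atTop ⌈‖p‖⌉₊] with n hn
        have : cutoff (‖p‖ / S n) = 1 := by
          refine cutoff_eq_one ?_
          rw [abs_of_nonneg (div_nonneg (norm_nonneg p) (hS0 n).le), div_le_one (hS0 n)]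
          have := Nat.le_of_ceil_le hn
          simp only [hS]
          linarith
        simp [hΘ, sph, this]
    have hsum := htend.add hgin
    simp only [hid] at hsum
    have hval := tendsto_nhds_unique tendsto_const_nhds hsum
    refine Eq.trans ?_ hval.symm
    congr 1
    · refine integral_congr_ae (ae_of_all _ fun x => ?_)
      simp only [sph, hA]
      rw [gen_backwardTest hm hθ hb hc h0, hbω]
    · refine integral_congr_ae (ae_of_all _ fun p => ?_)
      simp only [sph, hA, backwardTest]
      rw [hbω]
  · intro n
    refine ae_of_all _ fun x => ?_
    rw [hgen]
    refine (abs_add_three _ _ _).trans (add_le_add (add_le_add ?_ ?_) ?_)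
    · rw [abs_mul, abs_of_nonneg (cutoff_nonneg _)]
      exact (mul_le_of_le_one_left (abs_nonneg _) (cutoff_le_one _)).trans (hgb _ _)
    · rw [abs_mul, abs_mul, abs_two]
      gcongr
      · exact (hK _).2.1
      · exact hdb _ _
    · rw [abs_mul, abs_div, abs_of_pos (hS0 n)]
      refine mul_le_mul (hAb _ _) ?_ (by positivity) (by positivity)
      refine (div_le_self (abs_nonneg _) ?_).trans (hK _).2.2
      simp only [hS]
      linarith [(Nat.cast_nonneg n : (0 : ℝ) ≤ n)]
  · intro n x hx
    rw [hgen]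
    have h1 : A (sph x.1 x.2) = 0 := by simp [hA, backwardTest, sph, h0 _ hx]
    have h2 : dq A (sph x.1 x.2) = 0 := by
      rw [hA, dq_backwardTest hm hθ hb hc h0]
      exact mul_eq_zero_of_right _ h1
    have h3 : gen A (sph x.1 x.2) = 0 := by
      rw [sph, hA, gen_backwardTest hm hθ hb hc h0, deriv_eq_zero_of_lt h0 hx]
      simp
    rw [h1, h2, h3]
    simp
  · refine ae_of_all _ fun x => tendsto_const_nhds.congr' ?_
    filter_upwards [eventually_ge_atTop ⌈‖x.2‖⌉₊] with n hn
    have hlt : |‖x.2‖ / S n| < 1 := by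
      rw [abs_of_nonneg (div_nonneg (norm_nonneg _) (hS0 n).le), div_lt_one (hS0 n)]
      have := Nat.le_of_ceil_le hn
      simp only [hS]
      linarith
    rw [hgen, cutoff_eq_one hlt.le, cutoff'_eq_zero (Or.inl hlt), cutoffL_eq_zero (Or.inl hlt)]
    ring

/-- A compactly supported function on `(0, 1/m)` is, on `t > 0`, the derivative of an admissible
time cutoff. -/
lemma exists_time_primitive {a : ℝ} (ha : 0 < a) {η : ℝ → ℝ} (hη : ContDiff ℝ ∞ η)
    (hηc : HasCompactSupport η) (hηs : tsupport η ⊆ Ioo 0 a) :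
    ∃ (θ : ℝ → ℝ) (c : ℝ), ContDiff ℝ ∞ θ ∧ HasCompactSupport θ ∧ c < a ∧
      (∀ t, c < t → θ t = 0) ∧ ∀ t, 0 < t → deriv θ t = η t := by
  obtain ⟨c, hc0, hca, hc⟩ : ∃ c, 0 < c ∧ c < a ∧ ∀ t, c < t → η t = 0 := by
    rcases (tsupport η).eq_empty_or_nonempty with he | hne
    · refine ⟨a / 2, by positivity, by linarith, fun t _ => ?_⟩
      exact image_eq_zero_of_notMem_tsupport (by simp [he])
    · obtain ⟨c, hc, hmax⟩ := hηc.isCompact.exists_isGreatest hne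
      refine ⟨c, (hηs hc).1, (hηs hc).2, fun t ht => image_eq_zero_of_notMem_tsupport ?_⟩
      intro hmem
      exact absurd (hmax hmem) (not_le.2 ht)
  -- Based at `a`, beyond the support of `η`, the primitive vanishes for `t > c`. It may be a
  -- nonzero constant for negative times, which the factor `cutoff (t / a)` truncates without
  -- changing it on `(0, a)`.
  set θ₀ : ℝ → ℝ := fun t => ∫ s in a..t, η s with hθ₀
  have hd : ∀ t, HasDerivAt θ₀ (η t) t := fun t =>
    intervalIntegral.integral_hasDerivAt_right (hη.continuous.intervalIntegrable _ _)
      (hη.continuous.stronglyMeasurableAtFilter _ _) hη.continuous.continuousAt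
  have hθ₀s : ContDiff ℝ ∞ θ₀ := by
    rw [contDiff_infty_iff_deriv]
    refine ⟨fun t => (hd t).differentiableAt, ?_⟩
    rw [show deriv θ₀ = η from funext fun t => (hd t).deriv]
    exact hη
  have hθ₀0 : ∀ t, c < t → θ₀ t = 0 := by
    intro t ht
    refine intervalIntegral.integral_zero_ae (ae_of_all _ fun s hs => hc s ?_)
    exact (lt_min hca ht).trans hs.1
  refine ⟨fun t => θ₀ t * cutoff (t / a), c, hθ₀s.mul (contDiff_cutoff.comp (by fun_prop)), ?_,
    hca, fun t ht => by simp [hθ₀0 t ht], ?_⟩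
  · refine HasCompactSupport.intro (isCompact_closedBall (0 : ℝ) (2 * a)) fun t ht => ?_
    rw [cutoff_div_eq_zero ha (by simpa using ht), mul_zero]
  · intro t ht
    rcases lt_or_ge t a with hta | hta
    · have : (fun t => θ₀ t * cutoff (t / a)) =ᶠ[𝓝 t] θ₀ := by
        filter_upwards [lt_mem_nhds ht, gt_mem_nhds hta] with s hs hs'
        rw [cutoff_eq_one, mul_one]
        rw [abs_of_pos (div_pos hs ha), div_le_one ha]
        exact le_of_lt hs'
      rw [this.deriv_eq, (hd t).deriv]
    · have hct : c < t := hca.trans_le hta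
      rw [deriv_eq_zero_of_lt (c := c) (fun s hs => by simp [hθ₀0 s hs]) hct, hc t hct]

lemma measurable_backward (m : ℝ) : Measurable fun x : ℝ × ℝ => backward m x.1 x.2 := by
  unfold backward; fun_prop

lemma MemLinftyL1.integrable_mul_backward {h : ℝ → Mom → ℝ} (hh : MemLinftyL1 h) {m : ℝ}
    (hm : 0 < m) {η : ℝ → ℝ} (hη : Measurable η) {C c : ℝ} (hC0 : 0 ≤ C)
    (hC : ∀ t, |η t| ≤ C) (hc : m * c < 1) (h0 : ∀ t, c < t → η t = 0) (α : Fin 3 → ℕ) :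
    Integrable (fun x : ℝ × Mom => h x.1 x.2 *
      (η x.1 * backward m x.1 ‖x.2‖ * mono α (‖x.2‖⁻¹ • x.2))) spaceTime := by
  have hδ0 : 0 < 1 - m * c := by linarith
  have hmb : Measurable fun x : ℝ × Mom => backward m x.1 ‖x.2‖ :=
    (measurable_backward m).comp (f := fun x : ℝ × Mom => (x.1, ‖x.2‖)) (by fun_prop)
  have hmm : Measurable fun x : ℝ × Mom => mono α (‖x.2‖⁻¹ • x.2) :=
    (contDiff_mono α).continuous.measurable.comp (by fun_prop)
  refine hh.integrable_mul (C := C * (1 - m * c)⁻¹ ^ 3) (T := c)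
    (Measurable.aestronglyMeasurable (by fun_prop)) (ae_of_all _ fun x => ?_)
    (fun x hx => by rw [h0 _ hx]; ring)
  rcases le_or_gt x.1 c with ht | ht
  · have hs : 1 - m * c ≤ 1 - m * x.1 := by nlinarith
    have hb0 := backward_nonneg (hδ0.le.trans hs) ‖x.2‖
    rw [abs_mul, abs_mul, abs_of_nonneg hb0]
    refine (mul_le_of_le_one_right (mul_nonneg (abs_nonneg _) hb0)
      (abs_mono_le α (norm_inv_smul_le_one _))).trans ?_
    exact mul_le_mul (hC _) (backward_le hm.le hδ0 hs (norm_nonneg _)) hb0 hC0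
  · rw [h0 _ ht]
    simp only [zero_mul, abs_zero]
    positivity

/-- Two weak solutions have the same exponential moments at almost every time. -/
lemma ae_backward_moment_eq {gin : Mom → ℝ} (hi : Integrable gin) {h₁ h₂ : ℝ → Mom → ℝ}
    (hh₁ : IsWeakSolution IsSphericalTest gin h₁) (hh₂ : IsWeakSolution IsSphericalTest gin h₂)
    {m : ℝ} (hm : 0 < m) (α : Fin 3 → ℕ) :
    ∀ᵐ t : ℝ, t ∈ Ioo 0 (1 / m) →
      (∫ p, h₁ t p * (backward m t ‖p‖ * mono α (‖p‖⁻¹ • p)))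
        - ∫ p, h₂ t p * (backward m t ‖p‖ * mono α (‖p‖⁻¹ • p)) = 0 := by
  have hslice : ∀ {h : ℝ → Mom → ℝ}, MemLinftyL1 h → ∀ {η : ℝ → ℝ} {C c : ℝ}, Measurable η →
      0 ≤ C → (∀ t, |η t| ≤ C) → m * c < 1 → (∀ t, c < t → η t = 0) →
      IntegrableOn (fun t => η t * ∫ p, h t p * (backward m t ‖p‖ * mono α (‖p‖⁻¹ • p))) (Ioi 0) ∧
      ∫ t in Ioi (0 : ℝ), η t * ∫ p, h t p * (backward m t ‖p‖ * mono α (‖p‖⁻¹ • p))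
        = ∫ x, h x.1 x.2 * (η x.1 * backward m x.1 ‖x.2‖ * mono α (‖x.2‖⁻¹ • x.2))
          ∂spaceTime := by
    intro h hh η C c hη hC0 hC hc h0
    have hI := hh.integrable_mul_backward hm hη hC0 hC hc h0 α
    have heq : (fun t => η t * ∫ p, h t p * (backward m t ‖p‖ * mono α (‖p‖⁻¹ • p)))
        = fun t => ∫ p, h t p * (η t * backward m t ‖p‖ * mono α (‖p‖⁻¹ • p)) := by
      funext t
      rw [← integral_const_mul]
      refine integral_congr_ae (ae_of_all _ fun p => ?_)
      simp only
      ring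
    rw [heq]
    exact ⟨hI.integral_prod_left, (integral_prod _ hI).symm⟩
  have hcompact : ∀ {h : ℝ → Mom → ℝ}, MemLinftyL1 h → ∀ K ⊆ Ioo 0 (1 / m), IsCompact K →
      IntegrableOn (fun t => ∫ p, h t p * (backward m t ‖p‖ * mono α (‖p‖⁻¹ • p))) K := by
    intro h hh K hK hKc
    rcases K.eq_empty_or_nonempty with rfl | hne
    · simp
    obtain ⟨c, hcK, hmax⟩ := hKc.exists_isGreatest hne
    have hc : m * c < 1 := by
      have := (hK hcK).2
      rw [lt_div_iff₀ hm] at this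
      linarith
    -- The indicator of `K` is an admissible weight: the threshold `c` is the largest point of `K`
    -- and lies below `1/m`.
    have h1 := (hslice hh (η := K.indicator fun _ => 1) (C := 1) (c := c)
      (measurable_const.indicator hKc.measurableSet) zero_le_one (fun t => by
        by_cases ht : t ∈ K <;> simp [ht]) hc (fun t ht => by
        refine indicator_of_notMem (fun hmem => ?_) _
        exact absurd (hmax hmem) (not_le.2 ht))).1
    have h2 : IntegrableOn (fun t => K.indicator (fun _ => (1 : ℝ)) t *
        ∫ p, h t p * (backward m t ‖p‖ * mono α (‖p‖⁻¹ • p))) K :=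
      h1.mono_set fun t ht => (hK ht).1
    refine h2.congr_fun (fun t ht => ?_) hKc.measurableSet
    simp [ht]
  -- Fundamental lemma of the calculus of variations: each `η` is the derivative of an admissible
  -- time cutoff `θ`, and `backward_identity` gives both solutions the same integral, depending only
  -- on `gin` and `θ 0`.
  refine isOpen_Ioo.ae_eq_zero_of_integral_contDiff_smul_eq_zero ?_ ?_
  · rw [locallyIntegrableOn_iff isOpen_Ioo.isLocallyClosed]
    intro K hK hKc
    exact (hcompact hh₁.1 K hK hKc).sub (hcompact hh₂.1 K hK hKc)
  · intro η hη hηc hηs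
    obtain ⟨θ, c, hθ, hθc, hca, h0, hderiv⟩ := exists_time_primitive (by positivity) hη hηc hηs
    have hc : m * c < 1 := by
      rw [lt_div_iff₀ hm] at hca
      linarith
    obtain ⟨C, hC0, hC⟩ := exists_bound_of_hasCompactSupport hη.continuous hηc
    -- `deriv θ = η` is available only for `t > 0`, hence the threshold `max c 0`.
    have hη0 : ∀ t, max c 0 < t → η t = 0 := fun t ht => by
      rw [← hderiv t ((le_max_right _ _).trans_lt ht)]
      exact deriv_eq_zero_of_lt h0 ((le_max_left _ _).trans_lt ht)
    have hc' : m * max c 0 < 1 := by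
      rw [mul_max_of_nonneg _ _ hm.le]
      exact max_lt hc (by simp)
    have key : ∀ {h : ℝ → Mom → ℝ}, IsWeakSolution IsSphericalTest gin h →
        ∫ t in Ioi (0 : ℝ), η t * ∫ p, h t p * (backward m t ‖p‖ * mono α (‖p‖⁻¹ • p))
          = -∫ p, gin p * (θ 0 * backward m 0 ‖p‖ * mono α (‖p‖⁻¹ • p)) := by
      intro h hh
      rw [(hslice hh.1 hη.continuous.measurable hC0 hC hc' hη0).2, eq_neg_iff_add_eq_zero]
      refine Eq.trans ?_ (hh.backward_identity hi hm hθ hθc hc h0 α)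
      congr 1
      refine integral_congr_ae ?_
      filter_upwards [ae_spaceTime] with x hx
      rw [hderiv _ hx.1]
    have hsupp : ∫ t, η t • ((∫ p, h₁ t p * (backward m t ‖p‖ * mono α (‖p‖⁻¹ • p)))
        - ∫ p, h₂ t p * (backward m t ‖p‖ * mono α (‖p‖⁻¹ • p)))
        = ∫ t in Ioi (0 : ℝ), η t • ((∫ p, h₁ t p * (backward m t ‖p‖ * mono α (‖p‖⁻¹ • p)))
        - ∫ p, h₂ t p * (backward m t ‖p‖ * mono α (‖p‖⁻¹ • p))) := by
      symm
      refine setIntegral_eq_integral_of_forall_compl_eq_zero fun t ht => ?_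
      rw [image_eq_zero_of_notMem_tsupport (fun hmem => ht (hηs hmem).1), zero_smul]
    rw [hsupp]
    simp only [smul_eq_mul, mul_sub]
    rw [integral_sub (hslice hh₁.1 hη.continuous.measurable hC0 hC hc' hη0).1
      (hslice hh₂.1 hη.continuous.measurable hC0 hC hc' hη0).1, key hh₁, key hh₂, sub_self]

/-- Exponential moments at a countable dense set of rates determine all integer ones. -/
lemma moments_eq_zero_of_rational {d : Mom → ℝ} (hd : Integrable d) {t : ℝ} (ht : 0 < t)
    (α : Fin 3 → ℕ) (h : ∀ r : ℚ, 0 < (r : ℝ) → (r : ℝ) * t < 1 →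
      ∫ p, d p * (Real.exp (-(r * (1 - r * t)⁻¹ * ‖p‖)) * mono α (‖p‖⁻¹ • p)) = 0) (n : ℕ) :
    ∫ p, d p * (Real.exp (-(n * ‖p‖)) * mono α (‖p‖⁻¹ • p)) = 0 := by
  -- The solution of `m/(1 - mt) = n`.
  set m₀ : ℝ := n / (1 + n * t) with hm₀
  have hden : 0 < 1 + n * t := by positivity
  have hm₀0 : 0 ≤ m₀ := by positivity
  have hm₀1 : m₀ < 1 / t := by
    rw [hm₀, div_lt_div_iff₀ hden ht]
    linarith
  have hn : (n : ℝ) = m₀ * (1 - m₀ * t)⁻¹ := by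
    have : 1 - m₀ * t = (1 + n * t)⁻¹ := by
      rw [hm₀]
      field_simp
      ring
    rw [this, inv_inv, hm₀]
    field_simp
  set I : ℝ → ℝ := fun m =>
    ∫ p, d p * (Real.exp (-(m * (1 - m * t)⁻¹ * ‖p‖)) * mono α (‖p‖⁻¹ • p)) with hI
  -- The limit is taken from the right because `m₀ = 0` when `n = 0`, while the hypothesis concerns
  -- positive rates.
  have hlim : Tendsto I (𝓝[>] m₀) (𝓝 (I m₀)) := by
    refine tendsto_integral_filter_of_dominated_convergence (fun p => ‖d p‖) ?_ ?_ hd.norm ?_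
    · refine Eventually.of_forall fun m => hd.1.mul (Measurable.aestronglyMeasurable ?_)
      have hmm : Measurable fun p : Mom => mono α (‖p‖⁻¹ • p) :=
        (contDiff_mono α).continuous.measurable.comp (by fun_prop)
      fun_prop
    · filter_upwards [Ioo_mem_nhdsGT hm₀1] with m hm
      refine ae_of_all _ fun p => ?_
      have hm0 : 0 ≤ m := hm₀0.trans hm.1.le
      have hm1 : 0 < 1 - m * t := by
        have := hm.2
        rw [lt_div_iff₀ ht] at this
        linarith
      rw [norm_mul, norm_mul, Real.norm_eq_abs (mono _ _), Real.norm_of_nonneg (Real.exp_nonneg _)]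
      refine mul_le_of_le_one_right (norm_nonneg _) (mul_le_one₀ ?_ (abs_nonneg _)
        (abs_mono_le α (norm_inv_smul_le_one p)))
      exact Real.exp_le_one_iff.2 (neg_nonpos.2 (by positivity))
    · refine ae_of_all _ fun p => ?_
      have hne : 1 - m₀ * t ≠ 0 := by
        rw [lt_div_iff₀ ht] at hm₀1
        linarith
      have hc : ContinuousAt (fun m : ℝ => d p * (Real.exp (-(m * (1 - m * t)⁻¹ * ‖p‖)) *
          mono α (‖p‖⁻¹ • p))) m₀ := by
        fun_prop (disch := assumption)
      exact hc.tendsto.mono_left nhdsWithin_le_nhds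
  have hfreq : ∃ᶠ m in 𝓝[>] m₀, I m = 0 := by
    rw [frequently_iff]
    intro U hU
    obtain ⟨u, hu, hsub⟩ := (mem_nhdsGT_iff_exists_Ioo_subset' hm₀1).1 hU
    have hlt : m₀ < min u (1 / t) := lt_min hu hm₀1
    obtain ⟨r, hr1, hr2⟩ := exists_rat_btwn hlt
    refine ⟨r, hsub ⟨hr1, hr2.trans_le (min_le_left _ _)⟩, h r (hm₀0.trans_lt hr1) ?_⟩
    have := hr2.trans_le (min_le_right _ _)
    rwa [lt_div_iff₀ ht] at this
  have hzero : I m₀ = 0 := by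
    by_contra hne
    exact hfreq (hlim.eventually_ne hne)
  rw [hn]
  exact hzero

/-- Rational rates and multi-indices are countable, so one null set of times serves all moments. At
each remaining time continuity in the rate recovers the integer moments, and these determine the
difference. -/
lemma IsWeakSolution.unique {gin : Mom → ℝ} (hi : Integrable gin) {h₁ h₂ : ℝ → Mom → ℝ}
    (hh₁ : IsWeakSolution IsSphericalTest gin h₁) (hh₂ : IsWeakSolution IsSphericalTest gin h₂) :
    ∀ᵐ t ∂(volume.restrict (Ioi (0 : ℝ))), h₁ t =ᵐ[volume] h₂ t := by
  have hall : ∀ᵐ t : ℝ, ∀ (r : ℚ) (α : Fin 3 → ℕ), 0 < (r : ℝ) → t ∈ Ioo 0 (1 / (r : ℝ)) →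
      (∫ p, h₁ t p * (backward r t ‖p‖ * mono α (‖p‖⁻¹ • p)))
        - ∫ p, h₂ t p * (backward r t ‖p‖ * mono α (‖p‖⁻¹ • p)) = 0 := by
    rw [ae_all_iff]
    intro r
    rw [ae_all_iff]
    intro α
    by_cases hr : 0 < (r : ℝ)
    · filter_upwards [ae_backward_moment_eq hi hh₁ hh₂ hr α] with t ht _ using ht
    · exact ae_of_all _ fun t h => absurd h hr
  obtain ⟨-, C₁, hC₁⟩ := hh₁.1
  obtain ⟨-, C₂, hC₂⟩ := hh₂.1
  filter_upwards [ae_restrict_of_ae hall, hC₁, hC₂, ae_restrict_mem measurableSet_Ioi]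
    with t hmom hi₁ hi₂ ht
  have ht : 0 < t := ht
  have hd : Integrable (fun p => h₁ t p - h₂ t p) := hi₁.1.sub hi₂.1
  have hz := ae_eq_zero_of_moments hd fun n α => by
    refine moments_eq_zero_of_rational hd ht α (fun r hr hrt => ?_) n
    have hs : 0 < 1 - (r : ℝ) * t := by linarith
    have h1 := hmom r α hr ⟨ht, by rw [lt_div_iff₀ hr]; linarith⟩
    have hmm : Measurable fun p : Mom => mono α (‖p‖⁻¹ • p) :=
      (contDiff_mono α).continuous.measurable.comp (by fun_prop)
    have hint : ∀ {f : Mom → ℝ}, Integrable f →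
        Integrable fun p => f p * (backward r t ‖p‖ * mono α (‖p‖⁻¹ • p)) := by
      intro f hf
      have hmb : Measurable fun p : Mom => backward r t ‖p‖ := by unfold backward; fun_prop
      refine hf.mul_bdd (c := (1 - (r : ℝ) * t)⁻¹ ^ 3)
        (Measurable.aestronglyMeasurable (by fun_prop)) (ae_of_all _ fun p => ?_)
      have hb0 := backward_nonneg hs.le ‖p‖
      rw [norm_mul, Real.norm_of_nonneg hb0, Real.norm_eq_abs]
      exact (mul_le_of_le_one_right hb0 (abs_mono_le α (norm_inv_smul_le_one p))).trans
        (backward_le hr.le hs le_rfl (norm_nonneg p))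
    rw [← integral_sub (hint hi₁.1) (hint hi₂.1)] at h1
    have h2 : (fun p => h₁ t p * (backward r t ‖p‖ * mono α (‖p‖⁻¹ • p))
        - h₂ t p * (backward r t ‖p‖ * mono α (‖p‖⁻¹ • p)))
        = fun p => (1 - (r : ℝ) * t)⁻¹ ^ 3 * ((h₁ t p - h₂ t p) *
          (Real.exp (-(r * (1 - r * t)⁻¹ * ‖p‖)) * mono α (‖p‖⁻¹ • p))) := by
      funext p
      rw [backward]
      ring
    rw [h2, integral_const_mul] at h1
    exact (mul_eq_zero.1 h1).resolve_left (by positivity)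
  filter_upwards [hz] with p hp
  exact sub_eq_zero.1 hp

/-! ### Null sets and conclusion -/

/-- The solution formula only depends on the initial datum up to null sets, uniformly in time. -/
lemma ae_ultraSol_eq_raySol {gin f : Mom → ℝ} (h : gin =ᵐ[volume] f) :
    ∀ᵐ p : Mom, ∀ t : ℝ, 0 < t → ultraSol gin t p = raySol f t p := by
  filter_upwards [ae_ae_ray h, ae_ne_zero_Mom] with p hp hp0 t ht
  rw [ultraSol_eq gin ht hp0, raySol]
  refine integral_congr_ae ?_
  filter_upwards [hp] with z hz
  rw [hz]

/-- The quantifier over `t` stands inside the almost everywhere statement in `p`. Agreement almost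
everywhere on the product thus follows with no measurability assumption on `k`. -/
lemma IsWeakSolution.congr {T : (ℝ → Mom → ℝ) → Prop} {gin f : Mom → ℝ} {g k : ℝ → Mom → ℝ}
    (h : IsWeakSolution T gin g) (hf : gin =ᵐ[volume] f)
    (hk : ∀ᵐ p : Mom, ∀ t : ℝ, 0 < t → g t p = k t p) : IsWeakSolution T f k := by
  have hslice : ∀ t : ℝ, 0 < t → g t =ᵐ[volume] k t := fun t ht => by
    filter_upwards [hk] with p hp using hp t ht
  obtain ⟨⟨hm, C, hC⟩, hw⟩ := h
  refine ⟨⟨hm.congr ?_, C, ?_⟩, fun φ hφ => ?_⟩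
  · have h1 : ∀ᵐ x ∂((volume.restrict (Ioi (0 : ℝ))).prod (volume : Measure Mom)), 0 < x.1 :=
      Measure.quasiMeasurePreserving_fst.ae (ae_restrict_mem measurableSet_Ioi)
    have h2 : ∀ᵐ x ∂((volume.restrict (Ioi (0 : ℝ))).prod (volume : Measure Mom)),
        ∀ t : ℝ, 0 < t → g t x.2 = k t x.2 := Measure.quasiMeasurePreserving_snd.ae hk
    filter_upwards [h1, h2] with x hx hx' using hx' _ hx
  · filter_upwards [hC, ae_restrict_mem measurableSet_Ioi] with t ht ht0
    have he := hslice t ht0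
    refine ⟨ht.1.congr he, le_of_eq_of_le (integral_congr_ae ?_) ht.2⟩
    filter_upwards [he] with p hp
    rw [hp]
  · refine Eq.trans ?_ (hw φ hφ)
    congr 1
    · refine setIntegral_congr_fun measurableSet_Ioi fun t ht => integral_congr_ae ?_
      filter_upwards [hslice t ht] with p hp
      rw [hp]
    · refine integral_congr_ae ?_
      filter_upwards [hf] with p hp
      rw [hp]

end UltraFP

end

theorem proposition3 (gin : UltraFP.Mom → ℝ) (hint : Integrable gin)
    (hnonneg : ∀ᵐ p, 0 ≤ gin p) :
    -- the integral in the formula converges, and the formula defines a nonnegative function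
    (∀ t : ℝ, 0 < t → ∀ᵐ p : UltraFP.Mom,
      IntegrableOn (UltraFP.solIntegrand gin t ‖p‖ (‖p‖⁻¹ • p)) (Ioi 0) ∧
        0 ≤ UltraFP.ultraSol gin t p) ∧
    -- which is a global solution
    UltraFP.IsWeakSolution UltraFP.IsSphericalTest gin (UltraFP.ultraSol gin) ∧
    UltraFP.IsWeakSolution UltraFP.IsTest gin (UltraFP.ultraSol gin) ∧
    -- and the only one
    (∀ h : ℝ → UltraFP.Mom → ℝ, UltraFP.IsWeakSolution UltraFP.IsSphericalTest gin h →
      ∀ᵐ t ∂(volume.restrict (Ioi (0 : ℝ))), h t =ᵐ[volume] UltraFP.ultraSol gin t) ∧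
    (∀ h : ℝ → UltraFP.Mom → ℝ, UltraFP.IsWeakSolution UltraFP.IsTest gin h →
      (∀ᵐ t ∂(volume.restrict (Ioi (0 : ℝ))), ∀ᵐ p, 0 ≤ h t p) →
      ∀ᵐ t ∂(volume.restrict (Ioi (0 : ℝ))), h t =ᵐ[volume] UltraFP.ultraSol gin t) ∧
    -- the norm estimates
    (∀ γ : ℝ≥0∞, 1 ≤ γ → MemLp gin γ → ∀ t : ℝ, 0 < t →
      MemLp (UltraFP.ultraSol gin t) γ ∧
        eLpNorm (UltraFP.ultraSol gin t) γ ≤ eLpNorm gin γ) ∧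
    (∀ t : ℝ, 0 < t → eLpNorm (UltraFP.ultraSol gin t) 1 = eLpNorm gin 1) := by
  -- The datum is replaced by a Borel version that is nonnegative everywhere; the formula changes
  -- only on a null set of `p` independent of `t`.
  obtain ⟨f, hfm, hf0, hfae⟩ : ∃ f : UltraFP.Mom → ℝ, Measurable f ∧ (∀ p, 0 ≤ f p) ∧
      gin =ᵐ[volume] f := by
    refine ⟨fun p => max (hint.1.mk gin p) 0,
      hint.1.stronglyMeasurable_mk.measurable.max measurable_const, fun p => le_max_right _ _, ?_⟩
    filter_upwards [hint.1.ae_eq_mk, hnonneg] with p hp hp0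
    rw [← hp, max_eq_left hp0]
  have hfi : Integrable f := hint.congr hfae
  have hsol := UltraFP.ae_ultraSol_eq_raySol hfae
  have hslice : ∀ t : ℝ, 0 < t → UltraFP.ultraSol gin t =ᵐ[volume] UltraFP.raySol f t :=
    fun t ht => by filter_upwards [hsol] with p hp using hp t ht
  have hweak : UltraFP.IsWeakSolution UltraFP.IsSphericalTest gin (UltraFP.ultraSol gin) := by
    refine (UltraFP.isWeakSolution_raySol hfm hfi).congr hfae.symm ?_
    filter_upwards [hsol] with p hp t ht using (hp t ht).symm
  refine ⟨fun t ht => ?_, hweak, hweak.isTest, fun h hh => hh.unique hint hweak,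
    fun h hh h0 => (hh.isSphericalTest hint h0).unique hint hweak, fun γ hγ hg t ht => ?_,
    fun t ht => ?_⟩
  · filter_upwards [hslice t ht, (UltraFP.integrable_ray_integrand hfm hfi ht).prod_right_ae,
      UltraFP.ae_ae_ray hfae, UltraFP.ae_ne_zero_Mom] with p hp hpi hray hp0
    refine ⟨(UltraFP.integrableOn_solIntegrand_iff gin ht hp0).2 (hpi.congr ?_), ?_⟩
    · filter_upwards [hray] with z hz
      rw [hz]
    · rw [hp]
      exact UltraFP.raySol_nonneg hf0 ht p
  · have hle : eLpNorm (UltraFP.ultraSol gin t) γ ≤ eLpNorm gin γ := by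
      rw [eLpNorm_congr_ae (hslice t ht), eLpNorm_congr_ae hfae]
      exact UltraFP.eLpNorm_raySol_le hfm hγ ht
    exact ⟨⟨(UltraFP.integrable_raySol hfm hfi ht).1.congr (hslice t ht).symm,
      hle.trans_lt hg.2⟩, hle⟩
  · rw [eLpNorm_congr_ae (hslice t ht), eLpNorm_congr_ae hfae]
    exact UltraFP.eLpNorm_one_raySol hfm hfi hf0 ht
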